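/- **Theorem (Minimax lower bound).** Let $d\ge 1$, $\beta,L>0$, $\alpha\in(0,1)$, and for every $n$ let $m=m_n\le n$ with $0<\liminf_n m/n\le\limsup_n m/n<1$. *Notation.* Let $\lfloor\beta\rfloor$ denote the largest integer strictly smaller than $\beta$. For a convex set $I\subset\mathbb{R}^d$ with nonempty interior, $\mathcal{H}_d(\beta,L;I)$ is the set of all $\lfloor\beta\rfloor$ times continuously differentiable $f:I\to\mathbb{R}$ with $|f(x)-P_y^{(f)}(x)|\le L\|x-y\|_2^{\beta}$ for all $x,y\in I$, where $P_y^{(f)}$ is the Taylor polynomial of $f$ at $y$ of order $\lfloor\beta\rfloor$ (for $\beta\le 1$: $|f(x)-f(y)|\le L\|x-y\|_2^\beta$). For probability densities $p,q$ on $[0,1]^d$ put $$h(m,n,p,q)=\tfrac mn\,p+\bigl(1-\tfrac mn\bigr)q,\qquad \phi=\phi(m,n,p,q)=\frac{p-q}{\sqrt{h(m,n,p,q)}},$$ and for a continuous density $h>0$ on $[0,1]^d$ let $\mathcal{F}^{(m,n)}_{h}(\beta,L)$ be the set of all pairs of densities $(p,q)$ on $[0,1]^d$ with $h(m,n,p,q)=h$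 and $\phi(m,n,p,q)\in\mathcal{H}_d(\beta,L;[0,1]^d)$. Let $\mathbb{E}_{(m,n,p,q)}$ be the expectation when $X_1,\dots,X_n$ are independent, $X_1,\dots,X_m$ having density $p$ and $X_{m+1},\dots,X_n$ having density $q$. Write $\|\phi\|_J=\sup_{x\in J}|\phi(x)|$. *Statement.* The optimal recovery problem $$\text{minimize } \|\gamma\|_{2}=\Bigl(\int_{\mathbb{R}^d}\gamma^2\Bigr)^{1/2}\ \text{ over all } \gamma\in\mathcal{H}_d(\beta,1;\mathbb{R}^d) \text{ with } \gamma(0)\ge 1$$ has a solution in $L^2(\mathbb{R}^d)$. Let $\gamma_\beta$ be a solution, and put $$\rho_{m,n}=\Bigl(\frac{n\log n}{m(n-m)}\Bigr)^{\beta/(2\beta+d)},\qquad c(\beta,L)=\Bigl(\frac{2d\,L^{d/\beta}}{(2\beta+d)\|\gamma_\beta\|_2^2}\Bigr)^{\beta/(2\beta+d)}.$$ Let $(h_n)$ be a sequence of probability densities on $[0,1]^d$ that is equicontinuous and uniformly bounded away from zero. Then for every $\delta>0$, every nondegenerate axis-parallel rectangle $J\subset[0,1]^d$ and every sequence of tests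 $\psi_n:(\mathbb{R}^d)^n\to[0,1]$ (measurable; $\psi_n$ may depend on $h_n,\beta,L$) with $\mathbb{E}_{(m,n,h_n,h_n)}\psi_n\le\alpha$ for all $n$, $$\limsup_{n\to\infty}\ \inf_{\substack{(p,q)\in\mathcal{F}^{(m,n)}_{h_n}(\beta,L):\\ \|\phi\|_J\ge(1-\delta)c(\beta,L)\rho_{m,n}}}\mathbb{E}_{(m,n,p,q)}\psi_n\ \le\ \alpha,$$ where the infimum over the empty set is $+\infty$. -/

import Mathlib

open MeasureTheory Filter Topology

noncomputable section

namespace TwoSample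

/-- The sample space of one observation: `ℝ^d` with the Euclidean norm. -/
abbrev Euc (d : ℕ) : Type := EuclideanSpace ℝ (Fin d)

/-- The unit cube `[0,1]^d`. -/
def unitCube (d : ℕ) : Set (Euc d) := {x | ∀ i, x i ∈ Set.Icc (0 : ℝ) 1}

/-- Nondegenerate axis-parallel rectangles: products of intervals (open, closed or half-open),
each with more than one point. -/
def IsNondegenerateRectangle {d : ℕ} (J : Set (Euc d)) : Prop :=
  ∃ I : Fin d → Set ℝ, (∀ i, (I i).OrdConnected ∧ (I i).Nontrivial) ∧ J = {x | ∀ i, x i ∈ I i}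

/-- The largest integer strictly smaller than `β` (for `β > 0`). -/
def strictFloor (β : ℝ) : ℕ := ⌈β⌉₊ - 1

/-- The Taylor polynomial of order `k` of `f : I → ℝ` at the point `y`, evaluated at `x`. -/
def taylorPoly {d : ℕ} (k : ℕ) (f : Euc d → ℝ) (I : Set (Euc d)) (y x : Euc d) : ℝ :=
  ∑ j ∈ Finset.range (k + 1),
    ((j.factorial : ℝ))⁻¹ * iteratedFDerivWithin ℝ j f I y (fun _ => x - y)

/-- The isotropic Hölder class `H_d(β, L; I)` for convex `I` with nonempty interior. Functions on
`I` are represented by functions on `ℝ^d`; only their values on `I` matter. For `β ≤ 1` this is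
`|f x - f y| ≤ L ‖x - y‖ ^ β` on `I`, see `mem_holderClass_iff_of_le_one`. -/
def holderClass {d : ℕ} (β L : ℝ) (I : Set (Euc d)) : Set (Euc d → ℝ) :=
  {f | ContDiffOn ℝ (strictFloor β : ℕ) f I ∧
    ∀ x ∈ I, ∀ y ∈ I, |f x - taylorPoly (strictFloor β) f I y x| ≤ L * ‖x - y‖ ^ β}

/-- For `0 < β ≤ 1` the Hölder class is given by the usual Hölder condition. -/
theorem mem_holderClass_iff_of_le_one {d : ℕ} {β L : ℝ} (hβ : 0 < β) (hβ1 : β ≤ 1)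
    (I : Set (Euc d)) (f : Euc d → ℝ) :
    f ∈ holderClass β L I ↔ ∀ x ∈ I, ∀ y ∈ I, |f x - f y| ≤ L * ‖x - y‖ ^ β := by
  have hk : strictFloor β = 0 := by
    have : ⌈β⌉₊ ≤ 1 := Nat.ceil_le.2 (by simpa using hβ1)
    unfold strictFloor; omega
  have ht : ∀ x y, taylorPoly 0 f I y x = f y := by
    intro x y; simp [taylorPoly]
  simp only [holderClass, hk, Set.mem_ofPred_eq, ht, and_iff_right_iff_imp]
  intro h
  simp only [Nat.cast_zero, contDiffOn_zero]
  intro y hy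
  have hlim : Tendsto (fun x => L * ‖x - y‖ ^ β) (𝓝[I] y) (𝓝 0) := by
    have hc : Continuous fun x : Euc d => L * ‖x - y‖ ^ β :=
      continuous_const.mul
        ((continuous_norm.comp (continuous_id.sub continuous_const)).rpow_const
          fun _ => Or.inr hβ.le)
    have := (hc.tendsto y).mono_left (nhdsWithin_le_nhds (s := I))
    simpa [Real.zero_rpow hβ.ne'] using this
  rw [ContinuousWithinAt, tendsto_iff_norm_sub_tendsto_zero]
  refine squeeze_zero' (Eventually.of_forall fun _ => norm_nonneg _) ?_ hlim
  filter_upwards [self_mem_nhdsWithin] with x hx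
  simpa [Real.norm_eq_abs] using h x hx y hy

/-- `f` is a Lebesgue probability density on the unit cube. -/
def IsDensity {d : ℕ} (f : Euc d → ℝ) : Prop :=
  (∀ x ∈ unitCube d, 0 ≤ f x) ∧ IntegrableOn f (unitCube d) volume ∧
    ∫ x in unitCube d, f x = 1

/-- The mixed density `h(m,n,p,q) = (m/n) p + (1 - m/n) q`. -/
def mixedDensity {d : ℕ} (m n : ℕ) (p q : Euc d → ℝ) : Euc d → ℝ :=
  fun x => ((m : ℝ) / n) * p x + (1 - (m : ℝ) / n) * q x

/-- The reparametrized difference `φ(m,n,p,q) = (p - q) / √h(m,n,p,q)`. -/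
def phi {d : ℕ} (m n : ℕ) (p q : Euc d → ℝ) : Euc d → ℝ :=
  fun x => (p x - q x) / √(mixedDensity m n p q x)

/-- The class of pairs of densities `(p, q)` on the cube with mixed density `h` and
`φ(m,n,p,q) ∈ H_d(β, L; [0,1]^d)`. -/
def pairClass {d : ℕ} (m n : ℕ) (h : Euc d → ℝ) (β L : ℝ) :
    Set ((Euc d → ℝ) × (Euc d → ℝ)) :=
  {pq | IsDensity pq.1 ∧ IsDensity pq.2 ∧
    phi m n pq.1 pq.2 ∈ holderClass β L (unitCube d) ∧
    Set.EqOn (mixedDensity m n pq.1 pq.2) h (unitCube d)}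

/-- The supremum `‖f‖_J = sup_{x ∈ J} |f x|`. -/
def supOn {d : ℕ} (J : Set (Euc d)) (f : Euc d → ℝ) : ℝ := ⨆ x : J, |f x|

/-- The distribution on the cube with Lebesgue density `f`. -/
def densityLaw {d : ℕ} (f : Euc d → ℝ) : Measure (Euc d) :=
  (volume.restrict (unitCube d)).withDensity fun x => ENNReal.ofReal (f x)

/-- The joint distribution of the `n` independent observations, of which the first `m` have
density `p` and the others have density `q`. -/
def sampleLaw {d : ℕ} (m n : ℕ) (p q : Euc d → ℝ) : Measure (Fin n → Euc d) :=
  Measure.pi fun i => if (i : ℕ) < m then densityLaw p else densityLaw q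

/-- A (randomized) statistical test based on `n` observations. -/
def IsTest {d n : ℕ} (ψ : (Fin n → Euc d) → ℝ) : Prop :=
  Measurable ψ ∧ ∀ x, ψ x ∈ Set.Icc (0 : ℝ) 1

/-- The minimal power of the test `ψ` over all pairs in the class with mixed density `h` and
`‖φ‖_J ≥ r`. It is an extended real, so that the infimum over an empty class is `+∞`. -/
def minimalPower {d : ℕ} (m n : ℕ) (h : Euc d → ℝ) (β L : ℝ) (J : Set (Euc d)) (r : ℝ)
    (ψ : (Fin n → Euc d) → ℝ) : EReal :=
  ⨅ pq ∈ {pq ∈ pairClass m n h β L | r ≤ supOn J (phi m n pq.1 pq.2)},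
    ((∫ x, ψ x ∂(sampleLaw m n pq.1 pq.2) : ℝ) : EReal)

/-- The rate `ρ_{m,n} = (n log n / (m (n - m))) ^ (β / (2β + d))`. -/
def rate (d : ℕ) (β : ℝ) (m n : ℕ) : ℝ :=
  ((n : ℝ) * Real.log n / ((m : ℝ) * ((n : ℝ) - m))) ^ (β / (2 * β + d))

/-- `γ` solves the optimal recovery problem: it minimizes `‖γ‖₂` over all
`γ ∈ H_d(β, 1; ℝ^d)` with `γ(0) ≥ 1`. -/
def IsOptimalRecovery {d : ℕ} (β : ℝ) (γ : Euc d → ℝ) : Prop :=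
  γ ∈ holderClass β 1 Set.univ ∧ 1 ≤ γ 0 ∧ MemLp γ 2 volume ∧
    ∀ g ∈ holderClass (d := d) β 1 Set.univ, 1 ≤ g 0 → eLpNorm γ 2 volume ≤ eLpNorm g 2 volume

/-- The constant `c(β, L) = (2 d L^{d/β} / ((2β + d) ‖γ‖₂²)) ^ (β / (2β + d))`. -/
def sharpConst {d : ℕ} (β L : ℝ) (γ : Euc d → ℝ) : ℝ :=
  (2 * d * L ^ ((d : ℝ) / β) / ((2 * β + d) * (eLpNorm γ 2 volume).toReal ^ 2)) ^
    (β / (2 * β + d))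

end TwoSample

end

noncomputable section

namespace TwoSample

/-! ### Taylor remainders along lines and the algebra of Hölder classes -/

variable {d : ℕ}

/-! Lower bound. Put λ = m/n and T = m(n-m)/n. For φ with ∫ √h φ = 0 and G = φ/√h small, the
densities p = h(1 + (1-λ)G) and q = h(1 - λG) have mixed density h and normalized difference φ. The
alternatives take for φ one of N^d bumps A f((x - t_j)/b), centred by a small constant, where the
t_j form a grid in J and f is a compactly supported approximation of γ. Since G is divided by √h,
inner products of the G in L²(h dx) are Lebesgue inner products of the φ, so h drops out of the
leading terms and disjoint bumps are almost orthogonal.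

The likelihood ratio against (h, h) is ∏ (1 + c_k G(x_k)) with ∑ c_k² = T. Its moment of order 1 + s
is about exp(T (1+s)s/2 ∫φ²). With amplitude A ~ (log n/T)^{β/(2β+d)} and width b ~ (log
n/T)^{1/(2β+d)}, T∫φ² is about θ log n for a constant θ. A plain second moment bound for the average
of the ratios would need θ < d/(2β+d), the exponent of the largest possible number of bumps.
Truncating each ratio at K = n^κ₁ leaves the conditions θ/2 < κ₁ (lost mass) and κ₁ < κ₂ < d/(2β+d)
(variance of the average, with N^d about n^κ₂). This gains the factor two that makes the constant
sharp: `exists_integral_mul_likelihood_le`, `minimalPower_le_of_bumps`,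
`limsup_minimalPower_le_of_profile`. For a given height and Hölder constant the bump of smallest L²
norm is a rescaled γ, and solving θ/2 = d/(2β+d) for the height gives `sharpConst`
(`exists_profile`).

Existence of γ. It is the projection of 0 onto a nonempty closed convex set in L². Closedness rests
on interpolation: within a Hölder class, a small L² norm forces uniformly small derivatives up to
order `strictFloor β` (`exists_small_iteratedFDeriv`), so L² limits inherit smoothness and the
remainder bound. -/

theorem iteratedDeriv_line {f : Euc d → ℝ} {k : ℕ} (hf : ContDiff ℝ k f) (y v : Euc d)
    {j : ℕ} (hj : j ≤ k) :
    iteratedDeriv j (fun t : ℝ => f (y + t • v)) 0 = iteratedFDeriv ℝ j f y (fun _ => v) := by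
  have h1 : (fun t : ℝ => f (y + t • v)) =
      (fun z => f (y + z)) ∘ (ContinuousLinearMap.toSpanSingleton ℝ v) := by
    ext t; simp
  have hf' : ContDiff ℝ k (fun z => f (y + z)) := hf.comp (contDiff_const.add contDiff_id)
  rw [iteratedDeriv_eq_iteratedFDeriv, h1,
    ContinuousLinearMap.iteratedFDeriv_comp_right _ hf' _ (by exact_mod_cast hj)]
  simp only [ContinuousMultilinearMap.compContinuousLinearMap_apply,
    ContinuousLinearMap.toSpanSingleton_apply, one_smul, zero_smul]
  rw [iteratedFDeriv_comp_add_left]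
  simp

theorem contDiff_line {f : Euc d → ℝ} {k : ℕ} (hf : ContDiff ℝ k f) (y v : Euc d) :
    ContDiff ℝ k (fun t : ℝ => f (y + t • v)) :=
  hf.comp (contDiff_const.add (contDiff_id.smul contDiff_const))

/-- The remainder of the Taylor polynomial of order `k` of `f` at `y`, evaluated at `y + v`. -/
def taylorRem (k : ℕ) (f : Euc d → ℝ) (y v : Euc d) : ℝ :=
  f (y + v) - ∑ j ∈ Finset.range (k + 1), ((j.factorial : ℝ))⁻¹ * iteratedFDeriv ℝ j f y (fun _ => v)

theorem mem_holderClass_univ_iff {β L : ℝ} {f : Euc d → ℝ} :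
    f ∈ holderClass β L Set.univ ↔ ContDiff ℝ (strictFloor β : ℕ) f ∧
      ∀ y v, |taylorRem (strictFloor β) f y v| ≤ L * ‖v‖ ^ β := by
  simp only [holderClass, Set.mem_ofPred_eq, contDiffOn_univ, Set.mem_univ, true_imp_iff,
    taylorPoly, iteratedFDerivWithin_univ, taylorRem]
  refine and_congr_right fun _ => ⟨fun h y v => ?_, fun h x y => ?_⟩
  · simpa using h (y + v) y
  · simpa using h y (x - y)

theorem taylorRem_eq_line {f : Euc d → ℝ} {k : ℕ} (hf : ContDiff ℝ k f) (y v : Euc d) :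
    taylorRem k f y v = f (y + v) - ∑ j ∈ Finset.range (k + 1), ((j.factorial : ℝ))⁻¹ *
      iteratedDeriv j (fun t : ℝ => f (y + t • v)) 0 := by
  unfold taylorRem
  congr 1
  refine Finset.sum_congr rfl fun j hj => ?_
  rw [iteratedDeriv_line hf y v (Nat.lt_succ_iff.1 (Finset.mem_range.1 hj))]

/-- The remainder depends only on the restriction of the function to a line, and the substitution
carries the line through y in direction v to the line through c(y - t) in direction c v with the
same parameter. No chain rule for multilinear maps is needed. -/
theorem taylorRem_affine {f : Euc d → ℝ} {k : ℕ} (hf : ContDiff ℝ k f) (A c : ℝ) (t y v : Euc d) :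
    taylorRem k (fun x => A * f (c • (x - t))) y v = A * taylorRem k f (c • (y - t)) (c • v) := by
  have hF : ContDiff ℝ k (fun x => A * f (c • (x - t))) :=
    contDiff_const.mul (hf.comp (contDiff_id.sub contDiff_const |>.const_smul c))
  rw [taylorRem_eq_line hF, taylorRem_eq_line hf]
  have h1 : ∀ s : ℝ, c • (y + s • v - t) = c • (y - t) + s • (c • v) := by
    intro s; module
  have h2 : c • (y + v - t) = c • (y - t) + c • v := by module
  simp only [h1, h2, iteratedDeriv_const_mul_field, mul_sub, Finset.mul_sum]
  congr 1
  refine Finset.sum_congr rfl fun j _ => by ring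

theorem holderClass_affine {β L : ℝ} {f : Euc d → ℝ} (hf : f ∈ holderClass β L Set.univ)
    {A c : ℝ} (hA : 0 ≤ A) (hc : 0 ≤ c) (t : Euc d) :
    (fun x => A * f (c • (x - t))) ∈ holderClass β (A * L * c ^ β) Set.univ := by
  rw [mem_holderClass_univ_iff] at hf ⊢
  refine ⟨contDiff_const.mul (hf.1.comp (contDiff_id.sub contDiff_const |>.const_smul c)),
    fun y v => ?_⟩
  rw [taylorRem_affine hf.1, abs_mul, abs_of_nonneg hA]
  calc A * |_| ≤ A * (L * ‖c • v‖ ^ β) := mul_le_mul_of_nonneg_left (hf.2 _ _) hA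
    _ = _ := by
      rw [norm_smul, Real.norm_of_nonneg hc, Real.mul_rpow hc (norm_nonneg _)]; ring

theorem taylorRem_add {f g : Euc d → ℝ} {k : ℕ} (hf : ContDiff ℝ k f) (hg : ContDiff ℝ k g)
    (y v : Euc d) : taylorRem k (fun x => f x + g x) y v = taylorRem k f y v + taylorRem k g y v := by
  unfold taylorRem
  have : ∀ j ∈ Finset.range (k + 1), ((j.factorial : ℝ))⁻¹ *
      iteratedFDeriv ℝ j (fun x => f x + g x) y (fun _ => v) =
      ((j.factorial : ℝ))⁻¹ * iteratedFDeriv ℝ j f y (fun _ => v) +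
      ((j.factorial : ℝ))⁻¹ * iteratedFDeriv ℝ j g y (fun _ => v) := by
    intro j hj
    have hj' : (j : WithTop ℕ∞) ≤ k := by
      exact_mod_cast Nat.lt_succ_iff.1 (Finset.mem_range.1 hj)
    have := iteratedFDeriv_add_apply (x := y) (hf.of_le hj').contDiffAt (hg.of_le hj').contDiffAt
    change _ * iteratedFDeriv ℝ j (f + g) y _ = _
    rw [this, _root_.add_apply, mul_add]
  rw [Finset.sum_congr rfl this, Finset.sum_add_distrib]
  ring

theorem taylorRem_const (k : ℕ) (a : ℝ) (y v : Euc d) : taylorRem k (fun _ => a) y v = 0 := by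
  unfold taylorRem
  rw [Finset.sum_range_succ']
  have : ∀ j ∈ Finset.range k, (((j + 1).factorial : ℝ))⁻¹ *
      iteratedFDeriv ℝ (j + 1) (fun _ : Euc d => a) y (fun _ => v) = 0 := by
    intro j _
    rw [iteratedFDeriv_const_of_ne (Nat.succ_ne_zero j)]; simp
  rw [Finset.sum_congr rfl this]
  simp

theorem taylorRem_const_mul {f : Euc d → ℝ} {k : ℕ} (hf : ContDiff ℝ k f) (a : ℝ) (y v : Euc d) :
    taylorRem k (fun x => a * f x) y v = a * taylorRem k f y v := by
  simpa using taylorRem_affine hf a 1 0 y v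

theorem holderClass_add {β L L' : ℝ} {f g : Euc d → ℝ} (hf : f ∈ holderClass β L Set.univ)
    (hg : g ∈ holderClass β L' Set.univ) :
    (fun x => f x + g x) ∈ holderClass β (L + L') Set.univ := by
  rw [mem_holderClass_univ_iff] at hf hg ⊢
  refine ⟨hf.1.add hg.1, fun y v => ?_⟩
  rw [taylorRem_add hf.1 hg.1, add_mul]
  exact (abs_add_le _ _).trans (add_le_add (hf.2 y v) (hg.2 y v))

theorem holderClass_const_mul {β L : ℝ} {f : Euc d → ℝ} (hf : f ∈ holderClass β L Set.univ)
    (a : ℝ) : (fun x => a * f x) ∈ holderClass β (|a| * L) Set.univ := by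
  rw [mem_holderClass_univ_iff] at hf ⊢
  refine ⟨contDiff_const.mul hf.1, fun y v => ?_⟩
  rw [taylorRem_const_mul hf.1, abs_mul, mul_assoc]
  exact mul_le_mul_of_nonneg_left (hf.2 y v) (abs_nonneg _)

/-- Constants have no remainder, so centring a bump by a constant costs nothing in its Hölder
constant. -/
theorem const_mem_holderClass (β a : ℝ) :
    (fun _ => a) ∈ holderClass (d := d) β 0 Set.univ := by
  rw [mem_holderClass_univ_iff]
  exact ⟨contDiff_const, fun y v => by simp [taylorRem_const]⟩

theorem holderClass_mono {β L L' : ℝ} {I : Set (Euc d)} (h : L ≤ L') :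
    holderClass β L I ⊆ holderClass β L' I := fun _ hf =>
  ⟨hf.1, fun x hx y hy => (hf.2 x hx y hy).trans
    (mul_le_mul_of_nonneg_right h (Real.rpow_nonneg (norm_nonneg _) _))⟩

/-! ### The unit cube and the strict floor -/

theorem convex_unitCube : Convex ℝ (unitCube d) := by
  intro x hx y hy a b ha hb hab i
  exact (convex_Icc (0 : ℝ) 1) (hx i) (hy i) ha hb hab

theorem nonempty_interior_unitCube : (interior (unitCube d)).Nonempty := by
  refine ⟨WithLp.toLp 2 fun _ => (1 / 2 : ℝ), ?_⟩
  rw [mem_interior]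
  refine ⟨⋂ i : Fin d, {x : Euc d | x i ∈ Set.Ioo (0 : ℝ) 1}, ?_, ?_, ?_⟩
  · intro x hx i
    exact Set.Ioo_subset_Icc_self (Set.mem_iInter.1 hx i)
  · exact isOpen_iInter_of_finite fun i => isOpen_Ioo.preimage (by fun_prop)
  · simp only [Set.mem_iInter, Set.mem_ofPred_eq]
    intro i
    norm_num

theorem uniqueDiffOn_unitCube : UniqueDiffOn ℝ (unitCube d) :=
  uniqueDiffOn_convex convex_unitCube nonempty_interior_unitCube

theorem holderClass_unitCube_of_univ {β L : ℝ} {f : Euc d → ℝ}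
    (hf : f ∈ holderClass β L Set.univ) : f ∈ holderClass β L (unitCube d) := by
  have hc : ContDiff ℝ (strictFloor β : ℕ) f := contDiffOn_univ.1 hf.1
  refine ⟨hc.contDiffOn, fun x hx y hy => ?_⟩
  have := hf.2 x (Set.mem_univ _) y (Set.mem_univ _)
  have h2 : taylorPoly (strictFloor β) f (unitCube d) y x =
      taylorPoly (strictFloor β) f Set.univ y x := by
    unfold taylorPoly
    refine Finset.sum_congr rfl fun j hj => ?_
    rw [iteratedFDerivWithin_univ, iteratedFDerivWithin_eq_iteratedFDeriv uniqueDiffOn_unitCube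
      (hc.of_le _).contDiffAt hy]
    exact_mod_cast Nat.lt_succ_iff.1 (Finset.mem_range.1 hj)
  rwa [h2]

theorem strictFloor_lt {β : ℝ} (hβ : 0 < β) : (strictFloor β : ℝ) < β := by
  have h1 : 0 < ⌈β⌉₊ := Nat.ceil_pos.2 hβ
  have h2 := Nat.ceil_lt_add_one hβ.le
  unfold strictFloor
  rw [Nat.cast_sub h1]; push_cast; linarith

theorem le_strictFloor_add_one (β : ℝ) : β ≤ strictFloor β + 1 := by
  have h1 : ⌈β⌉₊ ≤ strictFloor β + 1 := by unfold strictFloor; omega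
  have := Nat.le_ceil β
  exact this.trans (by exact_mod_cast h1)

/-- Truncated subtraction on both sides makes this hold for every i. It matches the order k - i in
the Leibniz rule for remainders with the Hölder exponent β - i. -/
theorem strictFloor_sub {β : ℝ} (i : ℕ) :
    strictFloor (β - i) = strictFloor β - i := by
  unfold strictFloor at *
  rw [Nat.ceil_sub_natCast]; omega

/-! ### Derivatives controlled by values: Vandermonde inversion and polarization -/

/-- Coefficients of a polynomial of degree at most `k` in terms of its values at `1, …, k + 1`. -/
theorem exists_coeff_eq_sum_values (k : ℕ) : ∃ W : ℕ → ℕ → ℝ, ∀ c : ℕ → ℝ, ∀ j ≤ k,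
    c j = ∑ i ∈ Finset.range (k + 1), W j i *
      ∑ l ∈ Finset.range (k + 1), c l * ((i : ℝ) + 1) ^ l := by
  let V : Matrix (Fin (k + 1)) (Fin (k + 1)) ℝ := Matrix.vandermonde fun i => ((i : ℕ) : ℝ) + 1
  have hV : IsUnit V.det := by
    rw [isUnit_iff_ne_zero, Matrix.det_vandermonde_ne_zero_iff]
    intro a b hab
    simp only [add_left_inj, Nat.cast_inj] at hab
    exact Fin.ext hab
  refine ⟨fun j i => if h : j < k + 1 ∧ i < k + 1 then V⁻¹ ⟨j, h.1⟩ ⟨i, h.2⟩ else 0,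
    fun c j hj => ?_⟩
  have hj' : j < k + 1 := Nat.lt_succ_of_le hj
  have h1 := congrFun (Matrix.mulVec_mulVec (fun l : Fin (k + 1) => c l) V⁻¹ V) ⟨j, hj'⟩
  rw [Matrix.nonsing_inv_mul V hV, Matrix.one_mulVec] at h1
  simp only at h1
  rw [← h1, Finset.sum_range]
  simp only [Matrix.mulVec, dotProduct]
  refine Finset.sum_congr rfl fun i _ => ?_
  simp only [hj', i.2, and_self, dite_true, Fin.eta]
  rw [Finset.sum_range]
  congr 1
  refine Finset.sum_congr rfl fun l _ => ?_
  simp [V, Matrix.vandermonde_apply, mul_comm]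

/-- Inclusion–exclusion: expand ∏ (1 + e_i) over subsets, with e_i = 0 on the range of r and e_i =
-1 off it. A subset S survives only if its complement avoids the range, and the product vanishes as
soon as one point is missed. -/
theorem sum_neg_one_pow_compl_mul_subset {j : ℕ} (r : Fin j → Fin j) :
    ∑ S : Finset (Fin j), (-1 : ℝ) ^ (Sᶜ).card * (if ∀ l, r l ∈ S then 1 else 0) =
      if Function.Surjective r then 1 else 0 := by
  have h := Finset.prod_add (fun _ : Fin j => (1 : ℝ)) (fun i => if i ∈ Set.range r then 0 else -1)
    Finset.univ
  rw [Finset.powerset_univ] at h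
  have hl : ∏ i : Fin j, ((1 : ℝ) + if i ∈ Set.range r then 0 else -1) =
      if Function.Surjective r then 1 else 0 := by
    split_ifs with hr
    · refine Finset.prod_eq_one fun i _ => ?_
      rw [if_pos (show i ∈ Set.range r from hr i)]; simp
    · simp only [Function.Surjective, not_forall] at hr
      obtain ⟨i, hi⟩ := hr
      refine Finset.prod_eq_zero (Finset.mem_univ i) ?_
      rw [if_neg (by simpa using hi)]; norm_num
  rw [← hl, h]
  refine Finset.sum_congr rfl fun S _ => ?_
  rw [Finset.prod_const_one, one_mul, ← Finset.compl_eq_univ_sdiff]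
  split_ifs with hS
  · rw [mul_one]
    have : ∀ i ∈ Sᶜ, (if i ∈ Set.range r then (0 : ℝ) else -1) =
        if i ∈ Set.range r then 0 else -1 := fun _ _ => rfl
    rw [Finset.prod_congr rfl (g := fun _ => (-1 : ℝ)), Finset.prod_const]
    intro i hi
    rw [if_neg]
    rintro ⟨l, rfl⟩
    exact Finset.mem_compl.1 hi (hS l)
  · push Not at hS
    obtain ⟨l, hl⟩ := hS
    rw [mul_zero]
    symm
    exact Finset.prod_eq_zero (Finset.mem_compl.2 hl) (if_pos ⟨l, rfl⟩)

/-- The polarization formula for symmetric multilinear maps. -/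
theorem polarization_formula {E : Type*} [NormedAddCommGroup E] [NormedSpace ℝ E] {j : ℕ}
    (T : ContinuousMultilinearMap ℝ (fun _ : Fin j => E) ℝ)
    (hT : ∀ (v : Fin j → E) (σ : Equiv.Perm (Fin j)), T (v ∘ σ) = T v) (v : Fin j → E) :
    (j.factorial : ℝ) * T v =
      ∑ S : Finset (Fin j), (-1 : ℝ) ^ (Sᶜ).card * T (fun _ => ∑ i ∈ S, v i) := by
  have h1 : ∀ S : Finset (Fin j), T (fun _ => ∑ i ∈ S, v i) =
      ∑ r : Fin j → Fin j, (if ∀ l, r l ∈ S then 1 else 0) * T (fun l => v (r l)) := by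
    intro S
    have := T.toMultilinearMap.map_sum_finset (fun _ i => v i) (fun _ => S)
    rw [show T (fun _ => ∑ i ∈ S, v i) = T.toMultilinearMap (fun _ => ∑ i ∈ S, v i) from rfl, this]
    simp only [ite_mul, one_mul, zero_mul]
    rw [← Finset.sum_filter]
    refine Finset.sum_congr ?_ fun _ _ => rfl
    ext r
    simp [Fintype.mem_piFinset]
  simp_rw [h1, Finset.mul_sum]
  rw [Finset.sum_comm]
  have h0 : ∀ r : Fin j → Fin j, ∑ S : Finset (Fin j), (-1 : ℝ) ^ (Sᶜ).card *
      ((if ∀ l, r l ∈ S then 1 else 0) * T (fun l => v (r l))) =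
      if Function.Surjective r then T (fun l => v (r l)) else 0 := by
    intro r
    simp_rw [← mul_assoc]
    rw [← Finset.sum_mul, sum_neg_one_pow_compl_mul_subset r, ite_mul, one_mul, zero_mul]
  rw [Finset.sum_congr rfl fun r _ => h0 r, ← Finset.sum_filter]
  have h2 : ∀ r ∈ Finset.univ.filter (fun r : Fin j → Fin j => Function.Surjective r),
      T (fun l => v (r l)) = T v := by
    intro r hr
    have hb : Function.Bijective r := Finite.surjective_iff_bijective.1 (Finset.mem_filter.1 hr).2
    exact hT v (Equiv.ofBijective r hb)
  rw [Finset.sum_congr rfl h2, Finset.sum_const, nsmul_eq_mul]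
  congr 2
  have : Finset.univ.filter (fun r : Fin j → Fin j => Function.Surjective r) =
      Finset.univ.image (fun σ : Equiv.Perm (Fin j) => (σ : Fin j → Fin j)) := by
    ext r
    simp only [Finset.mem_filter, Finset.mem_univ, true_and, Finset.mem_image]
    constructor
    · intro hr
      exact ⟨Equiv.ofBijective r (Finite.surjective_iff_bijective.1 hr), rfl⟩
    · rintro ⟨σ, rfl⟩
      exact σ.surjective
  rw [this, Finset.card_image_of_injective _ DFunLike.coe_injective, Finset.card_univ,
    Fintype.card_perm, Fintype.card_fin]

/-- On unit vectors the polarization formula has 2^j terms, each evaluated at a sum of norm at most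
j; the factor j! ≥ 1 on the left is dropped. General vectors follow by homogeneity in each slot. -/
theorem norm_le_of_symmetric_of_diagonal {E : Type*} [NormedAddCommGroup E] [NormedSpace ℝ E]
    {j : ℕ} (T : ContinuousMultilinearMap ℝ (fun _ : Fin j => E) ℝ)
    (hT : ∀ (v : Fin j → E) (σ : Equiv.Perm (Fin j)), T (v ∘ σ) = T v) {M : ℝ} (hM : 0 ≤ M)
    (h : ∀ v : E, |T (fun _ => v)| ≤ M * ‖v‖ ^ j) : ‖T‖ ≤ 2 ^ j * (j : ℝ) ^ j * M := by
  suffices hunit : ∀ v : Fin j → E, (∀ i, ‖v i‖ = 1) → |T v| ≤ 2 ^ j * (j : ℝ) ^ j * M by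
    refine ContinuousMultilinearMap.opNorm_le_bound (by positivity) fun m => ?_
    by_cases hm : ∃ i, m i = 0
    · obtain ⟨i, hi⟩ := hm
      rw [T.map_coord_zero i hi, norm_zero]
      positivity
    · push Not at hm
      have e : m = fun i => ‖m i‖ • (‖m i‖⁻¹ • m i) := by
        funext i
        rw [smul_smul, mul_inv_cancel₀ (norm_ne_zero_iff.2 (hm i)), one_smul]
      have h1 := T.map_smul_univ (fun i => ‖m i‖) (fun i => ‖m i‖⁻¹ • m i)
      rw [← e] at h1
      have h0 : 0 ≤ ∏ i, ‖m i‖ := Finset.prod_nonneg fun _ _ => norm_nonneg _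
      rw [h1, norm_smul, mul_comm, Real.norm_of_nonneg h0]
      refine mul_le_mul_of_nonneg_right (hunit _ fun i => ?_) h0
      rw [norm_smul, norm_inv, norm_norm, inv_mul_cancel₀ (norm_ne_zero_iff.2 (hm i))]
  intro v hv
  have h1 := polarization_formula T hT v
  have h2 : |(j.factorial : ℝ) * T v| ≤ 2 ^ j * (j : ℝ) ^ j * M := by
    rw [h1]
    refine (Finset.abs_sum_le_sum_abs _ _).trans ?_
    have h3 : ∀ S : Finset (Fin j), |(-1 : ℝ) ^ (Sᶜ).card * T (fun _ => ∑ i ∈ S, v i)| ≤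
        (j : ℝ) ^ j * M := by
      intro S
      rw [abs_mul, abs_pow, abs_neg, abs_one, one_pow, one_mul]
      refine (h _).trans ?_
      rw [mul_comm]
      refine mul_le_mul_of_nonneg_right ?_ hM
      refine pow_le_pow_left₀ (norm_nonneg _) ?_ _
      refine (norm_sum_le _ _).trans ?_
      simp only [hv, Finset.sum_const, nsmul_eq_mul, mul_one]
      exact_mod_cast (Finset.card_le_univ S).trans (by simp)
    refine (Finset.sum_le_sum fun S _ => h3 S).trans ?_
    rw [Finset.sum_const, Finset.card_univ, Fintype.card_finset, Fintype.card_fin, nsmul_eq_mul]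
    push_cast
    rw [mul_assoc]
  rw [abs_mul, Nat.abs_cast] at h2
  have h4 : (1 : ℝ) ≤ j.factorial := by exact_mod_cast Nat.one_le_iff_ne_zero.2 j.factorial_ne_zero
  calc |T v| ≤ j.factorial * |T v| := le_mul_of_one_le_left (abs_nonneg _) h4
    _ ≤ _ := h2

/-- Adjacent transpositions generate the permutations. The swap of the first two slots is the
symmetry of the second derivative of a lower iterated derivative; every other adjacent swap acts on
the tail, where the induction hypothesis can be differentiated. -/
theorem iteratedFDeriv_comp_perm_of_contDiff {E : Type*} [NormedAddCommGroup E]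
    [NormedSpace ℝ E] {f : E → ℝ} {k : ℕ} (hf : ContDiff ℝ k f) :
    ∀ {j : ℕ}, j ≤ k → ∀ (y : E) (v : Fin j → E) (σ : Equiv.Perm (Fin j)),
      iteratedFDeriv ℝ j f y (v ∘ σ) = iteratedFDeriv ℝ j f y v := by
  intro j
  induction j with
  | zero => intro _ y v σ; exact congrArg _ (Subsingleton.elim _ _)
  | succ n ih =>
    intro hj y v σ
    have hd : Differentiable ℝ (iteratedFDeriv ℝ n f) :=
      hf.differentiable_iteratedFDeriv (by exact_mod_cast hj)
    have key : ∀ i : Fin n, ∀ v : Fin (n + 1) → E,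
        iteratedFDeriv ℝ (n + 1) f y (v ∘ Equiv.swap i.castSucc i.succ) =
          iteratedFDeriv ℝ (n + 1) f y v := by
      intro i v
      obtain ⟨n, rfl⟩ : ∃ n', n = n' + 1 := ⟨n - 1, by have := i.2; omega⟩
      refine Fin.cases ?_ (fun i => ?_) i
      · have hd' : Differentiable ℝ (iteratedFDeriv ℝ n f) :=
          hf.differentiable_iteratedFDeriv (by exact_mod_cast (by omega : n < k))
        have hc2 : ContDiff ℝ 2 (iteratedFDeriv ℝ n f) := by
          refine ContDiff.iteratedFDeriv_right hf ?_
          exact_mod_cast (by omega : 2 + n ≤ k)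
        have hs := (hc2.contDiffAt (x := y)).isSymmSndFDerivAt (by simp)
        have e : ∀ w : Fin (n + 2) → E, iteratedFDeriv ℝ (n + 2) f y w =
            fderiv ℝ (fderiv ℝ (iteratedFDeriv ℝ n f)) y (w 0) (w 1) (Fin.tail (Fin.tail w)) := by
          intro w
          rw [iteratedFDeriv_succ_apply_left]
          have hz : ∀ z, iteratedFDeriv ℝ (n + 1) f z (Fin.tail w) =
              fderiv ℝ (iteratedFDeriv ℝ n f) z (w 1) (Fin.tail (Fin.tail w)) := fun z => by
            rw [iteratedFDeriv_succ_apply_left]; rfl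
          have hd1 := ((hc2.fderiv_right (m := 1) (by norm_num)).differentiable (by norm_num)
            y).hasFDerivAt
          have h1 := (((hd y).hasFDerivAt.continuousMultilinear_apply_const (Fin.tail w)).congr_of_eventuallyEq
            (f₁ := fun z => fderiv ℝ (iteratedFDeriv ℝ n f) z (w 1) (Fin.tail (Fin.tail w)))
            (Eventually.of_forall fun z => (hz z).symm))
          have h2 := (hd1.clm_apply (hasFDerivAt_const (w 1) y)).continuousMultilinear_apply_const
            (Fin.tail (Fin.tail w))
          have h3 := DFunLike.congr_fun (h1.unique h2) (w 0)
          simpa using h3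
        rw [e, e]
        have e3 : Fin.tail (Fin.tail (v ∘ Equiv.swap (Fin.castSucc 0) (Fin.succ (0 : Fin (n + 1))))) =
            Fin.tail (Fin.tail v) := by
          funext l
          simp only [Fin.tail, Function.comp]
          rw [Equiv.swap_apply_of_ne_of_ne]
          · simp
          · simp [Fin.ext_iff]
        rw [e3]
        have e1 : (v ∘ Equiv.swap (Fin.castSucc 0) (Fin.succ (0 : Fin (n + 1)))) 0 = v 1 := by
          simp
        have e2 : (v ∘ Equiv.swap (Fin.castSucc 0) (Fin.succ (0 : Fin (n + 1)))) 1 = v 0 := by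
          simp
        rw [e1, e2, hs.eq]
      · rw [iteratedFDeriv_succ_apply_left, iteratedFDeriv_succ_apply_left]
        have e1 : (v ∘ Equiv.swap i.succ.castSucc i.succ.succ) 0 = v 0 := by
          simp only [Function.comp]
          rw [Equiv.swap_apply_of_ne_of_ne]
          · simp [Fin.ext_iff]
          · simp [Fin.ext_iff]
        have e2 : Fin.tail (v ∘ Equiv.swap i.succ.castSucc i.succ.succ) =
            Fin.tail v ∘ Equiv.swap i.castSucc i.succ := by
          funext l
          simp only [Fin.tail, Function.comp]
          rw [← Fin.succ_castSucc]
          congr 1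
          exact (Fin.succ_injective _).swap_apply _ _ _
        rw [e1, e2]
        have h1 := (hd y).hasFDerivAt.continuousMultilinear_apply_const
          (Fin.tail v ∘ Equiv.swap i.castSucc i.succ)
        have h2 := (hd y).hasFDerivAt.continuousMultilinear_apply_const (Fin.tail v)
        have h3 : (fun z => iteratedFDeriv ℝ (n + 1) f z (Fin.tail v ∘ Equiv.swap i.castSucc i.succ)) =
            fun z => iteratedFDeriv ℝ (n + 1) f z (Fin.tail v) := by
          funext z; exact ih (by omega) z _ _
        rw [h3] at h1
        simpa using DFunLike.congr_fun (h1.unique h2) (v 0)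
    have hmem : σ ∈ Submonoid.closure
        (Set.range fun i : Fin n => Equiv.swap i.castSucc i.succ) := by
      rw [Equiv.Perm.mclosure_swap_castSucc_succ]; trivial
    induction hmem using Submonoid.closure_induction generalizing v with
    | mem x hx => obtain ⟨i, rfl⟩ := hx; exact key i v
    | one => rfl
    | mul a b _ _ ha hb =>
      have : v ∘ ⇑(a * b) = (v ∘ a) ∘ b := rfl
      rw [this, hb, ha]

theorem norm_iteratedFDeriv_le_of_diagonal {f : Euc d → ℝ} {k : ℕ} (hf : ContDiff ℝ k f) {j : ℕ}
    (hj : j ≤ k) (y : Euc d) {M : ℝ} (hM : 0 ≤ M)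
    (h : ∀ v, |iteratedFDeriv ℝ j f y (fun _ => v)| ≤ M * ‖v‖ ^ j) :
    ‖iteratedFDeriv ℝ j f y‖ ≤ 2 ^ j * (j : ℝ) ^ j * M := by
  refine norm_le_of_symmetric_of_diagonal _ (fun v σ => ?_) hM h
  exact iteratedFDeriv_comp_perm_of_contDiff hf hj y v σ

theorem iteratedFDeriv_diagonal_smul (j : ℕ) (f : Euc d → ℝ) (y v : Euc d) (c : ℝ) :
    iteratedFDeriv ℝ j f y (fun _ => c • v) = c ^ j * iteratedFDeriv ℝ j f y (fun _ => v) := by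
  have := (iteratedFDeriv ℝ j f y).map_smul_univ (fun _ => c) (fun _ => v)
  simpa using this

/-- Removing the remainder leaves the Taylor polynomial in direction v, whose value at (i + 1) v is
a polynomial in i + 1; inverting the Vandermonde matrix yields its coefficients. The nodes start at
1, not 0, so even f y is expressed through points that all move with v, which later permits
averaging over v. -/
theorem exists_taylor_coeff_eq (k : ℕ) : ∃ W : ℕ → ℕ → ℝ, ∀ (f : Euc d → ℝ) (y v : Euc d),
    ∀ j ≤ k, ((j.factorial : ℝ))⁻¹ * iteratedFDeriv ℝ j f y (fun _ => v) =
      ∑ i ∈ Finset.range (k + 1), W j i *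
        (f (y + ((i : ℝ) + 1) • v) - taylorRem k f y (((i : ℝ) + 1) • v)) := by
  obtain ⟨W, hW⟩ := exists_coeff_eq_sum_values k
  refine ⟨W, fun f y v j hj => ?_⟩
  rw [hW (fun j => ((j.factorial : ℝ))⁻¹ * iteratedFDeriv ℝ j f y (fun _ => v)) j hj]
  refine Finset.sum_congr rfl fun i _ => ?_
  congr 1
  rw [taylorRem, sub_sub_cancel]
  refine Finset.sum_congr rfl fun l _ => ?_
  rw [iteratedFDeriv_diagonal_smul]
  ring

/-- The constant depends on β only, and the bound B is needed at just k + 1 points of one ray. Scale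
can therefore be traded against size by choosing v. -/
theorem exists_taylor_coeff_bound (d : ℕ) {β : ℝ} (hβ : 0 < β) : ∃ C : ℝ, 0 ≤ C ∧
    ∀ (M : ℝ), 0 ≤ M → ∀ f ∈ holderClass (d := d) β M Set.univ, ∀ B : ℝ, 
    ∀ y v, (∀ i ≤ strictFloor β, |f (y + ((i : ℝ) + 1) • v)| ≤ B) → ∀ j ≤ strictFloor β,
    |iteratedFDeriv ℝ j f y (fun _ => v)| ≤ C * (B + M * ‖v‖ ^ β) := by
  set k := strictFloor β
  obtain ⟨W, hW⟩ := exists_taylor_coeff_eq (d := d) k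
  set C₁ := ∑ j ∈ Finset.range (k + 1), ∑ i ∈ Finset.range (k + 1), |W j i|
  have hC₁ : 0 ≤ C₁ := Finset.sum_nonneg fun _ _ => Finset.sum_nonneg fun _ _ => abs_nonneg _
  set K : ℝ := ((k : ℝ) + 1) ^ β
  have hK : 1 ≤ K := Real.one_le_rpow (by simp) hβ.le
  refine ⟨k.factorial * (C₁ * K), by positivity, fun M hM f hf B y v hB j hj => ?_⟩
  rw [mem_holderClass_univ_iff] at hf
  have hB0 : 0 ≤ B := (abs_nonneg _).trans (hB 0 (Nat.zero_le _))
  have hv : 0 ≤ ‖v‖ ^ β := by positivity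
  have h1 := hW f y v j hj
  have hjf : (0 : ℝ) < j.factorial := by exact_mod_cast j.factorial_pos
  have h2 : iteratedFDeriv ℝ j f y (fun _ => v) = j.factorial *
      ∑ i ∈ Finset.range (k + 1), W j i *
        (f (y + ((i : ℝ) + 1) • v) - taylorRem k f y (((i : ℝ) + 1) • v)) := by
    rw [← h1, mul_inv_cancel_left₀ hjf.ne']
  rw [h2, abs_mul, Nat.abs_cast]
  have h3 : ∀ i ∈ Finset.range (k + 1), |W j i *
      (f (y + ((i : ℝ) + 1) • v) - taylorRem k f y (((i : ℝ) + 1) • v))| ≤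
      |W j i| * (K * (B + M * ‖v‖ ^ β)) := by
    intro i hi
    have hi' : i ≤ k := Nat.lt_succ_iff.1 (Finset.mem_range.1 hi)
    rw [abs_mul]
    refine mul_le_mul_of_nonneg_left ?_ (abs_nonneg _)
    refine (abs_sub _ _).trans ?_
    have h4 := hf.2 y (((i : ℝ) + 1) • v)
    rw [norm_smul, Real.norm_of_nonneg (by positivity), Real.mul_rpow (by positivity)
      (norm_nonneg _)] at h4
    have h5 : ((i : ℝ) + 1) ^ β ≤ K := Real.rpow_le_rpow (by positivity)
      (by simpa using (by exact_mod_cast hi' : (i : ℝ) ≤ k)) hβ.le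
    calc _ ≤ B + M * (((i : ℝ) + 1) ^ β * ‖v‖ ^ β) := add_le_add (hB i hi') h4
      _ ≤ K * B + M * (K * ‖v‖ ^ β) := by gcongr; exact le_mul_of_one_le_left hB0 hK
      _ = _ := by ring
  have h6 : |∑ i ∈ Finset.range (k + 1), W j i *
        (f (y + ((i : ℝ) + 1) • v) - taylorRem k f y (((i : ℝ) + 1) • v))| ≤
        C₁ * (K * (B + M * ‖v‖ ^ β)) := by
    refine (Finset.abs_sum_le_sum_abs _ _).trans ((Finset.sum_le_sum h3).trans ?_)
    rw [← Finset.sum_mul]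
    refine mul_le_mul_of_nonneg_right ?_ (by positivity)
    exact Finset.single_le_sum (f := fun j => ∑ i ∈ Finset.range (k + 1), |W j i|)
      (fun _ _ => Finset.sum_nonneg fun _ _ => abs_nonneg _)
      (Finset.mem_range.2 (Nat.lt_succ_of_le hj))
  calc _ ≤ (k.factorial : ℝ) * (C₁ * (K * (B + M * ‖v‖ ^ β))) := by
        gcongr
    _ = _ := by ring

/-! ### Interpolation between the L² norm and the Hölder bound -/

/-- Pointwise values of a Hölder function are controlled by its `L²` norm. -/
theorem exists_sq_le_integral_sq (d : ℕ) {β : ℝ} (hβ : 0 < β) : ∃ C : ℝ, 0 ≤ C ∧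
    ∀ (M : ℝ), 0 ≤ M → ∀ f ∈ holderClass (d := d) β M Set.univ, MemLp f 2 volume →
    ∀ r : ℝ, 0 < r → ∀ y, f y ^ 2 ≤
      C * ((∫ x, f x ^ 2) / volume.real (Metric.ball (0 : Euc d) r) + (M * r ^ β) ^ 2) := by
  set k := strictFloor β
  obtain ⟨W, hW⟩ := exists_taylor_coeff_eq (d := d) k
  set K : ℝ := ((k : ℝ) + 1) ^ β
  have hK : 1 ≤ K := Real.one_le_rpow (by simp) hβ.le
  set S := ∑ i ∈ Finset.range (k + 1), W 0 i ^ 2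
  have hS : 0 ≤ S := Finset.sum_nonneg fun _ _ => sq_nonneg _
  refine ⟨2 * (k + 1) * S * (K ^ 2 * (k + 1)), by positivity, fun M hM f hf hf2 r hr y => ?_⟩
  rw [mem_holderClass_univ_iff] at hf
  set I := ∫ x, f x ^ 2
  have hint : Integrable (fun x => f x ^ 2) := hf2.integrable_sq
  set V := volume.real (Metric.ball (0 : Euc d) r)
  have hV : 0 < V := ENNReal.toReal_pos (Metric.measure_ball_pos _ _ hr).ne'
    measure_ball_lt_top.ne
  set Q := M * r ^ β
  have hQ : 0 ≤ Q := by positivity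
  -- Each v in the ball represents f y through the values at y + (i + 1) v, up to remainders. The
  -- inequality is then integrated over v.
  have hpt : ∀ v ∈ Metric.ball (0 : Euc d) r, f y ^ 2 ≤ 2 * S *
      (∑ i ∈ Finset.range (k + 1), f (y + ((i : ℝ) + 1) • v) ^ 2 + (k + 1) * (K * Q) ^ 2) := by
    intro v hv
    have h1 := hW f y v 0 (Nat.zero_le _)
    simp only [Nat.factorial_zero, Nat.cast_one, inv_one, one_mul, iteratedFDeriv_zero_apply] at h1
    rw [h1]
    refine (Finset.sum_mul_sq_le_sq_mul_sq _ _ _).trans ?_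
    rw [mul_comm 2 S, mul_assoc]
    refine mul_le_mul_of_nonneg_left ?_ hS
    have h2 : ∀ i ∈ Finset.range (k + 1), (f (y + ((i : ℝ) + 1) • v) -
        taylorRem k f y (((i : ℝ) + 1) • v)) ^ 2 ≤
        2 * f (y + ((i : ℝ) + 1) • v) ^ 2 + 2 * (K * Q) ^ 2 := by
      intro i hi
      have hi' : i ≤ k := Nat.lt_succ_iff.1 (Finset.mem_range.1 hi)
      have h4 := hf.2 y (((i : ℝ) + 1) • v)
      have h5 : M * ‖((i : ℝ) + 1) • v‖ ^ β ≤ K * Q := by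
        rw [norm_smul, Real.norm_of_nonneg (by positivity), Real.mul_rpow (by positivity)
          (norm_nonneg _)]
        have h5 : ((i : ℝ) + 1) ^ β ≤ K := Real.rpow_le_rpow (by positivity)
          (by simpa using (by exact_mod_cast hi' : (i : ℝ) ≤ k)) hβ.le
        have h6 : ‖v‖ ^ β ≤ r ^ β :=
          Real.rpow_le_rpow (norm_nonneg _) (mem_ball_zero_iff.1 hv).le hβ.le
        calc _ ≤ M * (K * r ^ β) := by gcongr
          _ = _ := by ring
      have h7 : taylorRem k f y (((i : ℝ) + 1) • v) ^ 2 ≤ (K * Q) ^ 2 :=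
        sq_le_sq' (by linarith [(abs_le.1 (h4.trans h5)).1]) (abs_le.1 (h4.trans h5)).2
      nlinarith [sq_nonneg (f (y + ((i : ℝ) + 1) • v) + taylorRem k f y (((i : ℝ) + 1) • v))]
    refine (Finset.sum_le_sum h2).trans (le_of_eq ?_)
    rw [Finset.sum_add_distrib, ← Finset.mul_sum, Finset.sum_const, Finset.card_range, nsmul_eq_mul]
    push_cast
    ring
  -- The substitution v ↦ y + (i + 1) v has Jacobian at least 1, so every averaged term is at most
  -- the full integral.
  have hcomp : ∀ i : ℕ, Integrable (fun v : Euc d => f (y + ((i : ℝ) + 1) • v) ^ 2) ∧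
      ∫ v : Euc d, f (y + ((i : ℝ) + 1) • v) ^ 2 ≤ I := by
    intro i
    have hi0 : ((i : ℝ) + 1) ≠ 0 := by positivity
    have hint' : Integrable (fun x : Euc d => f (y + x) ^ 2) := hint.comp_add_left y
    refine ⟨hint'.comp_smul hi0, ?_⟩
    rw [Measure.integral_comp_smul volume (fun x : Euc d => f (y + x) ^ 2),
      integral_add_left_eq_self (fun x : Euc d => f x ^ 2) y, smul_eq_mul]
    refine mul_le_of_le_one_left (integral_nonneg fun _ => sq_nonneg _) ?_
    rw [abs_of_nonneg (by positivity)]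
    exact inv_le_one_of_one_le₀ (one_le_pow₀ (by simp))
  have h8 : V * f y ^ 2 ≤ 2 * S * ((k + 1) * I + (k + 1) * (K * Q) ^ 2 * V) := by
    have e1 : ∫ v in Metric.ball (0 : Euc d) r, f y ^ 2 = V * f y ^ 2 := by
      rw [setIntegral_const, smul_eq_mul]
    rw [← e1]
    have hsum : Integrable (fun v : Euc d => ∑ i ∈ Finset.range (k + 1),
        f (y + ((i : ℝ) + 1) • v) ^ 2) := integrable_finsetSum _ fun i _ => (hcomp i).1
    have hcst : IntegrableOn (fun _ : Euc d => ((k : ℝ) + 1) * (K * Q) ^ 2)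
        (Metric.ball (0 : Euc d) r) := integrableOn_const measure_ball_lt_top.ne
    refine (setIntegral_mono_on (integrableOn_const measure_ball_lt_top.ne)
      ((hsum.integrableOn.add hcst).const_mul (2 * S)) measurableSet_ball hpt).trans ?_
    rw [integral_const_mul]
    refine mul_le_mul_of_nonneg_left ?_ (by positivity)
    rw [integral_add' hsum.integrableOn hcst, setIntegral_const, smul_eq_mul, mul_comm V]
    refine add_le_add_left ?_ _
    refine (setIntegral_le_integral hsum (Eventually.of_forall fun v =>
      Finset.sum_nonneg fun _ _ => sq_nonneg _)).trans ?_
    rw [integral_finsetSum _ fun i _ => (hcomp i).1]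
    refine (Finset.sum_le_sum fun i _ => (hcomp i).2).trans ?_
    rw [Finset.sum_const, Finset.card_range, nsmul_eq_mul]
    push_cast
    exact le_rfl
  have hI : 0 ≤ I := integral_nonneg fun _ => sq_nonneg _
  have h9 : f y ^ 2 ≤ 2 * S * ((k + 1) * (I / V) + (k + 1) * (K * Q) ^ 2) := by
    rw [← mul_le_mul_iff_right₀ hV]
    refine h8.trans (le_of_eq ?_)
    field_simp
  refine h9.trans ?_
  have hIV : 0 ≤ I / V := by positivity
  have hK2 : 1 ≤ K ^ 2 := one_le_pow₀ hK
  have hk : (1 : ℝ) ≤ k + 1 := by simp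
  calc 2 * S * ((k + 1) * (I / V) + (k + 1) * (K * Q) ^ 2)
      ≤ 2 * S * ((k + 1) * (K ^ 2 * (I / V)) + (k + 1) * (K * Q) ^ 2) := by
        gcongr; exact le_mul_of_one_le_left hIV hK2
    _ = 2 * 1 * S * ((k + 1) * (K ^ 2 * (I / V + Q ^ 2))) := by ring
    _ ≤ 2 * (k + 1) * S * ((k + 1) * (K ^ 2 * (I / V + Q ^ 2))) := by gcongr
    _ = _ := by ring

theorem exists_bound_of_memLp {β M : ℝ} (hβ : 0 < β) (hM : 0 ≤ M) {f : Euc d → ℝ}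
    (hf : f ∈ holderClass β M Set.univ) (hf2 : MemLp f 2 volume) :
    ∃ B, 0 ≤ B ∧ ∀ y, |f y| ≤ B := by
  obtain ⟨C, -, hC⟩ := exists_sq_le_integral_sq d hβ
  refine ⟨√(C * ((∫ x, f x ^ 2) / volume.real (Metric.ball (0 : Euc d) 1) + (M * 1 ^ β) ^ 2)),
    Real.sqrt_nonneg _, fun y => ?_⟩
  rw [← Real.sqrt_sq_eq_abs]
  exact Real.sqrt_le_sqrt (hC M hM f hf hf2 1 one_pos y)

theorem iteratedFDeriv_diagonal_le_of_ball {j : ℕ} {f : Euc d → ℝ} {y : Euc d} {r A : ℝ}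
    (hr : 0 < r) (h : ∀ w : Euc d, ‖w‖ ≤ r → |iteratedFDeriv ℝ j f y (fun _ => w)| ≤ A) (v : Euc d) :
    |iteratedFDeriv ℝ j f y (fun _ => v)| ≤ A / r ^ j * ‖v‖ ^ j := by
  rcases eq_or_ne v 0 with rfl | hv
  · rcases Nat.eq_zero_or_pos j with rfl | hj
    · simpa using h 0 (by simpa using hr.le)
    · have := iteratedFDeriv_diagonal_smul j f y 0 0
      rw [zero_smul, zero_pow hj.ne', zero_mul] at this
      rw [this, norm_zero, zero_pow hj.ne']
      simp
  · have hv' : 0 < ‖v‖ := norm_pos_iff.2 hv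
    have h1 := h ((r / ‖v‖) • v) (by
      rw [norm_smul, Real.norm_of_nonneg (by positivity), div_mul_cancel₀ _ hv'.ne'])
    rw [iteratedFDeriv_diagonal_smul, abs_mul, abs_of_nonneg (by positivity), div_pow] at h1
    rw [div_mul_eq_mul_div, le_div_iff₀ (by positivity)]
    have h2 := mul_le_mul_of_nonneg_right h1 (pow_nonneg hv'.le j)
    refine le_trans (le_of_eq ?_) h2
    field_simp

theorem exists_bound_iteratedFDeriv_of_memLp {β M : ℝ} (hβ : 0 < β) (hM : 0 ≤ M) {f : Euc d → ℝ}
    (hf : f ∈ holderClass β M Set.univ) (hf2 : MemLp f 2 volume) :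
    ∃ B, 0 ≤ B ∧ ∀ j ≤ strictFloor β, ∀ y v, |iteratedFDeriv ℝ j f y (fun _ => v)| ≤ B * ‖v‖ ^ j := by
  obtain ⟨B, hB0, hB⟩ := exists_bound_of_memLp hβ hM hf hf2
  obtain ⟨C, hC0, hC⟩ := exists_taylor_coeff_bound d hβ
  refine ⟨C * (B + M), by positivity, fun j hj y v => ?_⟩
  have := iteratedFDeriv_diagonal_le_of_ball (f := f) (j := j) (y := y) (A := C * (B + M)) one_pos
    (fun w hw => (hC M hM f hf B y w (fun _ _ => hB _) j hj).trans ?_) v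
  · simpa using this
  · gcongr
    exact mul_le_of_le_one_right hM (Real.rpow_le_one (norm_nonneg _) hw hβ.le)

/-- A small L² norm first gives a small uniform bound B, since averaging over tiny balls makes the
Hölder term negligible. At scale r the derivatives are then of size B/r^k + M r^(β-k); because k < β
strictly, r can be fixed to make the second term small and B chosen afterwards. -/
theorem exists_small_iteratedFDeriv (d : ℕ) {β M : ℝ} (hβ : 0 < β) (hM : 0 ≤ M) {η : ℝ}
    (hη : 0 < η) : ∃ ε, 0 < ε ∧ ∀ f ∈ holderClass (d := d) β M Set.univ, MemLp f 2 volume →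
      ∫ x, f x ^ 2 ≤ ε → ∀ j ≤ strictFloor β, ∀ y, ‖iteratedFDeriv ℝ j f y‖ ≤ η := by
  set k := strictFloor β with hk
  obtain ⟨C₀, hC₀0, hC₀⟩ := exists_sq_le_integral_sq d hβ
  obtain ⟨C, hC0, hC⟩ := exists_taylor_coeff_bound d hβ
  set D : ℝ := (∑ j ∈ Finset.range (k + 1), 2 ^ j * (j : ℝ) ^ j) * C + 1
  have hD : 0 < D := by positivity
  have hDj : ∀ j ≤ k, 2 ^ j * (j : ℝ) ^ j * C ≤ D := by
    intro j hj
    have := Finset.single_le_sum (f := fun j : ℕ => 2 ^ j * (j : ℝ) ^ j)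
      (fun _ _ => by positivity) (Finset.mem_range.2 (Nat.lt_succ_of_le hj))
    have := mul_le_mul_of_nonneg_right this hC0
    simp only [D]
    linarith
  have hkβ : 0 < β - k := sub_pos.2 (strictFloor_lt hβ)
  -- choice of the radius
  obtain ⟨r, hr0, hr1, hr⟩ : ∃ r : ℝ, 0 < r ∧ r ≤ 1 ∧ D * (M * r ^ (β - k)) ≤ η / 2 := by
    have hlim : Tendsto (fun r : ℝ => D * (M * r ^ (β - k))) (𝓝[>] 0) (𝓝 0) := by
      have : Tendsto (fun r : ℝ => D * (M * r ^ (β - k))) (𝓝 0) (𝓝 (D * (M * 0 ^ (β - k)))) :=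
        ((Real.continuousAt_rpow_const _ _ (Or.inr hkβ.le)).tendsto.const_mul M).const_mul D
      rw [Real.zero_rpow hkβ.ne', mul_zero, mul_zero] at this
      exact this.mono_left nhdsWithin_le_nhds
    have h1 := hlim.eventually (eventually_le_nhds (half_pos hη))
    have h2 : ∀ᶠ r : ℝ in 𝓝[>] 0, r ≤ 1 := nhdsWithin_le_nhds (eventually_le_nhds one_pos)
    obtain ⟨r, h1, h2, h3⟩ := (h1.and (h2.and self_mem_nhdsWithin)).exists
    exact ⟨r, h3, h2, h1⟩
  set B := η * r ^ k / (2 * D)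
  have hB : 0 < B := by positivity
  -- choice of the radius for the bound on the function
  obtain ⟨r', hr'0, hr'⟩ : ∃ r' : ℝ, 0 < r' ∧ C₀ * (M * r' ^ β) ^ 2 ≤ B ^ 2 / 2 := by
    have hlim : Tendsto (fun r : ℝ => C₀ * (M * r ^ β) ^ 2) (𝓝[>] 0) (𝓝 0) := by
      have : Tendsto (fun r : ℝ => C₀ * (M * r ^ β) ^ 2) (𝓝 0) (𝓝 (C₀ * (M * 0 ^ β) ^ 2)) :=
        (((Real.continuousAt_rpow_const _ _ (Or.inr hβ.le)).tendsto.const_mul M).pow 2).const_mul C₀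
      rw [Real.zero_rpow hβ.ne', mul_zero, zero_pow two_ne_zero, mul_zero] at this
      exact this.mono_left nhdsWithin_le_nhds
    have h1 := hlim.eventually (eventually_le_nhds (half_pos (pow_pos hB 2)))
    obtain ⟨r, h1, h3⟩ := (h1.and self_mem_nhdsWithin).exists
    exact ⟨r, h3, h1⟩
  set V := volume.real (Metric.ball (0 : Euc d) r')
  have hV : 0 < V := ENNReal.toReal_pos (Metric.measure_ball_pos _ _ hr'0).ne'
    measure_ball_lt_top.ne
  refine ⟨B ^ 2 / 2 * V / (C₀ + 1), by positivity, fun f hf hf2 hI j hj y => ?_⟩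
  have hfB : ∀ y, |f y| ≤ B := by
    intro y
    refine abs_le_of_sq_le_sq ?_ hB.le
    refine (hC₀ M hM f hf hf2 r' hr'0 y).trans ?_
    rw [mul_add]
    have : C₀ * ((∫ x, f x ^ 2) / V) ≤ B ^ 2 / 2 := by
      calc C₀ * ((∫ x, f x ^ 2) / V) ≤ (C₀ + 1) * ((B ^ 2 / 2 * V / (C₀ + 1)) / V) := by
            have : 0 ≤ ∫ x, f x ^ 2 := integral_nonneg fun _ => sq_nonneg _
            gcongr; linarith
        _ = B ^ 2 / 2 := by field_simp
    linarith
  have hfk : ContDiff ℝ k f := (mem_holderClass_univ_iff.1 hf).1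
  have h1 : ∀ v, |iteratedFDeriv ℝ j f y (fun _ => v)| ≤ C * (B + M * r ^ β) / r ^ j * ‖v‖ ^ j :=
    iteratedFDeriv_diagonal_le_of_ball hr0 fun w hw =>
      (hC M hM f hf B y w (fun _ _ => hfB _) j hj).trans (by gcongr)
  refine (norm_iteratedFDeriv_le_of_diagonal hfk hj y (by positivity) h1).trans ?_
  have hrk : r ^ k ≤ r ^ j := pow_le_pow_of_le_one hr0.le hr1 hj
  calc 2 ^ j * (j : ℝ) ^ j * (C * (B + M * r ^ β) / r ^ j)
      = 2 ^ j * (j : ℝ) ^ j * C * ((B + M * r ^ β) / r ^ j) := by ring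
    _ ≤ D * ((B + M * r ^ β) / r ^ k) := by
        gcongr
        exact hDj j hj
    _ = D * B / r ^ k + D * (M * r ^ (β - k)) := by
        rw [Real.rpow_sub hr0, Real.rpow_natCast]; field_simp
    _ ≤ η / 2 + η / 2 := by
        refine add_le_add (le_of_eq ?_) hr
        simp only [B]; field_simp
    _ = η := by ring

/-! ### Smooth compactly supported functions and a feasible competitor -/

/-- For ‖v‖ ≤ 1 the integral form of the remainder is of order ‖v‖^(k+1) ≤ ‖v‖^β. For ‖v‖ ≥ 1 each
term of the polynomial is separately at most a multiple of ‖v‖^j ≤ ‖v‖^β. Both halves of k < β ≤ k +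
1 are used. -/
theorem mem_holderClass_of_smooth {χ : Euc d → ℝ} (hχ : ContDiff ℝ (⊤ : ℕ∞) χ)
    (hs : HasCompactSupport χ) {β : ℝ} (hβ : 0 < β) :
    ∃ C, 0 ≤ C ∧ χ ∈ holderClass β C Set.univ := by
  set k := strictFloor β
  have hB : ∀ j : ℕ, ∃ B, 0 ≤ B ∧ ∀ x, ‖iteratedFDeriv ℝ j χ x‖ ≤ B := by
    intro j
    obtain ⟨B, hB⟩ := (hs.iteratedFDeriv j).exists_bound_of_continuous
      (hχ.continuous_iteratedFDeriv (by exact_mod_cast le_top))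
    exact ⟨B, (norm_nonneg _).trans (hB 0), hB⟩
  choose B hB0 hB using hB
  have hBv : ∀ j y v, |iteratedFDeriv ℝ j χ y (fun _ => v)| ≤ B j * ‖v‖ ^ j := by
    intro j y v
    refine ((iteratedFDeriv ℝ j χ y).le_opNorm _).trans ?_
    simp only [Finset.prod_const, Finset.card_univ, Fintype.card_fin]
    exact mul_le_mul_of_nonneg_right (hB j y) (by positivity)
  have hsum0 : 0 ≤ ∑ j ∈ Finset.range (k + 1), B j := Finset.sum_nonneg fun j _ => hB0 j
  refine ⟨B (k + 1) + (B 0 + ∑ j ∈ Finset.range (k + 1), B j),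
    add_nonneg (hB0 _) (add_nonneg (hB0 _) hsum0), ?_⟩
  rw [mem_holderClass_univ_iff]
  refine ⟨hχ.of_le (by exact_mod_cast le_top), fun y v => ?_⟩
  rcases le_total ‖v‖ 1 with hv | hv
  · have h1 := map_add_eq_sum_add_integral_iteratedFDeriv (f := χ) (x := y) (y := v) (n := k)
      (fun t _ => (hχ.of_le (by exact_mod_cast le_top)).contDiffAt)
    have h2 : taylorRem k χ y v = ((k.factorial : ℝ))⁻¹ • ∫ t in (0 : ℝ)..1, (1 - t) ^ k •
        iteratedFDeriv ℝ (k + 1) χ (y + t • v) (fun _ => v) := by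
      rw [taylorRem, h1]
      simp only [smul_eq_mul, add_sub_cancel_left]
    have h3 : ‖∫ t in (0 : ℝ)..1, (1 - t) ^ k •
        iteratedFDeriv ℝ (k + 1) χ (y + t • v) (fun _ => v)‖ ≤ B (k + 1) * ‖v‖ ^ (k + 1) * |1 - 0| := by
      refine intervalIntegral.norm_integral_le_of_norm_le_const fun t ht => ?_
      rw [Set.uIoc_of_le zero_le_one] at ht
      rw [norm_smul, Real.norm_of_nonneg (pow_nonneg (by linarith [ht.2]) k)]
      refine (mul_le_of_le_one_left (norm_nonneg _) (pow_le_one₀ (by linarith [ht.2])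
        (by linarith [ht.1]))).trans ?_
      exact hBv _ _ _
    rw [h2, smul_eq_mul, abs_mul, abs_of_nonneg (by positivity)]
    have hk1 : ((k.factorial : ℝ))⁻¹ ≤ 1 :=
      inv_le_one_of_one_le₀ (by exact_mod_cast Nat.one_le_iff_ne_zero.2 k.factorial_ne_zero)
    refine (mul_le_of_le_one_left (abs_nonneg _) hk1).trans (h3.trans ?_)
    rw [sub_zero, abs_one, mul_one]
    have h4 : ‖v‖ ^ (k + 1) ≤ ‖v‖ ^ β := by
      rcases eq_or_ne v 0 with rfl | hv0
      · simp [Real.zero_rpow hβ.ne']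
      · rw [← Real.rpow_natCast]
        refine Real.rpow_le_rpow_of_exponent_ge (norm_pos_iff.2 hv0) hv ?_
        push_cast
        exact le_strictFloor_add_one β
    refine mul_le_mul ?_ h4 (by positivity) ?_
    · linarith [hB0 0]
    · linarith [hB0 0, hB0 (k + 1)]
  · have hvβ : ∀ j ≤ k, ‖v‖ ^ j ≤ ‖v‖ ^ β := by
      intro j hj
      rw [← Real.rpow_natCast]
      refine Real.rpow_le_rpow_of_exponent_le hv ?_
      have : (j : ℝ) ≤ k := by exact_mod_cast hj
      linarith [strictFloor_lt hβ]
    have h1 : |χ (y + v)| ≤ B 0 * ‖v‖ ^ β := by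
      have := hBv 0 (y + v) v
      simp only [iteratedFDeriv_zero_apply, pow_zero, mul_one] at this
      refine this.trans (le_mul_of_one_le_right (hB0 0) ?_)
      simpa using hvβ 0 (Nat.zero_le _)
    have h2 : |∑ j ∈ Finset.range (k + 1), ((j.factorial : ℝ))⁻¹ *
        iteratedFDeriv ℝ j χ y (fun _ => v)| ≤ (∑ j ∈ Finset.range (k + 1), B j) * ‖v‖ ^ β := by
      rw [Finset.sum_mul]
      refine (Finset.abs_sum_le_sum_abs _ _).trans (Finset.sum_le_sum fun j hj => ?_)
      rw [abs_mul, abs_of_nonneg (by positivity)]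
      have hk1 : ((j.factorial : ℝ))⁻¹ ≤ 1 :=
        inv_le_one_of_one_le₀ (by exact_mod_cast Nat.one_le_iff_ne_zero.2 j.factorial_ne_zero)
      refine (mul_le_of_le_one_left (abs_nonneg _) hk1).trans ((hBv j y v).trans ?_)
      exact mul_le_mul_of_nonneg_left (hvβ j (Nat.lt_succ_iff.1 (Finset.mem_range.1 hj))) (hB0 j)
    rw [taylorRem]
    refine (abs_sub _ _).trans ((add_le_add h1 h2).trans ?_)
    rw [← add_mul]
    refine mul_le_mul_of_nonneg_right ?_ (by positivity)
    linarith [hB0 (k + 1)]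

/-- A smooth function with values in `[0, 1]`, equal to `1` at the origin, of compact support. -/
theorem exists_smooth_cutoff (d : ℕ) : ∃ χ : Euc d → ℝ, ContDiff ℝ (⊤ : ℕ∞) χ ∧
    HasCompactSupport χ ∧ χ 0 = 1 ∧ ∀ x, 0 ≤ χ x ∧ χ x ≤ 1 := by
  let b : ContDiffBump (0 : Euc d) := ⟨1, 2, one_pos, one_lt_two⟩
  exact ⟨b, b.contDiff, b.hasCompactSupport, b.one_of_mem_closedBall (by simp [b]),
    fun x => ⟨b.nonneg, b.le_one⟩⟩

theorem exists_feasible (d : ℕ) {β : ℝ} (hβ : 0 < β) : ∃ f ∈ holderClass (d := d) β 1 Set.univ,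
    1 ≤ f 0 ∧ MemLp f 2 volume := by
  obtain ⟨χ, h1, h2, h3, -⟩ := exists_smooth_cutoff d
  obtain ⟨C, hC0, hC⟩ := mem_holderClass_of_smooth h1 h2 hβ
  -- Dilation by c multiplies the Hölder constant by c^β, which turns C into C / (C + 1) ≤ 1.
  set c : ℝ := (C + 1) ^ (-β⁻¹)
  have hc : 0 < c := by positivity
  have hm := holderClass_affine hC (A := 1) zero_le_one hc.le 0
  refine ⟨_, holderClass_mono ?_ hm, by simp [h3], ?_⟩
  · rw [← Real.rpow_mul (by positivity), neg_mul, inv_mul_cancel₀ hβ.ne', Real.rpow_neg_one,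
      one_mul, ← div_eq_mul_inv, div_le_one (by positivity)]
    linarith
  · simp only [sub_zero, one_mul]
    have hcont : Continuous fun x : Euc d => χ (c • x) :=
      h1.continuous.comp (continuous_const_smul c)
    refine hcont.memLp_of_hasCompactSupport ?_
    exact h2.comp_smul hc.ne'

/-! ### Existence of a solution of the optimal recovery problem -/

/-- Along a fast subsequence the successive differences, which lie in the class with constant 2M,
have derivatives up to order k bounded by 2^(-n). The telescoping series converges with these
derivatives, and the remainder inequality passes to the pointwise limit. -/
theorem exists_holder_limit {β M : ℝ} (hβ : 0 < β) (hM : 0 ≤ M) {f : ℕ → Euc d → ℝ}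
    (hf : ∀ n, f n ∈ holderClass β M Set.univ) (hf2 : ∀ n, MemLp (f n) 2 volume)
    (hC : ∀ ε > 0, ∃ N, ∀ m ≥ N, ∀ n ≥ N, ∫ x, (f m x - f n x) ^ 2 ≤ ε) :
    ∃ g ∈ holderClass (d := d) β M Set.univ, ∃ φ : ℕ → ℕ, StrictMono φ ∧
      ∀ y, Tendsto (fun n => f (φ n) y) atTop (𝓝 (g y)) := by
  set k := strictFloor β
  have hfk : ∀ n, ContDiff ℝ k (f n) := fun n => (mem_holderClass_univ_iff.1 (hf n)).1
  choose ε hε0 hε using fun n : ℕ => exists_small_iteratedFDeriv d hβ (by positivity : 0 ≤ 2 * M)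
    (η := (1 / 2 : ℝ) ^ n) (by positivity)
  obtain ⟨φ, hφ, hφP⟩ := extraction_forall_of_eventually'
    (P := fun n k => ∀ m ≥ k, ∫ x, (f m x - f k x) ^ 2 ≤ ε n) (fun n => by
      obtain ⟨N, hN⟩ := hC (ε n) (hε0 n)
      exact ⟨N, fun k hk m hm => hN m (hk.trans hm) k hk⟩)
  set D : ℕ → Euc d → ℝ := fun n x => f (φ (n + 1)) x - f (φ n) x
  have hDk : ∀ n, ContDiff ℝ k (D n) := fun n => (hfk _).sub (hfk _)
  have hDb : ∀ j n y, j ≤ k → ‖iteratedFDeriv ℝ j (D n) y‖ ≤ (1 / 2 : ℝ) ^ n := by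
    intro j n y hj
    refine hε n (D n) ?_ ((hf2 _).sub (hf2 _)) (hφP n _ (hφ n.lt_succ_self).le) j hj y
    have := holderClass_add (hf (φ (n + 1))) (holderClass_const_mul (hf (φ n)) (-1))
    convert this using 1
    · rw [abs_neg, abs_one, one_mul, two_mul]
    · funext x
      simp only [D, neg_one_mul, sub_eq_add_neg]
  have hDb' : ∀ (j n : ℕ) (y : Euc d), (j : ℕ∞) ≤ (k : ℕ∞) →
      ‖iteratedFDeriv ℝ j (D n) y‖ ≤ (1 / 2 : ℝ) ^ n :=
    fun j n y hj => hDb j n y (by exact_mod_cast hj)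
  have hsumm : Summable fun n : ℕ => (1 / 2 : ℝ) ^ n :=
    summable_geometric_of_lt_one (by norm_num) (by norm_num)
  have hSk : ContDiff ℝ k fun x => ∑' n, D n x :=
    contDiff_tsum (N := (k : ℕ∞)) hDk (fun _ _ => hsumm) hDb'
  have hSj : ∀ j ≤ k, ∀ y, iteratedFDeriv ℝ j (fun x => ∑' n, D n x) y =
      ∑' n, iteratedFDeriv ℝ j (D n) y := fun j hj y =>
    iteratedFDeriv_tsum_apply (N := (k : ℕ∞)) hDk (fun _ _ => hsumm) hDb' (by exact_mod_cast hj) y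
  set g : Euc d → ℝ := fun x => f (φ 0) x + ∑' n, D n x
  have hgk : ContDiff ℝ k g := (hfk _).add hSk
  have hlim : ∀ j ≤ k, ∀ y, Tendsto (fun n => iteratedFDeriv ℝ j (f (φ n)) y) atTop
      (𝓝 (iteratedFDeriv ℝ j g y)) := by
    intro j hj y
    have hj' : (j : WithTop ℕ∞) ≤ k := by exact_mod_cast hj
    have e1 : iteratedFDeriv ℝ j g y = iteratedFDeriv ℝ j (f (φ 0)) y +
        ∑' n, iteratedFDeriv ℝ j (D n) y := by
      rw [← hSj j hj y]
      exact iteratedFDeriv_add_apply ((hfk _).of_le hj').contDiffAt (hSk.of_le hj').contDiffAt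
    have e2 : ∀ n, iteratedFDeriv ℝ j (f (φ n)) y = iteratedFDeriv ℝ j (f (φ 0)) y +
        ∑ i ∈ Finset.range n, iteratedFDeriv ℝ j (D i) y := by
      intro n
      have e3 : ∀ i, iteratedFDeriv ℝ j (D i) y =
          iteratedFDeriv ℝ j (f (φ (i + 1))) y - iteratedFDeriv ℝ j (f (φ i)) y := fun i =>
        iteratedFDeriv_sub_apply ((hfk _).of_le hj').contDiffAt ((hfk _).of_le hj').contDiffAt
      simp_rw [e3]
      rw [Finset.sum_range_sub (fun i => iteratedFDeriv ℝ j (f (φ i)) y)]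
      abel
    rw [e1, funext e2]
    refine tendsto_const_nhds.add (Summable.hasSum ?_).tendsto_sum_nat
    exact Summable.of_norm_bounded hsumm fun n => hDb j n y hj
  have hlim0 : ∀ y, Tendsto (fun n => f (φ n) y) atTop (𝓝 (g y)) := by
    intro y
    have := hlim 0 (Nat.zero_le _) y
    have h2 := ((ContinuousMultilinearMap.apply ℝ (fun _ : Fin 0 => Euc d) ℝ
      (fun _ => 0)).continuous.tendsto _).comp this
    simpa [Function.comp_def] using h2
  refine ⟨g, ?_, φ, hφ, hlim0⟩
  rw [mem_holderClass_univ_iff]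
  refine ⟨hgk, fun y v => ?_⟩
  have ht : Tendsto (fun n => |taylorRem k (f (φ n)) y v|) atTop (𝓝 |taylorRem k g y v|) := by
    refine Tendsto.abs ((hlim0 (y + v)).sub (tendsto_finsetSum _ fun j hj => ?_))
    refine Tendsto.const_mul _ ?_
    have hj' : j ≤ k := Nat.lt_succ_iff.1 (Finset.mem_range.1 hj)
    exact ((ContinuousMultilinearMap.apply ℝ (fun _ : Fin j => Euc d) ℝ
      (fun _ => v)).continuous.tendsto _).comp (hlim j hj' y)
  exact le_of_tendsto ht (Eventually.of_forall fun n => (mem_holderClass_univ_iff.1 (hf (φ n))).2 y v)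

/-- The `L²` classes of the competitors in the optimal recovery problem. -/
def recoverySet (d : ℕ) (β : ℝ) : Set (Lp ℝ 2 (volume : Measure (Euc d))) :=
  {u | ∃ f ∈ holderClass (d := d) β 1 Set.univ, 1 ≤ f 0 ∧ f =ᵐ[volume] u}

theorem convex_recoverySet {β : ℝ} : Convex ℝ (recoverySet d β) := by
  rintro u ⟨f, hf, hf0, hfu⟩ v ⟨g, hg, hg0, hgv⟩ a b ha hb hab
  refine ⟨fun x => a * f x + b * g x, ?_, ?_, ?_⟩
  · have := holderClass_add (holderClass_const_mul hf a) (holderClass_const_mul hg b)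
    rwa [abs_of_nonneg ha, abs_of_nonneg hb, mul_one, mul_one, hab] at this
  · nlinarith
  · filter_upwards [hfu, hgv, Lp.coeFn_add (a • u) (b • v), Lp.coeFn_smul a u, Lp.coeFn_smul b v]
      with x h1 h2 h3 h4 h5
    rw [h3, Pi.add_apply, h4, h5, Pi.smul_apply, Pi.smul_apply, smul_eq_mul, smul_eq_mul, h1, h2]

theorem integral_sub_sq_eq_dist_sq {f g : Euc d → ℝ} {u v : Lp ℝ 2 (volume : Measure (Euc d))}
    (hf : f =ᵐ[volume] u) (hg : g =ᵐ[volume] v) :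
    ∫ x, (f x - g x) ^ 2 = dist u v ^ 2 := by
  rw [dist_eq_norm, ← real_inner_self_eq_norm_sq, L2.inner_def]
  refine integral_congr_ae ?_
  filter_upwards [hf, hg, Lp.coeFn_sub u v] with x h1 h2 h3
  rw [h3, Pi.sub_apply, h1, h2]
  simp [sq]

/-- The pointwise limit along a subsequence keeps the Hölder bound and the value at 0; a further
subsequence converges almost everywhere to the L² limit, so the two agree. -/
theorem isClosed_recoverySet {β : ℝ} (hβ : 0 < β) : IsClosed (recoverySet d β) := by
  refine IsSeqClosed.isClosed fun u a hu hua => ?_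
  choose f hf hf0 hfu using hu
  have hf2 : ∀ n, MemLp (f n) 2 volume := fun n => (memLp_congr_ae (hfu n)).2 (Lp.memLp (u n))
  have hC : ∀ ε > 0, ∃ N, ∀ m ≥ N, ∀ n ≥ N, ∫ x, (f m x - f n x) ^ 2 ≤ ε := by
    intro ε hε
    obtain ⟨N, hN⟩ := Metric.cauchySeq_iff.1 hua.cauchySeq (√ε) (Real.sqrt_pos.2 hε)
    refine ⟨N, fun m hm n hn => ?_⟩
    rw [integral_sub_sq_eq_dist_sq (hfu m) (hfu n)]
    exact (Real.le_sqrt dist_nonneg hε.le).1 (hN m hm n hn).le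
  obtain ⟨g, hg, φ, hφ, hlim⟩ := exists_holder_limit hβ zero_le_one hf hf2 hC
  refine ⟨g, hg, ge_of_tendsto (hlim 0) (Eventually.of_forall fun n => hf0 _), ?_⟩
  have hmeas : TendstoInMeasure volume (fun n => (u (φ n) : Euc d → ℝ)) atTop a := by
    have h1 : Tendsto (fun n => u (φ n)) atTop (𝓝 a) := hua.comp hφ.tendsto_atTop
    exact tendstoInMeasure_of_tendsto_Lp h1
  obtain ⟨ns, hns, hae⟩ := hmeas.exists_seq_tendsto_ae
  filter_upwards [hae, ae_all_iff.2 hfu] with x h1 h2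
  have h3 := (hlim x).comp hns.tendsto_atTop
  refine tendsto_nhds_unique h3 ?_
  simpa only [Function.comp_def, h2] using h1

theorem exists_isOptimalRecovery (d : ℕ) {β : ℝ} (hβ : 0 < β) :
    ∃ γ : Euc d → ℝ, IsOptimalRecovery β γ := by
  have hmem : ∀ g ∈ holderClass (d := d) β 1 Set.univ, 1 ≤ g 0 → ∀ hg : MemLp g 2 volume,
      hg.toLp g ∈ recoverySet d β := fun g hg hg0 hg2 => ⟨g, hg, hg0, (hg2.coeFn_toLp).symm⟩
  obtain ⟨f₀, hf₀, hf₀0, hf₀2⟩ := exists_feasible d hβ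
  obtain ⟨u, ⟨γ, hγ, hγ0, hγu⟩, hu⟩ := exists_norm_eq_iInf_of_complete_convex
    ⟨_, hmem f₀ hf₀ hf₀0 hf₀2⟩ (isClosed_recoverySet hβ).isComplete convex_recoverySet 0
  have hγ2 : MemLp γ 2 volume := (memLp_congr_ae hγu).2 (Lp.memLp u)
  refine ⟨γ, hγ, hγ0, hγ2, fun g hg hg0 => ?_⟩
  by_cases hg2 : MemLp g 2 volume
  · have h1 : ‖u‖ ≤ ‖hg2.toLp g‖ := by
      rw [zero_sub, norm_neg] at hu
      rw [hu]
      refine (ciInf_le ⟨0, ?_⟩ (⟨_, hmem g hg hg0 hg2⟩ : recoverySet d β)).trans (by simp)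
      rintro _ ⟨w, rfl⟩
      exact norm_nonneg _
    rw [eLpNorm_congr_ae hγu]
    rw [Lp.norm_def, Lp.norm_toLp] at h1
    exact (ENNReal.toReal_le_toReal (Lp.eLpNorm_ne_top u) hg2.2.ne).1 h1
  -- A competitor outside L² is still continuous, hence measurable, so its seminorm is infinite and
  -- there is nothing to compare.
  · have hgc : Continuous g := (mem_holderClass_univ_iff.1 hg).1.continuous
    have : eLpNorm g 2 volume = ⊤ := by
      by_contra h
      exact hg2 ⟨hgc.aestronglyMeasurable, lt_top_iff_ne_top.2 h⟩
    rw [this]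
    exact le_top

theorem IsOptimalRecovery.norm_pos {β : ℝ} {γ : Euc d → ℝ} (h : IsOptimalRecovery β γ) :
    0 < (eLpNorm γ 2 volume).toReal := by
  obtain ⟨h1, h2, h3, -⟩ := h
  have hc : Continuous γ := (mem_holderClass_univ_iff.1 h1).1.continuous
  refine ENNReal.toReal_pos (fun h0 => ?_) h3.2.ne
  rw [eLpNorm_eq_zero_iff h3.1 two_ne_zero] at h0
  have := hc.ae_eq_iff_eq volume continuous_zero |>.1 h0
  rw [this] at h2
  simp at h2
  linarith

/-! ### Approximating the solution by compactly supported profiles -/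

/-- Leibniz along a line, then resummation of the triangular double sum by rows. The asymmetric form
matters: the remainder of f is multiplied only by a value of g, so a cut-off g with values in [0, 1]
does not enlarge the main Hölder constant. -/
theorem taylorRem_mul {f g : Euc d → ℝ} {k : ℕ} (hf : ContDiff ℝ k f) (hg : ContDiff ℝ k g)
    (y v : Euc d) : taylorRem k (fun x => f x * g x) y v = g (y + v) * taylorRem k f y v +
      ∑ i ∈ Finset.range (k + 1), ((i.factorial : ℝ))⁻¹ * iteratedFDeriv ℝ i f y (fun _ => v) *
        taylorRem (k - i) g y v := by
  have hle : ∀ i ∈ Finset.range (k + 1), i ≤ k := fun i hi =>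
    Nat.lt_succ_iff.1 (Finset.mem_range.1 hi)
  set a : ℕ → ℝ := fun i => ((i.factorial : ℝ))⁻¹ * iteratedFDeriv ℝ i f y (fun _ => v) with ha
  set b : ℕ → ℝ := fun i => ((i.factorial : ℝ))⁻¹ * iteratedFDeriv ℝ i g y (fun _ => v) with hb
  have h1 : ∀ n ∈ Finset.range (k + 1), ((n.factorial : ℝ))⁻¹ *
      iteratedFDeriv ℝ n (fun x => f x * g x) y (fun _ => v) =
      ∑ i ∈ Finset.range (n + 1), a i * b (n - i) := by
    intro n hn
    have hn' := hle n hn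
    have hn'' : (n : WithTop ℕ∞) ≤ k := by exact_mod_cast hn'
    rw [← iteratedDeriv_line (hf.mul hg) y v hn']
    have := iteratedDeriv_mul (n := n) (x := (0 : ℝ))
      ((contDiff_line hf y v).of_le hn'').contDiffAt ((contDiff_line hg y v).of_le hn'').contDiffAt
    change _ * iteratedDeriv n ((fun t : ℝ => f (y + t • v)) * fun t : ℝ => g (y + t • v)) 0 = _
    rw [this, Finset.mul_sum]
    refine Finset.sum_congr rfl fun i hi => ?_
    have hi' : i ≤ n := Nat.lt_succ_iff.1 (Finset.mem_range.1 hi)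
    rw [iteratedDeriv_line hf y v (hi'.trans hn'),
      iteratedDeriv_line hg y v ((Nat.sub_le _ _).trans hn'), Nat.cast_choose ℝ hi']
    simp only [ha, hb]
    have h1 : (n.factorial : ℝ) ≠ 0 := by positivity
    field_simp
  have h2 : ∀ i ∈ Finset.range (k + 1), taylorRem (k - i) g y v = g (y + v) -
      ∑ l ∈ Finset.range (k + 1 - i), b l := by
    intro i hi
    rw [taylorRem, Nat.succ_sub (hle i hi)]
  rw [taylorRem, Finset.sum_congr rfl h1, Finset.sum_range_diag_flip (k + 1) (fun i l => a i * b l)]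
  have h3 : ∀ i ∈ Finset.range (k + 1), ((i.factorial : ℝ))⁻¹ *
      iteratedFDeriv ℝ i f y (fun _ => v) * taylorRem (k - i) g y v =
      a i * g (y + v) - ∑ l ∈ Finset.range (k + 1 - i), a i * b l := by
    intro i hi
    rw [h2 i hi, mul_sub, Finset.mul_sum]
  rw [Finset.sum_congr rfl h3, Finset.sum_sub_distrib, ← Finset.sum_mul, taylorRem]
  ring

/-- Multiply γ by the slowly varying cut-off χ(c x). The extra remainder terms carry factors c^(β-i)
with β - i > 0 and vanish as c → 0, while 0 ≤ χ ≤ 1 and χ 0 = 1 preserve the L² bound and the value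
at 0. -/
theorem exists_compactSupport_approx {β : ℝ} (hβ : 0 < β) {γ : Euc d → ℝ}
    (hγ : γ ∈ holderClass β 1 Set.univ) (hγ0 : 1 ≤ γ 0) (hγ2 : MemLp γ 2 volume) {ε : ℝ}
    (hε : 0 < ε) : ∃ f ∈ holderClass (d := d) β (1 + ε) Set.univ, 1 ≤ f 0 ∧
      HasCompactSupport f ∧ ∫ x, f x ^ 2 ≤ ∫ x, γ x ^ 2 := by
  set k := strictFloor β with hk
  obtain ⟨χ, hχ1, hχ2, hχ3, hχ4⟩ := exists_smooth_cutoff d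
  obtain ⟨B, hB0, hB⟩ := exists_bound_iteratedFDeriv_of_memLp hβ zero_le_one hγ hγ2
  have hpos : ∀ i ≤ k, 0 < β - i := fun i hi => by
    have : (i : ℝ) ≤ k := by exact_mod_cast hi
    linarith [strictFloor_lt hβ]
  have hC : ∀ i : ℕ, ∃ C, 0 ≤ C ∧ (i ≤ k → χ ∈ holderClass (β - i) C Set.univ) := by
    intro i
    by_cases hi : i ≤ k
    · obtain ⟨C, h1, h2⟩ := mem_holderClass_of_smooth hχ1 hχ2 (hpos i hi)
      exact ⟨C, h1, fun _ => h2⟩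
    · exact ⟨0, le_rfl, fun h => absurd h hi⟩
  choose C hC0 hC using hC
  have hle : ∀ i ∈ Finset.range (k + 1), i ≤ k := fun i hi =>
    Nat.lt_succ_iff.1 (Finset.mem_range.1 hi)
  obtain ⟨c, hc0, hc⟩ : ∃ c : ℝ, 0 < c ∧
      ∑ i ∈ Finset.range (k + 1), B * (C i * c ^ (β - i)) ≤ ε := by
    have hlim : Tendsto (fun c : ℝ => ∑ i ∈ Finset.range (k + 1), B * (C i * c ^ (β - i)))
        (𝓝[>] 0) (𝓝 0) := by
      have : Tendsto (fun c : ℝ => ∑ i ∈ Finset.range (k + 1), B * (C i * c ^ (β - i)))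
          (𝓝 0) (𝓝 (∑ i ∈ Finset.range (k + 1), B * (C i * 0 ^ (β - i)))) :=
        tendsto_finsetSum _ fun i hi => (((Real.continuousAt_rpow_const _ _
          (Or.inr (hpos i (hle i hi)).le)).tendsto.const_mul _).const_mul _)
      rw [Finset.sum_eq_zero fun i hi => by
        rw [Real.zero_rpow (hpos i (hle i hi)).ne', mul_zero, mul_zero]] at this
      exact this.mono_left nhdsWithin_le_nhds
    obtain ⟨c, h1, h3⟩ := ((hlim.eventually (eventually_le_nhds hε)).and self_mem_nhdsWithin).exists
    exact ⟨c, h3, h1⟩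
  have hγ' := mem_holderClass_univ_iff.1 hγ
  have hχc : ∀ i ≤ k, (fun x => χ (c • x)) ∈ holderClass (β - i) (C i * c ^ (β - i)) Set.univ := by
    intro i hi
    simpa using holderClass_affine (hC i hi) (A := 1) zero_le_one hc0.le 0
  have hχcont : Continuous fun x : Euc d => χ (c • x) :=
    hχ1.continuous.comp (continuous_const_smul c)
  refine ⟨fun x => γ x * χ (c • x), ?_, by simpa [hχ3] using hγ0, ?_, ?_⟩
  · rw [mem_holderClass_univ_iff]
    have hχk : ContDiff ℝ k (fun x => χ (c • x)) := by
      simpa [hk] using (mem_holderClass_univ_iff.1 (hχc 0 (Nat.zero_le _))).1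
    refine ⟨hγ'.1.mul hχk, fun y v => ?_⟩
    rw [taylorRem_mul hγ'.1 hχk]
    have h1 : |χ (c • (y + v)) * taylorRem k γ y v| ≤ 1 * ‖v‖ ^ β := by
      rw [abs_mul, abs_of_nonneg (hχ4 _).1]
      exact (mul_le_of_le_one_left (abs_nonneg _) (hχ4 _).2).trans (hγ'.2 y v)
    have h2 : ∀ i ∈ Finset.range (k + 1),
        |((i.factorial : ℝ))⁻¹ * iteratedFDeriv ℝ i γ y (fun _ => v) *
        taylorRem (k - i) (fun x => χ (c • x)) y v| ≤ B * (C i * c ^ (β - i)) * ‖v‖ ^ β := by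
      intro i hi
      have hi' := hle i hi
      have h3 := (mem_holderClass_univ_iff.1 (hχc i hi')).2 y v
      rw [strictFloor_sub] at h3
      have h4 := hB i hi' y v
      have hk1 : ((i.factorial : ℝ))⁻¹ ≤ 1 :=
        inv_le_one_of_one_le₀ (by exact_mod_cast Nat.one_le_iff_ne_zero.2 i.factorial_ne_zero)
      have h5 : ‖v‖ ^ i * ‖v‖ ^ (β - i) = ‖v‖ ^ β := by
        rw [← Real.rpow_natCast, ← Real.rpow_add' (norm_nonneg _) (by simpa using hβ.ne')]
        simp
      rw [abs_mul, abs_mul, abs_of_nonneg (by positivity : (0 : ℝ) ≤ ((i.factorial : ℝ))⁻¹)]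
      calc _ ≤ 1 * (B * ‖v‖ ^ i) * (C i * c ^ (β - i) * ‖v‖ ^ (β - i)) := by
            gcongr
        _ = B * (C i * c ^ (β - i)) * (‖v‖ ^ i * ‖v‖ ^ (β - i)) := by ring
        _ = _ := by rw [h5]
    refine (abs_add_le _ _).trans ?_
    rw [add_mul]
    refine add_le_add h1 ((Finset.abs_sum_le_sum_abs _ _).trans ((Finset.sum_le_sum h2).trans ?_))
    rw [← Finset.sum_mul]
    exact mul_le_mul_of_nonneg_right hc (by positivity)
  · exact (hχ2.comp_smul hc0.ne').mul_left
  · refine integral_mono_of_nonneg (Eventually.of_forall fun _ => sq_nonneg _) hγ2.integrable_sq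
      (Eventually.of_forall fun x => ?_)
    simp only [mul_pow]
    exact mul_le_of_le_one_right (sq_nonneg _) (pow_le_one₀ (hχ4 _).1 (hχ4 _).2)

/-! ### Truncated second moment method -/

theorem integral_abs_le_sqrt {Ω : Type*} [MeasurableSpace Ω] (P : Measure Ω)
    [IsProbabilityMeasure P] {W : Ω → ℝ} (hW : Integrable W P)
    (hW2 : Integrable (fun x => W x ^ 2) P) : ∫ x, |W x| ∂P ≤ √(∫ x, W x ^ 2 ∂P) := by
  set c := ∫ x, |W x| ∂P
  refine Real.le_sqrt_of_sq_le ?_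
  have h1 : 0 ≤ ∫ x, (W x ^ 2 - 2 * c * |W x| + c ^ 2) ∂P := by
    refine integral_nonneg fun x => ?_
    have : W x ^ 2 - 2 * c * |W x| + c ^ 2 = (|W x| - c) ^ 2 := by
      rw [← sq_abs (W x)]; ring
    rw [Pi.zero_apply, this]
    positivity
  have hi : Integrable (fun x => W x ^ 2 - 2 * c * |W x|) P := hW2.sub (hW.abs.const_mul _)
  rw [integral_add hi (integrable_const _),
    integral_sub hW2 (hW.abs.const_mul _), integral_const_mul, integral_const] at h1
  simp only [probReal_univ, smul_eq_mul, one_mul] at h1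
  change 0 ≤ _ - 2 * c * c + c ^ 2 at h1
  nlinarith

/-- A lower bound for the error of a test of a simple hypothesis against a finite composite
alternative, by truncation of the likelihood ratios and the second moment method. -/
theorem exists_integral_mul_likelihood_le {Ω ι : Type*} [MeasurableSpace Ω] (P : Measure Ω)
    [IsProbabilityMeasure P] [Fintype ι] [Nonempty ι] [DecidableEq ι] {Λ : ι → Ω → ℝ}
    (hmeas : ∀ i, Measurable (Λ i)) (hnn : ∀ i x, 0 ≤ Λ i x) (hint : ∀ i, Integrable (Λ i) P)
    (hone : ∀ i, ∫ x, Λ i x ∂P = 1) {ε s K M : ℝ} (hε : 0 ≤ ε) (hs : 0 < s) (hK : 0 < K)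
    (hcross : ∀ i j, i ≠ j → Integrable (fun x => Λ i x * Λ j x) P ∧
      ∫ x, Λ i x * Λ j x ∂P ≤ 1 + ε)
    (hmom : ∀ i, Integrable (fun x => Λ i x ^ (1 + s)) P ∧ ∫ x, Λ i x ^ (1 + s) ∂P ≤ M)
    {ψ : Ω → ℝ} (hψ : Measurable ψ) (hψ01 : ∀ x, ψ x ∈ Set.Icc (0 : ℝ) 1) :
    ∃ i, ∫ x, ψ x * Λ i x ∂P ≤ ∫ x, ψ x ∂P + M * K ^ (-s) +
      √(K / Fintype.card ι + ε + 2 * (M * K ^ (-s))) := by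
  set N : ℝ := (Fintype.card ι : ℝ) with hN
  have hN0 : 0 < N := by simpa [hN] using Fintype.card_pos
  set e := M * K ^ (-s)
  -- Truncation at K replaces the second moment of a single likelihood ratio, which is too large
  -- here, by K; only a moment of order 1 + s is needed to control the mass that is cut off.
  let T : ι → Ω → ℝ := fun i x => if Λ i x ≤ K then Λ i x else 0
  have hTmeas : ∀ i, Measurable (T i) := fun i =>
    Measurable.ite (measurableSet_le (hmeas i) measurable_const) (hmeas i) measurable_const
  have hT0 : ∀ i x, 0 ≤ T i x := fun i x => by simp only [T]; split_ifs <;> simp [hnn]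
  have hTK : ∀ i x, T i x ≤ K := fun i x => by
    simp only [T]; split_ifs with h
    · exact h
    · exact hK.le
  have hTle : ∀ i x, T i x ≤ Λ i x := fun i x => by
    simp only [T]; split_ifs with h
    · exact le_rfl
    · exact hnn i x
  have hTint : ∀ i, Integrable (T i) P := fun i =>
    (hint i).mono' (hTmeas i).aestronglyMeasurable
      (Eventually.of_forall fun x => by rw [Real.norm_of_nonneg (hT0 i x)]; exact hTle i x)
  have hbd : ∀ {W : Ω → ℝ} (C : ℝ), Measurable W → (∀ x, |W x| ≤ C) → Integrable W P :=
    fun C hW hC => (integrable_const C).mono' hW.aestronglyMeasurable (Eventually.of_forall hC)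
  have hψint : ∀ {W : Ω → ℝ}, Integrable W P → Integrable (fun x => ψ x * W x) P := fun hW =>
    hW.bdd_mul hψ.aestronglyMeasurable (c := 1) (Eventually.of_forall fun x => by
      rw [Real.norm_of_nonneg (hψ01 x).1]; exact (hψ01 x).2)
  -- Markov's inequality in pointwise form: where the ratio exceeds K, (Λ/K)^s is at least 1.
  have hdiff : ∀ i x, Λ i x - T i x ≤ Λ i x ^ (1 + s) * K ^ (-s) := by
    intro i x
    simp only [T]
    split_ifs with h
    · rw [sub_self]
      exact mul_nonneg (Real.rpow_nonneg (hnn i x) _) (Real.rpow_nonneg hK.le _)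
    · push Not at h
      have hpos : 0 < Λ i x := hK.trans h
      rw [sub_zero, Real.rpow_add hpos, Real.rpow_one, Real.rpow_neg hK.le, mul_assoc,
        ← div_eq_mul_inv]
      refine le_mul_of_one_le_right hpos.le ?_
      rw [one_le_div (Real.rpow_pos_of_pos hK _)]
      exact Real.rpow_le_rpow hK.le h.le hs.le
  have hdiffint : ∀ i, ∫ x, Λ i x ∂P - ∫ x, T i x ∂P ≤ e := by
    intro i
    rw [← integral_sub (hint i) (hTint i)]
    calc _ ≤ ∫ x, Λ i x ^ (1 + s) * K ^ (-s) ∂P :=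
          integral_mono ((hint i).sub (hTint i)) ((hmom i).1.mul_const _) (hdiff i)
      _ ≤ _ := by
          rw [integral_mul_const]
          exact mul_le_mul_of_nonneg_right (hmom i).2 (Real.rpow_nonneg hK.le _)
  have hTone : ∀ i, 1 - e ≤ ∫ x, T i x ∂P := fun i => by
    have := hdiffint i
    rw [hone i] at this
    linarith
  have hψT : ∀ i, ∫ x, ψ x * Λ i x ∂P ≤ ∫ x, ψ x * T i x ∂P + e := by
    intro i
    rw [← sub_le_iff_le_add', ← integral_sub (hψint (hint i)) (hψint (hTint i))]
    refine le_trans ?_ (hdiffint i)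
    rw [← integral_sub (hint i) (hTint i)]
    refine integral_mono ((hψint (hint i)).sub (hψint (hTint i))) ((hint i).sub (hTint i))
      fun x => ?_
    simp only
    rw [← mul_sub]
    exact mul_le_of_le_one_left (sub_nonneg.2 (hTle i x)) (hψ01 x).2
  have hTTint : ∀ i j, Integrable (fun x => T i x * T j x) P := fun i j =>
    hbd (K * K) ((hTmeas i).mul (hTmeas j)) fun x => by
      rw [abs_of_nonneg (mul_nonneg (hT0 i x) (hT0 j x))]
      exact mul_le_mul (hTK i x) (hTK j x) (hT0 j x) hK.le
  have hTT : ∀ i j, ∫ x, T i x * T j x ∂P ≤ (1 + ε) + if i = j then K else 0 := by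
    intro i j
    split_ifs with hij
    · subst hij
      have : ∫ x, T i x * T i x ∂P ≤ K := by
        calc _ ≤ ∫ x, K * Λ i x ∂P := integral_mono (hTTint i i) ((hint i).const_mul _)
              fun x => mul_le_mul (hTK i x) (hTle i x) (hT0 i x) hK.le
          _ = K := by rw [integral_const_mul, hone, mul_one]
      linarith
    · rw [add_zero]
      refine le_trans ?_ (hcross i j hij).2
      exact integral_mono (hTTint i j) (hcross i j hij).1 fun x =>
        mul_le_mul (hTle i x) (hTle j x) (hT0 j x) (hnn i x)
  -- The average of the truncated ratios has mean nearly 1 and second moment at most 1 + ε + K/N, so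
  -- it is close to 1 in L², hence in L¹. No test in [0, 1] can then separate the mixture from P.
  let Z : Ω → ℝ := fun x => N⁻¹ * ∑ i, T i x
  have hZint : Integrable Z P := (integrable_finsetSum _ fun i _ => hTint i).const_mul _
  have hZ1 : 1 - e ≤ ∫ x, Z x ∂P := by
    rw [integral_const_mul, integral_finsetSum _ fun i _ => hTint i]
    have := Finset.sum_le_sum fun i (_ : i ∈ Finset.univ) => hTone i
    rw [Finset.sum_const, Finset.card_univ, nsmul_eq_mul] at this
    rw [inv_mul_eq_div, le_div_iff₀ hN0, mul_comm]
    exact this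
  have hZ2eq : ∀ x, Z x ^ 2 = N⁻¹ ^ 2 * ∑ i, ∑ j, T i x * T j x := fun x => by
    simp only [Z]
    rw [mul_pow, sq (∑ i, T i x), Finset.sum_mul_sum]
  have hZ2int : Integrable (fun x => Z x ^ 2) P := by
    simp_rw [hZ2eq]
    exact (integrable_finsetSum _ fun i _ => integrable_finsetSum _ fun j _ => hTTint i j).const_mul _
  have hZ2 : ∫ x, Z x ^ 2 ∂P ≤ K / N + 1 + ε := by
    simp_rw [hZ2eq]
    rw [integral_const_mul, integral_finsetSum _ fun i _ => integrable_finsetSum _ fun j _ => hTTint i j]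
    simp_rw [integral_finsetSum _ fun j _ => hTTint _ j]
    have : ∑ i, ∑ j, ∫ x, T i x * T j x ∂P ≤ N * (N * (1 + ε) + K) := by
      refine (Finset.sum_le_sum fun i _ => Finset.sum_le_sum fun j _ => hTT i j).trans ?_
      simp only [Finset.sum_add_distrib, Finset.sum_const, Finset.card_univ, nsmul_eq_mul,
        Finset.sum_ite_eq, Finset.mem_univ, if_true, ← hN]
      linarith
    calc _ ≤ N⁻¹ ^ 2 * (N * (N * (1 + ε) + K)) := by gcongr
      _ = _ := by field_simp; ring
  have hW : ∫ x, (Z x - 1) ^ 2 ∂P ≤ K / N + ε + 2 * e := by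
    have : ∀ x, (Z x - 1) ^ 2 = Z x ^ 2 - 2 * Z x + 1 := fun x => by ring
    simp_rw [this]
    have hi : Integrable (fun x => Z x ^ 2 - 2 * Z x) P := hZ2int.sub (hZint.const_mul 2)
    rw [integral_add hi (integrable_const _),
      integral_sub hZ2int (hZint.const_mul 2), integral_const_mul]
    simp only [integral_const, probReal_univ, smul_eq_mul, mul_one]
    linarith
  have hW2int : Integrable (fun x => (Z x - 1) ^ 2) P := by
    have : ∀ x, (Z x - 1) ^ 2 = Z x ^ 2 - 2 * Z x + 1 := fun x => by ring
    simp_rw [this]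
    exact (hZ2int.sub (hZint.const_mul 2)).add (integrable_const _)
  have hψint' : Integrable ψ P := by simpa using hψint (integrable_const (1 : ℝ))
  have hψZ : ∫ x, ψ x * Z x ∂P ≤ ∫ x, ψ x ∂P + √(K / N + ε + 2 * e) := by
    have h1 : ∫ x, ψ x * Z x ∂P = ∫ x, ψ x ∂P + ∫ x, ψ x * (Z x - 1) ∂P := by
      have hi : Integrable (fun x => ψ x * (Z x - 1)) P := hψint (hZint.sub (integrable_const _))
      rw [← integral_add hψint' hi]
      exact integral_congr_ae (Eventually.of_forall fun x => by ring)
    rw [h1]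
    refine add_le_add le_rfl ?_
    calc ∫ x, ψ x * (Z x - 1) ∂P ≤ ∫ x, |Z x - 1| ∂P := by
          refine integral_mono (hψint (hZint.sub (integrable_const _)))
            (hZint.sub (integrable_const _)).abs fun x => ?_
          refine (le_abs_self _).trans ?_
          rw [abs_mul, abs_of_nonneg (hψ01 x).1]
          exact mul_le_of_le_one_left (abs_nonneg _) (hψ01 x).2
      _ ≤ √(∫ x, (Z x - 1) ^ 2 ∂P) :=
          integral_abs_le_sqrt P (hZint.sub (integrable_const _)) hW2int
      _ ≤ _ := Real.sqrt_le_sqrt hW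
  have hsum : ∑ i, ∫ x, ψ x * Λ i x ∂P ≤ ∑ _i : ι, (∫ x, ψ x ∂P + e + √(K / N + ε + 2 * e)) := by
    have h1 : ∑ i, ∫ x, ψ x * T i x ∂P = N * ∫ x, ψ x * Z x ∂P := by
      rw [← integral_finsetSum _ fun i _ => hψint (hTint i), ← integral_const_mul]
      refine integral_congr_ae (Eventually.of_forall fun x => ?_)
      simp only [Z]
      rw [← Finset.mul_sum]
      field_simp
    refine (Finset.sum_le_sum fun i _ => hψT i).trans ?_
    rw [Finset.sum_add_distrib, h1]
    simp only [Finset.sum_const, Finset.card_univ, nsmul_eq_mul, ← hN]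
    nlinarith
  -- The bound holds on average over the alternatives, so it holds for at least one of them.
  obtain ⟨i, -, hi⟩ := Finset.exists_le_of_sum_le Finset.univ_nonempty hsum
  exact ⟨i, hi⟩

/-! ### Product measures and moments of product likelihood ratios -/

theorem pi_withDensity_ofReal {ι E : Type*} [Fintype ι] [MeasurableSpace E] (μ : Measure E)
    [IsProbabilityMeasure μ] {g : ι → E → ℝ} (hg0 : ∀ i x, 0 ≤ g i x)
    (hgi : ∀ i, Integrable (g i) μ) :
    Measure.pi (fun i => μ.withDensity fun x => ENNReal.ofReal (g i x)) =
      (Measure.pi fun _ : ι => μ).withDensity fun x => ENNReal.ofReal (∏ i, g i (x i)) := by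
  have hfin : ∀ i, IsFiniteMeasure (μ.withDensity fun x => ENNReal.ofReal (g i x)) := fun i =>
    isFiniteMeasure_withDensity_ofReal (hgi i).2
  have hprod : Integrable (fun x : ι → E => ∏ i, g i (x i)) (Measure.pi fun _ => μ) :=
    Integrable.fintype_prod hgi
  refine Measure.pi_eq fun s hs => ?_
  have hset : ∀ i, (μ.withDensity fun x => ENNReal.ofReal (g i x)) (s i) =
      ENNReal.ofReal (∫ x, (s i).indicator (g i) x ∂μ) := by
    intro i
    rw [withDensity_apply _ (hs i), integral_indicator (hs i),
      ofReal_integral_eq_lintegral_ofReal (hgi i).integrableOn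
        (Eventually.of_forall fun x => hg0 i x)]
  rw [withDensity_apply _ (MeasurableSet.univ_pi hs)]
  simp_rw [hset]
  rw [← ENNReal.ofReal_prod_of_nonneg fun i _ =>
    integral_nonneg fun x => Set.indicator_nonneg (fun _ _ => hg0 i _) _]
  rw [← integral_fintype_prod_eq_prod (μ := fun _ : ι => μ) (fun i => (s i).indicator (g i))]
  rw [← ofReal_integral_eq_lintegral_ofReal hprod.integrableOn
    (Eventually.of_forall fun x => Finset.prod_nonneg fun i _ => hg0 i _),
    ← integral_indicator (MeasurableSet.univ_pi hs)]
  congr 2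
  funext x
  by_cases hx : x ∈ Set.univ.pi s
  · rw [Set.indicator_of_mem hx]
    exact Finset.prod_congr rfl fun i _ => (Set.indicator_of_mem (hx i trivial) _).symm
  · rw [Set.indicator_of_notMem hx]
    simp only [Set.mem_univ_pi, not_forall] at hx
    obtain ⟨i, hi⟩ := hx
    exact (Finset.prod_eq_zero (Finset.mem_univ i) (Set.indicator_of_notMem hi _)).symm

/-- Write the power as exp((1+s) log(1+u)) and expand both functions to second order. The quadratic
terms (1+s)²/2 and -(1+s)/2 combine to the exact coefficient (1+s)s/2, on which the sharp constant
depends; the cubic errors add up as 4 + 6 + 15 = 25. -/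
theorem one_add_rpow_le {s u : ℝ} (hs0 : 0 ≤ s) (hs1 : s ≤ 1) (hu : |u| ≤ 1 / 8) :
    (1 + u) ^ (1 + s) ≤ 1 + (1 + s) * u + (1 + s) * s / 2 * u ^ 2 + 25 * |u| ^ 3 := by
  set a := |u| with ha
  have ha0 : 0 ≤ a := abs_nonneg u
  have hua := abs_le.1 (le_of_eq ha.symm)
  have hu2 : u ^ 2 = a ^ 2 := (sq_abs u).symm
  have hpos : 0 < 1 + u := by linarith [hua.1]
  have hlog := Real.abs_log_sub_add_sum_range_le (x := -u) (by rw [abs_neg]; linarith) 2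
  rw [abs_neg, sub_neg_eq_add, ← ha] at hlog
  simp only [Finset.sum_range_succ, Finset.sum_range_zero] at hlog
  norm_num at hlog
  have h3 : a ^ 3 / (1 - a) ≤ 2 * a ^ 3 := by
    rw [div_le_iff₀ (by linarith)]
    nlinarith [pow_nonneg ha0 3]
  have hlog' : Real.log (1 + u) ≤ u - u ^ 2 / 2 + 2 * a ^ 3 := by
    have := (abs_le.1 (hlog.trans h3)).2
    linarith
  set w := u - u ^ 2 / 2 + 2 * a ^ 3 with hw
  set y := (1 + s) * w with hy
  have ha3 : a ^ 3 ≤ a ^ 2 / 8 := by nlinarith [sq_nonneg a]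
  have ha2 : a ^ 2 ≤ a / 8 := by nlinarith
  have hwu : |w - u| ≤ a ^ 2 := by
    rw [abs_le]
    constructor <;> nlinarith [pow_nonneg ha0 3]
  have hwa : |w| ≤ 2 * a := by
    have := abs_add_le (w - u) u
    rw [sub_add_cancel] at this
    linarith
  have hw2 : w ^ 2 ≤ u ^ 2 + 3 * a ^ 3 := by
    have h1 : w ^ 2 = u ^ 2 + (w - u) * (2 * u) + (w - u) ^ 2 := by ring
    have h2 : (w - u) * (2 * u) ≤ a ^ 2 * (2 * a) := by
      refine (le_abs_self _).trans ?_
      rw [abs_mul, abs_mul, abs_two]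
      gcongr
    have h3 : (w - u) ^ 2 ≤ (a ^ 2) ^ 2 := by
      rw [← sq_abs]; gcongr
    nlinarith [pow_nonneg ha0 3]
  have hya : |y| ≤ 4 * a := by
    rw [hy, abs_mul, abs_of_nonneg (by linarith)]
    calc (1 + s) * |w| ≤ 2 * (2 * a) := by gcongr; linarith
      _ = 4 * a := by ring
  have hexp := Real.exp_bound (x := y) (n := 3) (by linarith) (by norm_num)
  simp only [Finset.sum_range_succ, Finset.sum_range_zero] at hexp
  norm_num [Nat.factorial] at hexp
  have hy3 : |y| ^ 3 ≤ 64 * a ^ 3 := by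
    calc |y| ^ 3 ≤ (4 * a) ^ 3 := by gcongr
      _ = _ := by ring
  have h5 : Real.exp y ≤ 1 + y + y ^ 2 / 2 + 15 * a ^ 3 := by
    have := (abs_le.1 hexp).2
    nlinarith [pow_nonneg ha0 3]
  have h6 : (1 + u) ^ (1 + s) ≤ Real.exp y := by
    rw [Real.rpow_def_of_pos hpos, hy, mul_comm]
    exact Real.exp_le_exp.2 (mul_le_mul_of_nonneg_left hlog' (by linarith))
  have h7 : y ^ 2 ≤ (1 + s) ^ 2 * u ^ 2 + 12 * a ^ 3 := by
    have h8 : (1 + s) ^ 2 ≤ 4 := by nlinarith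
    rw [hy, mul_pow]
    have h9 := mul_le_mul_of_nonneg_left hw2 (sq_nonneg (1 + s))
    have h10 := mul_le_mul_of_nonneg_right h8 (pow_nonneg ha0 3)
    linarith
  have h8 : y ≤ (1 + s) * u - (1 + s) * u ^ 2 / 2 + 4 * a ^ 3 := by
    have h9 := mul_le_mul_of_nonneg_right hs1 (pow_nonneg ha0 3)
    rw [hy, hw]
    linarith
  linarith

theorem abs_mul_le_of_abs_le_one {c t : ℝ} (hc : |c| ≤ 1) : |c * t| ≤ |t| := by
  rw [abs_mul]; exact mul_le_of_le_one_left (abs_nonneg _) hc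

theorem one_add_mul_nonneg {ι E : Type*} {c : ι → ℝ} {g : E → ℝ} (hc : ∀ k, |c k| ≤ 1) (hg1 : ∀ x, |g x| ≤ 1) (k : ι) (x : E) :
    0 ≤ 1 + c k * g x := by
  have := (abs_le.1 ((abs_mul_le_of_abs_le_one (hc k)).trans (hg1 x))).1
  linarith

section Product

variable {ι E : Type*} [Fintype ι] [MeasurableSpace E] {μ : Measure E} [IsProbabilityMeasure μ]
  {c : ι → ℝ} {g g' : E → ℝ}

theorem integrable_of_abs_le (hg : Measurable g) {u : ℝ} (hgu : ∀ x, |g x| ≤ u) :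
    Integrable g μ :=
  (integrable_const u).mono' hg.aestronglyMeasurable (Eventually.of_forall hgu)

theorem integral_one_add_mul (hg : Integrable g μ) (a : ℝ) :
    ∫ x, (1 + a * g x) ∂μ = 1 + a * ∫ x, g x ∂μ := by
  rw [integral_add (integrable_const _) (hg.const_mul _), integral_const_mul]
  simp

theorem integral_prod_one_add (hg : Integrable g μ) (h0 : ∫ x, g x ∂μ = 0) :
    ∫ x : ι → E, ∏ k, (1 + c k * g (x k)) ∂(Measure.pi fun _ => μ) = 1 := by
  rw [integral_fintype_prod_eq_prod (μ := fun _ : ι => μ) (fun k x => 1 + c k * g x)]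
  refine Finset.prod_eq_one fun k _ => ?_
  rw [integral_one_add_mul hg, h0, mul_zero, add_zero]

/-- Fubini factorizes the integral; centring leaves 1 + c_k² ∫ g g' in each factor, and 1 + t ≤ exp
t. -/
theorem integral_prod_mul_prod_le (hc : ∀ k, |c k| ≤ 1) (hg : Measurable g) (hg' : Measurable g')
    (hg1 : ∀ x, |g x| ≤ 1) (hg1' : ∀ x, |g' x| ≤ 1) (h0 : ∫ x, g x ∂μ = 0)
    (h0' : ∫ x, g' x ∂μ = 0) {q : ℝ} (hq : ∫ x, g x * g' x ∂μ ≤ q) :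
    Integrable (fun x : ι → E => (∏ k, (1 + c k * g (x k))) * ∏ k, (1 + c k * g' (x k)))
      (Measure.pi fun _ => μ) ∧
    ∫ x : ι → E, (∏ k, (1 + c k * g (x k))) * (∏ k, (1 + c k * g' (x k))) ∂(Measure.pi fun _ => μ) ≤
      Real.exp ((∑ k, c k ^ 2) * q) := by
  have hgi := integrable_of_abs_le (μ := μ) hg hg1
  have hgi' := integrable_of_abs_le (μ := μ) hg' hg1'
  have hgg : Integrable (fun x => g x * g' x) μ := integrable_of_abs_le (hg.mul hg') (u := 1)
    fun x => by rw [abs_mul]; exact mul_le_one₀ (hg1 x) (abs_nonneg _) (hg1' x)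
  have e : ∀ k x, (1 + c k * g x) * (1 + c k * g' x) =
      1 + c k * g x + c k * g' x + c k ^ 2 * (g x * g' x) := fun k x => by ring
  have hi : ∀ k, Integrable (fun x => (1 + c k * g x) * (1 + c k * g' x)) μ := fun k => by
    simp_rw [e]
    exact (((integrable_const _).add (hgi.const_mul _)).add (hgi'.const_mul _)).add
      (hgg.const_mul _)
  have hI : ∀ k, ∫ x, (1 + c k * g x) * (1 + c k * g' x) ∂μ =
      1 + c k ^ 2 * ∫ x, g x * g' x ∂μ := fun k => by
    simp_rw [e]
    have i1 : Integrable (fun x => 1 + c k * g x) μ := (integrable_const _).add (hgi.const_mul _)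
    have i2 : Integrable (fun x => 1 + c k * g x + c k * g' x) μ := i1.add (hgi'.const_mul _)
    rw [integral_add i2 (hgg.const_mul _), integral_add i1 (hgi'.const_mul _),
      integral_one_add_mul hgi, integral_const_mul, integral_const_mul, h0, h0']
    ring
  simp_rw [← Finset.prod_mul_distrib]
  refine ⟨Integrable.fintype_prod hi, ?_⟩
  rw [integral_fintype_prod_eq_prod (μ := fun _ : ι => μ)
    (fun k x => (1 + c k * g x) * (1 + c k * g' x)), Finset.sum_mul, Real.exp_sum]
  refine Finset.prod_le_prod (fun k _ => integral_nonneg fun x =>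
    mul_nonneg (one_add_mul_nonneg hc hg1 k x) (one_add_mul_nonneg hc hg1' k x)) fun k _ => ?_
  rw [hI, add_comm]
  refine le_trans ?_ (Real.add_one_le_exp _)
  have := mul_le_mul_of_nonneg_left hq (sq_nonneg (c k))
  linarith

/-- The same factorization after a second-order expansion: centring removes the linear term, and the
uniform bound u on g absorbs the cubic error into an ε-fraction of the quadratic term. -/
theorem integral_prod_rpow_le (hc : ∀ k, |c k| ≤ 1) (hg : Measurable g) {u s ε q : ℝ}
    (hu8 : u ≤ 1 / 8) (hgu : ∀ x, |g x| ≤ u) (h0 : ∫ x, g x ∂μ = 0) (hs0 : 0 < s) (hs1 : s ≤ 1)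
    (hε : 25 * u ≤ (1 + s) * s / 2 * ε) (hq : ∫ x, g x ^ 2 ∂μ ≤ q) :
    Integrable (fun x : ι → E => (∏ k, (1 + c k * g (x k))) ^ (1 + s)) (Measure.pi fun _ => μ) ∧
    ∫ x : ι → E, (∏ k, (1 + c k * g (x k))) ^ (1 + s) ∂(Measure.pi fun _ => μ) ≤
      Real.exp ((∑ k, c k ^ 2) * ((1 + s) * s / 2 * (1 + ε) * q)) := by
  have hg1 : ∀ x, |g x| ≤ 1 := fun x => (hgu x).trans (by linarith)
  have hnn := one_add_mul_nonneg hc hg1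
  have hgi := integrable_of_abs_le (μ := μ) hg hgu
  have hgg : Integrable (fun x => g x ^ 2) μ := integrable_of_abs_le (hg.pow_const 2) (u := 1)
    fun x => by rw [abs_pow]; exact pow_le_one₀ (abs_nonneg _) (hg1 x)
  have hi : ∀ k, Integrable (fun x => (1 + c k * g x) ^ (1 + s)) μ := fun k => by
    refine integrable_of_abs_le ((measurable_const.add (hg.const_mul _)).pow_const _)
      (u := 2 ^ (1 + s)) fun x => ?_
    rw [abs_of_nonneg (Real.rpow_nonneg (hnn k x) _)]
    refine Real.rpow_le_rpow (hnn k x) ?_ (by linarith)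
    have := (abs_le.1 ((abs_mul_le_of_abs_le_one (t := g x) (hc k)).trans (hg1 x))).2
    linarith
  have hprod : ∀ x : ι → E, (∏ k, (1 + c k * g (x k))) ^ (1 + s) =
      ∏ k, (1 + c k * g (x k)) ^ (1 + s) := fun x =>
    (Real.finsetProd_rpow _ _ (fun k _ => hnn k _) _).symm
  simp_rw [hprod]
  refine ⟨Integrable.fintype_prod hi, ?_⟩
  rw [integral_fintype_prod_eq_prod (μ := fun _ : ι => μ)
    (fun k x => (1 + c k * g x) ^ (1 + s)), Finset.sum_mul, Real.exp_sum]
  refine Finset.prod_le_prod (fun k _ => integral_nonneg fun x => Real.rpow_nonneg (hnn k x) _)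
    fun k _ => ?_
  set D := (1 + s) * s / 2 * (1 + ε)
  have hu0 : ∀ x, 0 ≤ u := fun x => (abs_nonneg _).trans (hgu x)
  have hpt : ∀ x, (1 + c k * g x) ^ (1 + s) ≤ (1 + (1 + s) * c k * g x) + D * c k ^ 2 * g x ^ 2 := by
    intro x
    have h1 : |c k * g x| ≤ u := (abs_mul_le_of_abs_le_one (hc k)).trans (hgu x)
    refine (one_add_rpow_le hs0.le hs1 (h1.trans hu8)).trans ?_
    have h2 : 25 * |c k * g x| ^ 3 ≤ (1 + s) * s / 2 * ε * (c k * g x) ^ 2 := by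
      calc 25 * |c k * g x| ^ 3 = 25 * |c k * g x| * |c k * g x| ^ 2 := by ring
        _ ≤ 25 * u * |c k * g x| ^ 2 := by gcongr
        _ = 25 * u * (c k * g x) ^ 2 := by rw [sq_abs]
        _ ≤ _ := mul_le_mul_of_nonneg_right hε (sq_nonneg _)
    have h3 : D * c k ^ 2 * g x ^ 2 = (1 + s) * s / 2 * (c k * g x) ^ 2 +
        (1 + s) * s / 2 * ε * (c k * g x) ^ 2 := by simp only [D]; ring
    rw [h3]
    linarith
  have hx : Nonempty E := by
    by_contra hE
    rw [not_nonempty_iff] at hE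
    have := measure_univ (μ := μ)
    rw [Measure.eq_zero_of_isEmpty μ] at this
    simp at this
  have hD : 0 ≤ D := by
    have h1 := hu0 hx.some
    have : 0 ≤ (1 + s) * s / 2 := by positivity
    simp only [D]
    nlinarith
  have i1 : Integrable (fun x => 1 + (1 + s) * c k * g x) μ :=
    (integrable_const _).add (hgi.const_mul _)
  calc ∫ x, (1 + c k * g x) ^ (1 + s) ∂μ
      ≤ ∫ x, ((1 + (1 + s) * c k * g x) + D * c k ^ 2 * g x ^ 2) ∂μ :=
        integral_mono (hi k) (i1.add (hgg.const_mul _)) hpt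
    _ = 1 + D * c k ^ 2 * ∫ x, g x ^ 2 ∂μ := by
        rw [integral_add i1 (hgg.const_mul _), integral_one_add_mul hgi, integral_const_mul, h0]
        ring
    _ ≤ c k ^ 2 * (D * q) + 1 := by
        have := mul_le_mul_of_nonneg_left hq (mul_nonneg hD (sq_nonneg (c k)))
        linarith
    _ ≤ _ := Real.add_one_le_exp _

/-- Testing a product measure against a finite family of product perturbations. -/
theorem exists_integral_pi_withDensity_le {κ : Type*} [Fintype κ] [Nonempty κ] [DecidableEq κ]
    {G : κ → E → ℝ} (hc : ∀ k, |c k| ≤ 1) (hG : ∀ i, Measurable (G i)) {u s ε q q' K T : ℝ}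
    (hu8 : u ≤ 1 / 8) (hGu : ∀ i x, |G i x| ≤ u) (h0 : ∀ i, ∫ x, G i x ∂μ = 0) (hs0 : 0 < s)
    (hs1 : s ≤ 1) (hε : 25 * u ≤ (1 + s) * s / 2 * ε) (hq : ∀ i, ∫ x, G i x ^ 2 ∂μ ≤ q)
    (hq'0 : 0 ≤ q') (hq' : ∀ i j, i ≠ j → ∫ x, G i x * G j x ∂μ ≤ q') (hK : 0 < K)
    (hT : ∑ k, c k ^ 2 = T)
    {ψ : (ι → E) → ℝ} (hψ : Measurable ψ) (hψ01 : ∀ x, ψ x ∈ Set.Icc (0 : ℝ) 1) :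
    ∃ i, ∫ x, ψ x ∂(Measure.pi fun k => μ.withDensity fun x => ENNReal.ofReal (1 + c k * G i x)) ≤
      ∫ x, ψ x ∂(Measure.pi fun _ => μ) +
      Real.exp (T * ((1 + s) * s / 2 * (1 + ε) * q)) * K ^ (-s) +
      √(K / Fintype.card κ + (Real.exp (T * q') - 1) +
        2 * (Real.exp (T * ((1 + s) * s / 2 * (1 + ε) * q)) * K ^ (-s))) := by
  subst hT
  have hG1 : ∀ i x, |G i x| ≤ 1 := fun i x => (hGu i x).trans (by linarith)
  have hnn := fun i => one_add_mul_nonneg hc (hG1 i)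
  have hGi := fun i => integrable_of_abs_le (μ := μ) (hG i) (hGu i)
  have hGi' : ∀ i k, Integrable (fun x => 1 + c k * G i x) μ := fun i k =>
    (integrable_const _).add ((hGi i).const_mul _)
  have hΛm : ∀ i, Measurable fun x : ι → E => ∏ k, (1 + c k * G i (x k)) := fun i =>
    Finset.measurable_prod _ fun k _ => measurable_const.add
      (((hG i).comp (measurable_pi_apply k)).const_mul _)
  have hΛ0 : ∀ i (x : ι → E), 0 ≤ ∏ k, (1 + c k * G i (x k)) := fun i x =>
    Finset.prod_nonneg fun k _ => hnn i k _
  obtain ⟨i, hi⟩ := exists_integral_mul_likelihood_le (Measure.pi fun _ : ι => μ)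
    (Λ := fun i x => ∏ k, (1 + c k * G i (x k))) (ε := Real.exp ((∑ k, c k ^ 2) * q') - 1)
    (M := Real.exp ((∑ k, c k ^ 2) * ((1 + s) * s / 2 * (1 + ε) * q))) hΛm hΛ0
    (fun i => Integrable.fintype_prod (hGi' i)) (fun i => integral_prod_one_add (hGi i) (h0 i))
    (by
      rw [sub_nonneg, Real.one_le_exp_iff]
      exact mul_nonneg (Finset.sum_nonneg fun _ _ => sq_nonneg _) hq'0) hs0 hK
    (fun i j hij => by
      rw [add_sub_cancel]
      exact integral_prod_mul_prod_le hc (hG i) (hG j) (hG1 i) (hG1 j) (h0 i) (h0 j) (hq' i j hij))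
    (fun i => integral_prod_rpow_le hc (hG i) hu8 (hGu i) (h0 i) hs0 hs1 hε (hq i)) hψ hψ01
  refine ⟨i, le_trans (le_of_eq ?_) hi⟩
  rw [pi_withDensity_ofReal μ (g := fun k x => 1 + c k * G i x) (hnn i) (hGi' i),
    integral_withDensity_eq_integral_toReal_smul (hΛm i).ennreal_ofReal
      (Eventually.of_forall fun _ => ENNReal.ofReal_lt_top)]
  refine integral_congr_ae (Eventually.of_forall fun x => ?_)
  simp only [ENNReal.toReal_ofReal (hΛ0 i x), smul_eq_mul]
  ring

end Product

/-! ### Densities on the cube and the family of local alternatives -/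

theorem isCompact_unitCube : IsCompact (unitCube d) := by
  have h : unitCube d = (WithLp.toLp 2) '' (Set.univ.pi fun _ : Fin d => Set.Icc (0 : ℝ) 1) := by
    ext x
    constructor
    · intro hx
      exact ⟨WithLp.ofLp x, fun i _ => hx i, rfl⟩
    · rintro ⟨y, hy, rfl⟩ i
      exact hy i trivial
  rw [h]
  exact (isCompact_univ_pi fun _ => isCompact_Icc).image (PiLp.continuous_toLp 2 _)

theorem measurableSet_unitCube : MeasurableSet (unitCube d) :=
  isCompact_unitCube.isClosed.measurableSet

theorem densityLaw_congr {f g : Euc d → ℝ} (h : Set.EqOn f g (unitCube d)) :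
    densityLaw f = densityLaw g := by
  refine withDensity_congr_ae ?_
  filter_upwards [ae_restrict_mem measurableSet_unitCube] with x hx
  rw [h hx]

theorem integral_densityLaw {h : Euc d → ℝ} (hm : Measurable h) (h0 : ∀ x, 0 ≤ h x)
    (F : Euc d → ℝ) : ∫ x, F x ∂(densityLaw h) = ∫ x in unitCube d, h x * F x := by
  rw [densityLaw, integral_withDensity_eq_integral_toReal_smul hm.ennreal_ofReal
      (Eventually.of_forall fun _ => ENNReal.ofReal_lt_top)]
  refine integral_congr_ae (Eventually.of_forall fun x => ?_)
  simp only [ENNReal.toReal_ofReal (h0 x), smul_eq_mul]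

theorem densityLaw_mul {h v : Euc d → ℝ} (hm : Measurable h) (hv : Measurable v)
    (hv0 : ∀ x, 0 ≤ v x) : densityLaw (fun x => h x * v x) =
      (densityLaw h).withDensity fun x => ENNReal.ofReal (v x) := by
  unfold densityLaw
  rw [← withDensity_mul _ hm.ennreal_ofReal hv.ennreal_ofReal]
  congr 1
  funext x
  rw [Pi.mul_apply, ENNReal.ofReal_mul' (hv0 x)]

theorem IsDensity.isProbabilityMeasure {h : Euc d → ℝ} (hd : IsDensity h) :
    IsProbabilityMeasure (densityLaw h) := by
  constructor
  rw [densityLaw, withDensity_apply _ MeasurableSet.univ, Measure.restrict_univ,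
    ← ofReal_integral_eq_lintegral_ofReal hd.2.1, hd.2.2, ENNReal.ofReal_one]
  filter_upwards [ae_restrict_mem measurableSet_unitCube] with x hx using hd.1 x hx

/-- The weights are the coefficients of the perturbation in the two samples; their sum of squares is
the effective sample size in the rate. -/
theorem sum_weights_sq {m n : ℕ} (hm : m ≤ n) (hn : 0 < n) :
    ∑ k : Fin n, (if (k : ℕ) < m then 1 - (m : ℝ) / n else -((m : ℝ) / n)) ^ 2 =
      (m : ℝ) * ((n : ℝ) - m) / n := by
  have h1 := Fin.sum_univ_eq_sum_range
    (fun k : ℕ => (if k < m then 1 - (m : ℝ) / n else -((m : ℝ) / n)) ^ 2) n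
  rw [h1]
  obtain ⟨l, rfl⟩ := Nat.exists_eq_add_of_le hm
  rw [Finset.sum_range_add]
  rw [Finset.sum_congr rfl (g := fun _ => (1 - (m : ℝ) / (m + l : ℕ)) ^ 2) fun k hk => by
    rw [if_pos (Finset.mem_range.1 hk)]]
  rw [Finset.sum_congr rfl (s₁ := Finset.range l) (g := fun _ => (-((m : ℝ) / (m + l : ℕ))) ^ 2)
    fun k _ => by rw [if_neg (by omega)]]
  simp only [Finset.sum_const, Finset.card_range, nsmul_eq_mul]
  have : ((m + l : ℕ) : ℝ) ≠ 0 := by exact_mod_cast hn.ne'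
  field_simp
  push_cast
  ring

/-- The power of a test over a finite family of local alternatives. -/
theorem minimalPower_le_of_bumps {ι : Type*} [Fintype ι] [Nonempty ι] [DecidableEq ι] {m n : ℕ}
    (hm : m ≤ n) (hn : 0 < n) {h : Euc d → ℝ} (hd : IsDensity h) (hmeas : Measurable h)
    {κ H : ℝ} (hκ : 0 < κ) (hκh : ∀ x, κ ≤ h x) (hhH : ∀ x, h x ≤ H) {β L : ℝ}
    {J : Set (Euc d)} {B : ι → Euc d → ℝ}
    (hB : ∀ i, B i ∈ holderClass β L Set.univ) {S I₁ I₂ A r : ℝ} (hBS : ∀ i x, |B i x| ≤ S)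
    (hdisj : ∀ i j, i ≠ j → ∀ x, B i x * B j x = 0)
    (hI₁ : ∀ i, Integrable (B i) ∧ ∫ x, |B i x| ≤ I₁)
    (hI₂ : ∀ i, Integrable (fun x => B i x ^ 2) ∧ ∫ x, B i x ^ 2 ≤ I₂)
    (hA : ∀ i, ∃ t ∈ J, A ≤ B i t) (hr : r ≤ A - H * I₁) {u s ε q q' K T : ℝ}
    (hu : (S + H * I₁) / √κ ≤ u) (hu8 : u ≤ 1 / 8) (hs0 : 0 < s) (hs1 : s ≤ 1)
    (hε : 25 * u ≤ (1 + s) * s / 2 * ε) (hq : 2 * (H * I₁) * I₁ + (H * I₁) ^ 2 / κ ≤ q)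
    (hq' : I₂ + (2 * (H * I₁) * I₁ + (H * I₁) ^ 2 / κ) ≤ q') (hK : 0 < K)
    (hT : (m : ℝ) * ((n : ℝ) - m) / n = T) {ψ : (Fin n → Euc d) → ℝ} (hψ : IsTest ψ) :
    minimalPower m n h β L J r ψ ≤ ((∫ x, ψ x ∂(sampleLaw m n h h) +
      Real.exp (T * ((1 + s) * s / 2 * (1 + ε) * q')) * K ^ (-s) +
      √(K / Fintype.card ι + (Real.exp (T * q) - 1) +
        2 * (Real.exp (T * ((1 + s) * s / 2 * (1 + ε) * q')) * K ^ (-s))) : ℝ) : EReal) := by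
  have h0 : ∀ x, 0 < h x := fun x => hκ.trans_le (hκh x)
  have hH : 0 < H := (h0 0).trans_le (hhH 0)
  have hI₁0 : 0 ≤ I₁ := (integral_nonneg fun _ => abs_nonneg _).trans (hI₁ (Classical.arbitrary ι)).2
  set a := H * I₁
  have ha0 : 0 ≤ a := by positivity
  have hfin : volume (unitCube d) ≠ ⊤ := isCompact_unitCube.measure_lt_top.ne
  set V := volume.real (unitCube d)
  have hV : V ≤ 1 / κ := by
    rw [le_div_iff₀ hκ]
    have := setIntegral_mono (μ := volume) (s := unitCube d) (integrableOn_const hfin) hd.2.1 hκh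
    rw [hd.2.2, setIntegral_const, smul_eq_mul] at this
    exact this
  have hV0 : 0 ≤ V := measureReal_nonneg
  have hBc : ∀ i, Continuous (B i) := fun i => (mem_holderClass_univ_iff.1 (hB i)).1.continuous
  have hBabs : ∀ i, IntegrableOn (fun x => |B i x|) (unitCube d) := fun i => (hI₁ i).1.abs.integrableOn
  have hBabs' : ∀ i, ∫ x in unitCube d, |B i x| ≤ I₁ := fun i =>
    (setIntegral_le_integral (hI₁ i).1.abs (Eventually.of_forall fun _ => abs_nonneg _)).trans (hI₁ i).2
  have hbd : ∀ {F : Euc d → ℝ} (C : ℝ), Measurable F → (∀ x, |F x| ≤ C) →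
      IntegrableOn F (unitCube d) := fun C hF hC =>
    Integrable.mono' (integrableOn_const (C := C) hfin) hF.aestronglyMeasurable
      (Eventually.of_forall hC)
  have hsq : ∀ x, √(h x) * √(h x) = h x := fun x => Real.mul_self_sqrt (h0 x).le
  have hsq0 : ∀ x, 0 < √(h x) := fun x => Real.sqrt_pos.2 (h0 x)
  have hsqH : ∀ x, √(h x) ≤ √H := fun x => Real.sqrt_le_sqrt (hhH x)
  have hsqκ : ∀ x, √κ ≤ √(h x) := fun x => Real.sqrt_le_sqrt (hκh x)
  have hκ' : 0 < √κ := Real.sqrt_pos.2 hκ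
  have hH' : 0 < √H := Real.sqrt_pos.2 hH
  have hsqm : Measurable fun x => √(h x) := hmeas.sqrt
  have hsqi : IntegrableOn (fun x => √(h x)) (unitCube d) := hbd √H hsqm fun x => by
    rw [abs_of_pos (hsq0 x)]; exact hsqH x
  have hD : 1 / √H ≤ ∫ x in unitCube d, √(h x) := by
    rw [← hd.2.2, ← integral_div]
    refine setIntegral_mono (hd.2.1.div_const _) hsqi fun x => ?_
    simp only
    rw [div_le_iff₀ hH']
    calc h x = √(h x) * √(h x) := (hsq x).symm
      _ ≤ _ := mul_le_mul_of_nonneg_left (hsqH x) (hsq0 x).le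
  set D := ∫ x in unitCube d, √(h x)
  have hD0 : 0 < D := lt_of_lt_of_le (by positivity) hD
  -- This constant makes B i - ai i orthogonal to √h on the cube, which is what gives the perturbed
  -- densities total mass one.
  set ai : ι → ℝ := fun i => (∫ x in unitCube d, √(h x) * B i x) / D
  have hBsi : ∀ i, IntegrableOn (fun x => √(h x) * B i x) (unitCube d) := fun i =>
    hbd (√H * S) (hsqm.mul (hBc i).measurable) fun x => by
      rw [abs_mul, abs_of_pos (hsq0 x)]
      exact mul_le_mul (hsqH x) (hBS i x) (abs_nonneg _) hH'.le
  have hai : ∀ i, |ai i| ≤ a := by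
    intro i
    have h1 : |∫ x in unitCube d, √(h x) * B i x| ≤ √H * I₁ := by
      refine (abs_integral_le_integral_abs).trans ?_
      calc ∫ x in unitCube d, |√(h x) * B i x| ≤ ∫ x in unitCube d, √H * |B i x| := by
            refine setIntegral_mono (hBsi i).abs ((hBabs i).const_mul _) fun x => ?_
            simp only
            rw [abs_mul, abs_of_pos (hsq0 x)]
            exact mul_le_mul_of_nonneg_right (hsqH x) (abs_nonneg _)
        _ ≤ _ := by
            rw [integral_const_mul]
            exact mul_le_mul_of_nonneg_left (hBabs' i) hH'.le
    simp only [ai]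
    rw [abs_div, abs_of_pos hD0, div_le_iff₀ hD0]
    calc _ ≤ √H * I₁ := h1
      _ = a * (1 / √H) := by
        simp only [a]
        rw [mul_one_div, eq_div_iff hH'.ne']
        rw [mul_right_comm, Real.mul_self_sqrt hH.le]
      _ ≤ a * D := mul_le_mul_of_nonneg_left hD ha0
  set φ : ι → Euc d → ℝ := fun i x => B i x - ai i
  have hφc : ∀ i, Continuous (φ i) := fun i => (hBc i).sub continuous_const
  have hφb : ∀ i x, |φ i x| ≤ S + a := fun i x =>
    (abs_sub _ _).trans (add_le_add (hBS i x) (hai i))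
  have hφH : ∀ i, φ i ∈ holderClass β L (unitCube d) := fun i => by
    have := holderClass_add (hB i) (const_mem_holderClass β (-ai i))
    rw [add_zero] at this
    exact holderClass_unitCube_of_univ this
  have hφ0 : ∀ i, ∫ x in unitCube d, √(h x) * φ i x = 0 := by
    intro i
    have e : ∀ x, √(h x) * φ i x = √(h x) * B i x - √(h x) * ai i := fun x => by
      simp only [φ]; ring
    simp_rw [e]
    rw [integral_sub (hBsi i) (hsqi.mul_const _), integral_mul_const]
    change _ - D * ai i = 0
    simp only [ai]
    rw [mul_div_cancel₀ _ hD0.ne', sub_self]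
  -- Division by √h cancels the weight h in the inner products of `hGG`, so they no longer depend on
  -- h.
  set G : ι → Euc d → ℝ := fun i x => φ i x / √(h x)
  have hGm : ∀ i, Measurable (G i) := fun i => (hφc i).measurable.div hsqm
  have hGu : ∀ i x, |G i x| ≤ u := fun i x => by
    refine le_trans ?_ hu
    simp only [G]
    rw [abs_div, abs_of_pos (hsq0 x)]
    exact div_le_div₀ ((abs_nonneg _).trans (hφb i x)) (hφb i x) hκ' (hsqκ x)
  have hG1 : ∀ i x, |G i x| ≤ 1 := fun i x => (hGu i x).trans (by linarith)
  have hhG : ∀ i x, h x * G i x = √(h x) * φ i x := fun i x => by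
    simp only [G]
    rw [← mul_div_assoc, div_eq_iff (hsq0 x).ne']
    rw [mul_right_comm, hsq]
  have hGG : ∀ i j, ∫ x, G i x * G j x ∂(densityLaw h) = ∫ x in unitCube d, φ i x * φ j x := by
    intro i j
    rw [integral_densityLaw hmeas fun x => (h0 x).le]
    refine integral_congr_ae (Eventually.of_forall fun x => ?_)
    simp only [G]
    rw [div_mul_div_comm, hsq, mul_div_cancel₀ _ (h0 x).ne']
  -- Centring changes inner products only by terms containing a factor a; the volume of the cube is
  -- bounded by 1/κ because a density above κ integrates to one.
  have hquad : ∀ i j, ∫ x in unitCube d, φ i x * φ j x ≤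
      (∫ x in unitCube d, B i x * B j x) + (2 * a * I₁ + a ^ 2 / κ) := by
    intro i j
    have hBB : IntegrableOn (fun x => B i x * B j x) (unitCube d) :=
      hbd (S * S) ((hBc i).measurable.mul (hBc j).measurable) fun x => by
        rw [abs_mul]
        exact mul_le_mul (hBS i x) (hBS j x) (abs_nonneg _) ((abs_nonneg _).trans (hBS i x))
    have i1 : IntegrableOn (fun x => a * |B j x| + a * |B i x|) (unitCube d) :=
      ((hBabs j).const_mul _).add ((hBabs i).const_mul _)
    have i2 : IntegrableOn (fun x => a * |B j x| + a * |B i x| + a ^ 2) (unitCube d) :=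
      i1.add (integrableOn_const hfin)
    calc _ ≤ ∫ x in unitCube d, (B i x * B j x + (a * |B j x| + a * |B i x| + a ^ 2)) := by
          refine setIntegral_mono (hbd ((S + a) * (S + a))
            ((hφc i).measurable.mul (hφc j).measurable) fun x => ?_) (hBB.add i2) fun x => ?_
          · rw [abs_mul]
            exact mul_le_mul (hφb i x) (hφb j x) (abs_nonneg _) ((abs_nonneg _).trans (hφb i x))
          · have h1 : -(ai i * B j x) ≤ a * |B j x| := by
              refine (neg_le_abs _).trans ?_
              rw [abs_mul]
              exact mul_le_mul_of_nonneg_right (hai i) (abs_nonneg _)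
            have h2 : -(ai j * B i x) ≤ a * |B i x| := by
              refine (neg_le_abs _).trans ?_
              rw [abs_mul]
              exact mul_le_mul_of_nonneg_right (hai j) (abs_nonneg _)
            have h3 : ai i * ai j ≤ a ^ 2 := by
              refine (le_abs_self _).trans ?_
              rw [abs_mul, sq]
              exact mul_le_mul (hai i) (hai j) (abs_nonneg _) ha0
            have e : φ i x * φ j x = B i x * B j x + (-(ai i * B j x)) + (-(ai j * B i x)) +
                ai i * ai j := by simp only [φ]; ring
            simp only
            rw [e]
            linarith
      _ = (∫ x in unitCube d, B i x * B j x) + (a * ∫ x in unitCube d, |B j x|) +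
          (a * ∫ x in unitCube d, |B i x|) + V * a ^ 2 := by
          rw [integral_add hBB i2, integral_add i1 (integrableOn_const hfin),
            integral_add ((hBabs j).const_mul _) ((hBabs i).const_mul _), integral_const_mul,
            integral_const_mul, setIntegral_const, smul_eq_mul]
          ring
      _ ≤ _ := by
          have h1 := mul_le_mul_of_nonneg_left (hBabs' i) ha0
          have h2 := mul_le_mul_of_nonneg_left (hBabs' j) ha0
          have h3 := mul_le_mul_of_nonneg_right hV (sq_nonneg a)
          rw [one_div_mul_eq_div] at h3
          linarith
  have hμ : IsProbabilityMeasure (densityLaw h) := hd.isProbabilityMeasure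
  set c : Fin n → ℝ := fun k => if (k : ℕ) < m then 1 - (m : ℝ) / n else -((m : ℝ) / n) with hcdef
  have hn' : (0 : ℝ) < n := by exact_mod_cast hn
  have hl0 : 0 ≤ (m : ℝ) / n := by positivity
  have hl1 : (m : ℝ) / n ≤ 1 := by
    rw [div_le_one hn']; exact_mod_cast hm
  have hc : ∀ k, |c k| ≤ 1 := fun k => by
    simp only [c]
    rw [abs_le]
    split_ifs <;> constructor <;> linarith
  have hqpos : 0 ≤ q := le_trans (by positivity) hq
  -- The names cross over. Here q bounds only the centring error, which is all that remains for two
  -- disjoint bumps, while q' also includes the square of one bump.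
  obtain ⟨i, hi⟩ := exists_integral_pi_withDensity_le (μ := densityLaw h) (G := G) (q := q')
    (q' := q) hc hGm hu8 hGu
    (fun i => by
      rw [integral_densityLaw hmeas fun x => (h0 x).le]
      simp_rw [hhG]
      exact hφ0 i) hs0 hs1 hε
    (fun i => by
      simp_rw [sq (G i _)]
      rw [hGG]
      refine (hquad i i).trans (le_trans (add_le_add ?_ le_rfl) hq')
      simp_rw [← sq]
      exact (setIntegral_le_integral (hI₂ i).1 (Eventually.of_forall fun _ => sq_nonneg _)).trans
        (hI₂ i).2) hqpos
    (fun i j hij => by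
      rw [hGG]
      refine (hquad i j).trans ?_
      simp_rw [hdisj i j hij]
      simpa using hq) hK ((sum_weights_sq hm hn).trans hT) hψ.1 hψ.2
  -- Both densities of the alternative come from this family: b = 1 - m/n for the first sample and b
  -- = -m/n for the second.
  set w : ℝ → Euc d → ℝ := fun b x => h x * (1 + b * G i x)
  have hw0 : ∀ b : ℝ, |b| ≤ 1 → ∀ x, 0 ≤ 1 + b * G i x := fun b hb x => by
    have := (abs_le.1 ((abs_mul_le_of_abs_le_one (t := G i x) hb).trans (hG1 i x))).1
    linarith
  have hwd : ∀ b : ℝ, |b| ≤ 1 → IsDensity (w b) := by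
    intro b hb
    have e : ∀ x, w b x = h x + b * (√(h x) * φ i x) := fun x => by
      rw [← hhG]; simp only [w]; ring
    have hi' : IntegrableOn (fun x => √(h x) * φ i x) (unitCube d) :=
      hbd (√H * (S + a)) (hsqm.mul (hφc i).measurable) fun x => by
        rw [abs_mul, abs_of_pos (hsq0 x)]
        exact mul_le_mul (hsqH x) (hφb i x) (abs_nonneg _) hH'.le
    refine ⟨fun x _ => mul_nonneg (h0 x).le (hw0 b hb x), ?_, ?_⟩
    · rw [funext e]
      exact hd.2.1.add (hi'.const_mul _)
    · simp_rw [e]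
      rw [integral_add hd.2.1 (hi'.const_mul _), integral_const_mul, hφ0, hd.2.2, mul_zero, add_zero]
  have hb1 : |1 - (m : ℝ) / n| ≤ 1 := by rw [abs_le]; constructor <;> linarith
  have hb2 : |-((m : ℝ) / n)| ≤ 1 := by rw [abs_le]; constructor <;> linarith
  have hmix : mixedDensity m n (w (1 - (m : ℝ) / n)) (w (-((m : ℝ) / n))) = h := by
    funext x
    simp only [mixedDensity, w]
    ring
  have hphi : phi m n (w (1 - (m : ℝ) / n)) (w (-((m : ℝ) / n))) = φ i := by
    funext x
    have e : w (1 - (m : ℝ) / n) x - w (-((m : ℝ) / n)) x = √(h x) * φ i x := by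
      rw [← hhG]; simp only [w]; ring
    rw [phi, hmix, e, mul_div_cancel_left₀ _ (hsq0 x).ne']
  have hlaw : sampleLaw m n (w (1 - (m : ℝ) / n)) (w (-((m : ℝ) / n))) =
      Measure.pi fun k => (densityLaw h).withDensity fun x => ENNReal.ofReal (1 + c k * G i x) := by
    unfold sampleLaw
    congr 1
    funext k
    have hk : (if (k : ℕ) < m then densityLaw (w (1 - (m : ℝ) / n))
        else densityLaw (w (-((m : ℝ) / n)))) = densityLaw (w (c k)) := by
      simp only [c]; split_ifs <;> rfl
    rw [hk]
    exact densityLaw_mul hmeas (measurable_const.add ((hGm i).const_mul _)) (hw0 _ (hc k))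
  have hlaw0 : sampleLaw m n h h = Measure.pi fun _ => densityLaw h := by
    unfold sampleLaw; simp
  rw [← hlaw] at hi
  rw [hlaw0]
  refine (iInf₂_le (w (1 - (m : ℝ) / n), w (-((m : ℝ) / n))) ⟨⟨hwd _ hb1, hwd _ hb2, ?_, ?_⟩, ?_⟩).trans
    (EReal.coe_le_coe_iff.2 hi)
  · simp only
    rw [hphi]
    exact hφH i
  · simp only
    rw [hmix]
    exact fun _ _ => rfl
  · simp only
    rw [hphi]
    obtain ⟨t, ht, hAt⟩ := hA i
    refine le_trans ?_ (le_ciSup (f := fun x : J => |φ i x|) ⟨S + a, ?_⟩ ⟨t, ht⟩)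
    · refine le_trans ?_ (le_abs_self _)
      have := (abs_le.1 (hai i)).2
      simp only [φ]
      linarith
    · rintro _ ⟨x, rfl⟩
      exact hφb i x

/-! ### Uniform bounds, grids and rescaled profiles -/

/-- A large value at x would by equicontinuity persist on a set of fixed positive volume and force
the mass above one. Compactness makes the bound uniform. -/
theorem exists_uniform_bound {ι : Type*} {h : ι → Euc d → ℝ} (hd : ∀ n, IsDensity (h n))
    (he : EquicontinuousOn h (unitCube d)) : ∃ H : ℝ, ∀ n, ∀ x ∈ unitCube d, h n x ≤ H := by
  suffices hs : ∃ H : ℝ, ∀ x ∈ unitCube d, ∀ n, h n x ≤ H by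
    obtain ⟨H, hH⟩ := hs
    exact ⟨H, fun n x hx => hH x hx n⟩
  refine isCompact_unitCube.induction_on (p := fun s => ∃ H : ℝ, ∀ x ∈ s, ∀ n, h n x ≤ H)
    ⟨0, by simp⟩ (fun s t hst ⟨H, hH⟩ => ⟨H, fun x hx => hH x (hst hx)⟩)
    (fun s t ⟨H, hH⟩ ⟨H', hH'⟩ => ⟨max H H', fun x hx n => ?_⟩) fun x hx => ?_
  · rcases hx with hx | hx
    · exact (hH x hx n).trans (le_max_left _ _)
    · exact (hH' x hx n).trans (le_max_right _ _)
  · have h1 := he x hx {p : ℝ × ℝ | dist p.1 p.2 < 1} (Metric.dist_mem_uniformity one_pos)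
    refine ⟨_, h1, ?_⟩
    obtain ⟨O, hO, hxO, hOt⟩ := mem_nhdsWithin.1 h1
    -- The point x may lie on the boundary of the cube; intersecting with the interior gives an open
    -- set, near x though perhaps not containing it, of positive volume.
    set W := O ∩ interior (unitCube d)
    have hWo : IsOpen W := hO.inter isOpen_interior
    have hWne : W.Nonempty := by
      have : x ∈ closure (interior (unitCube d)) := by
        rw [convex_unitCube.closure_interior_eq_closure_of_nonempty_interior
          nonempty_interior_unitCube]
        exact subset_closure hx
      exact mem_closure_iff.1 this O hO hxO
    have hWc : W ⊆ unitCube d := Set.inter_subset_right.trans interior_subset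
    have hWfin : volume W ≠ ⊤ := (measure_mono hWc).trans_lt isCompact_unitCube.measure_lt_top |>.ne
    have hW0 : 0 < volume.real W := ENNReal.toReal_pos (hWo.measure_pos volume hWne).ne' hWfin
    refine ⟨1 / volume.real W + 2, fun y hy n => ?_⟩
    have h2 : (h n x - 1) * volume.real W ≤ 1 := by
      have h3 : ∫ z in W, (h n x - 1) ≤ ∫ z in W, h n z := by
        refine setIntegral_mono_on (integrableOn_const hWfin) ((hd n).2.1.mono_set hWc)
          hWo.measurableSet fun z hz => ?_
        have := hOt ⟨hz.1, hWc hz⟩ n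
        have := (abs_lt.1 (Real.dist_eq _ _ ▸ this : |h n x - h n z| < 1)).2
        linarith
      rw [setIntegral_const, smul_eq_mul, mul_comm] at h3
      refine h3.trans ?_
      rw [← (hd n).2.2]
      refine setIntegral_mono_set (hd n).2.1 ?_ hWc.eventuallyLE
      filter_upwards [ae_restrict_mem measurableSet_unitCube] with z hz using (hd n).1 z hz
    rw [← le_div_iff₀ hW0] at h2
    have h3 := hy n
    have := (abs_lt.1 (Real.dist_eq _ _ ▸ h3 : |h n x - h n y| < 1)).1
    linarith

theorem integral_comp_affine (F : Euc d → ℝ) {b : ℝ} (hb : 0 < b) (t : Euc d) :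
    ∫ x, F (b⁻¹ • (x - t)) = b ^ d * ∫ x, F x := by
  rw [integral_sub_right_eq_self (fun x => F (b⁻¹ • x)) t, Measure.integral_comp_smul,
    finrank_euclideanSpace_fin, smul_eq_mul, inv_pow, inv_inv, abs_of_pos (pow_pos hb d)]

theorem integrable_comp_affine {F : Euc d → ℝ} (hF : Integrable F) {b : ℝ} (hb : 0 < b)
    (t : Euc d) : Integrable fun x => F (b⁻¹ • (x - t)) :=
  (hF.comp_smul (inv_ne_zero hb.ne')).comp_sub_right t

/-- A nondegenerate rectangle contains a closed cube. -/
theorem IsNondegenerateRectangle.exists_cube {J : Set (Euc d)} (hJ : IsNondegenerateRectangle J) :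
    ∃ (a : Euc d) (ℓ : ℝ), 0 < ℓ ∧ ∀ x : Euc d, (∀ i, x i ∈ Set.Icc (a i) (a i + ℓ)) → x ∈ J := by
  obtain ⟨I, hI, rfl⟩ := hJ
  have h1 : ∀ i, ∃ y z : ℝ, y ∈ I i ∧ z ∈ I i ∧ y < z := fun i => by
    obtain ⟨y, hy, z, hz, hyz⟩ := (hI i).2
    rcases lt_or_gt_of_ne hyz with h | h
    · exact ⟨y, z, hy, hz, h⟩
    · exact ⟨z, y, hz, hy, h⟩
  choose y z hy hz hyz using h1
  obtain ⟨ℓ, hℓ0, hℓ⟩ : ∃ ℓ : ℝ, 0 < ℓ ∧ ∀ i, ℓ ≤ z i - y i := by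
    rcases isEmpty_or_nonempty (Fin d) with h | h
    · exact ⟨1, one_pos, fun i => (h.false i).elim⟩
    · obtain ⟨i₀, hi₀⟩ := Finite.exists_min fun i => z i - y i
      exact ⟨z i₀ - y i₀, sub_pos.2 (hyz i₀), hi₀⟩
  refine ⟨WithLp.toLp 2 y, ℓ, hℓ0, fun x hx i => (hI i).1.out (hy i) (hz i) ⟨(hx i).1, ?_⟩⟩
  exact (hx i).2.trans (by have := hℓ i; simp only; linarith)

/-- A grid of mesh ℓ/N: two distinct indices differ in some coordinate, and that coordinate alone
gives the separation. -/
theorem exists_separated_points {J : Set (Euc d)} {a : Euc d} {ℓ : ℝ} (hℓ : 0 < ℓ)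
    (hJ : ∀ x : Euc d, (∀ i, x i ∈ Set.Icc (a i) (a i + ℓ)) → x ∈ J) {N : ℕ} (hN : 0 < N) :
    ∃ t : (Fin d → Fin N) → Euc d, (∀ j, t j ∈ J) ∧ ∀ j j', j ≠ j' → ℓ / N ≤ ‖t j - t j'‖ := by
  have hN' : (0 : ℝ) < N := by exact_mod_cast hN
  refine ⟨fun j => WithLp.toLp 2 fun i => a i + ℓ / N * (j i : ℕ), fun j => hJ _ fun i => ?_,
    fun j j' hjj => ?_⟩
  · simp only
    have h1 : ((j i : ℕ) : ℝ) ≤ N := by exact_mod_cast (j i).2.le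
    refine ⟨le_add_of_nonneg_right (by positivity), ?_⟩
    have : ℓ / N * (j i : ℕ) ≤ ℓ / N * N := by gcongr
    rw [div_mul_cancel₀ _ hN'.ne'] at this
    linarith
  · obtain ⟨i, hi⟩ := Function.ne_iff.1 hjj
    refine le_trans ?_ (PiLp.norm_apply_le _ i)
    simp only [PiLp.sub_apply]
    rw [add_sub_add_left_eq_sub, ← mul_sub, Real.norm_eq_abs, abs_mul, abs_of_pos (by positivity)]
    refine le_mul_of_one_le_right (by positivity) ?_
    have h2 : ((j i : ℕ) : ℤ) - ((j' i : ℕ) : ℤ) ≠ 0 := by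
      rw [sub_ne_zero]
      exact fun h => hi (Fin.ext (by exact_mod_cast h))
    have := Int.one_le_abs h2
    exact_mod_cast this

/-- The power of a test over rescaled translates of a compactly supported profile `f`. -/
theorem minimalPower_le_of_profile {m n : ℕ} (hm : m ≤ n) (hn : 0 < n) {h : Euc d → ℝ}
    (hd : IsDensity h) (hcont : ContinuousOn h (unitCube d)) {κ H : ℝ} (hκ : 0 < κ)
    (hκh : ∀ x ∈ unitCube d, κ ≤ h x) (hhH : ∀ x ∈ unitCube d, h x ≤ H) (hκH : κ ≤ H)
    {β L : ℝ} {J : Set (Euc d)} {a : Euc d} {ℓ : ℝ} (hℓ : 0 < ℓ)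
    (hJ : ∀ x : Euc d, (∀ i, x i ∈ Set.Icc (a i) (a i + ℓ)) → x ∈ J)
    {f : Euc d → ℝ} {Lf S R : ℝ} (hf : f ∈ holderClass β Lf Set.univ) (hf0 : 1 ≤ f 0)
    (hfS : ∀ x, |f x| ≤ S) (hfR : ∀ x, R ≤ ‖x‖ → f x = 0) (hfc : HasCompactSupport f)
    {A b : ℝ} (hA : 0 < A) (hb : 0 < b) (hAb : A * Lf * b⁻¹ ^ β ≤ L) {N : ℕ} (hN : 0 < N)
    (hNb : 2 * R * b ≤ ℓ / N) {r u s ε q q' K T G I : ℝ} (hI : ∫ x, |f x| ≤ I)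
    (hr : r ≤ A - H * (A * b ^ d * I)) (hu : (A * S + H * (A * b ^ d * I)) / √κ ≤ u)
    (hu8 : u ≤ 1 / 8) (hs0 : 0 < s) (hs1 : s ≤ 1) (hε : 25 * u ≤ (1 + s) * s / 2 * ε)
    (hG : ∫ x, f x ^ 2 ≤ G)
    (hq : 2 * (H * (A * b ^ d * I)) * (A * b ^ d * I) + (H * (A * b ^ d * I)) ^ 2 / κ ≤ q)
    (hq' : A ^ 2 * b ^ d * G + (2 * (H * (A * b ^ d * I)) * (A * b ^ d * I) +
      (H * (A * b ^ d * I)) ^ 2 / κ) ≤ q')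
    (hK : 0 < K) (hT : (m : ℝ) * ((n : ℝ) - m) / n = T) {ψ : (Fin n → Euc d) → ℝ} (hψ : IsTest ψ) :
    minimalPower m n h β L J r ψ ≤ ((∫ x, ψ x ∂(sampleLaw m n h h) +
      Real.exp (T * ((1 + s) * s / 2 * (1 + ε) * q')) * K ^ (-s) +
      √(K / (N : ℝ) ^ d + (Real.exp (T * q) - 1) +
        2 * (Real.exp (T * ((1 + s) * s / 2 * (1 + ε) * q')) * K ^ (-s))) : ℝ) : EReal) := by
  classical
  -- Extending by κ off the cube makes measurability and the bounds global; neither the sample law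
  -- nor the class of pairs sees the change.
  set h' : Euc d → ℝ := (unitCube d).piecewise h fun _ => κ
  have hh' : Set.EqOn h' h (unitCube d) := fun x hx => Set.piecewise_eq_of_mem _ _ _ hx
  have hh'n : ∀ x, x ∉ unitCube d → h' x = κ := fun x hx => Set.piecewise_eq_of_notMem _ _ _ hx
  have hmeas : Measurable h' := hcont.measurable_piecewise continuousOn_const measurableSet_unitCube
  have hd' : IsDensity h' := by
    refine ⟨fun x hx => by rw [hh' hx]; exact hd.1 x hx,
      hd.2.1.congr_fun hh'.symm measurableSet_unitCube, ?_⟩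
    rw [setIntegral_congr_fun measurableSet_unitCube hh']
    exact hd.2.2
  have hmp : minimalPower m n h β L J r ψ = minimalPower m n h' β L J r ψ := by
    have : pairClass m n h β L = pairClass m n h' β L := by
      ext pq
      simp only [pairClass, Set.mem_ofPred_eq]
      exact and_congr_right fun _ => and_congr_right fun _ => and_congr_right fun _ =>
        ⟨fun e => e.trans hh'.symm, fun e => e.trans hh'⟩
    unfold minimalPower
    rw [this]
  have hsl : sampleLaw m n h h = sampleLaw m n h' h' := by
    unfold sampleLaw
    rw [densityLaw_congr hh']
  obtain ⟨t, htJ, htsep⟩ := exists_separated_points hℓ hJ hN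
  have : Nonempty (Fin N) := ⟨⟨0, hN⟩⟩
  have hfcont : Continuous f := (mem_holderClass_univ_iff.1 hf).1.continuous
  have hfi : Integrable f := hfcont.integrable_of_hasCompactSupport hfc
  have hfi2 : Integrable fun x => f x ^ 2 :=
    (hfcont.memLp_of_hasCompactSupport (p := 2) hfc).integrable_sq
  have hcard : (N : ℝ) ^ d = (Fintype.card (Fin d → Fin N) : ℝ) := by simp
  rw [hmp, hsl, hcard]
  refine minimalPower_le_of_bumps hm hn hd' hmeas hκ (H := H) ?_ ?_
    (B := fun j x => A * f (b⁻¹ • (x - t j))) (S := A * S) (I₁ := A * b ^ d * I)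
    (I₂ := A ^ 2 * b ^ d * G) (A := A) ?_ ?_ ?_ ?_ ?_ ?_ hr hu hu8 hs0 hs1 hε hq hq' hK hT hψ
  · intro x
    by_cases hx : x ∈ unitCube d
    · rw [hh' hx]; exact hκh x hx
    · rw [hh'n x hx]
  · intro x
    by_cases hx : x ∈ unitCube d
    · rw [hh' hx]; exact hhH x hx
    · rw [hh'n x hx]; exact hκH
  · intro j
    exact holderClass_mono hAb (holderClass_affine hf hA.le (inv_nonneg.2 hb.le) (t j))
  · intro j x
    rw [abs_mul, abs_of_pos hA]
    exact mul_le_mul_of_nonneg_left (hfS _) hA.le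
  · intro i j hij x
    by_contra hne
    have hlt : ∀ k, f (b⁻¹ • (x - t k)) ≠ 0 → ‖x - t k‖ < R * b := by
      intro k hk
      by_contra hcon
      push Not at hcon
      refine hk (hfR _ ?_)
      rw [norm_smul, Real.norm_of_nonneg (by positivity), inv_mul_eq_div, le_div_iff₀ hb]
      exact hcon
    have h1 := hlt i fun h0 => hne (by simp [h0])
    have h2 := hlt j fun h0 => hne (by simp [h0])
    have h3 := htsep i j hij
    have h4 : ‖t i - t j‖ ≤ ‖x - t j‖ + ‖x - t i‖ := by
      have := norm_sub_le (x - t j) (x - t i)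
      rwa [sub_sub_sub_cancel_left] at this
    linarith
  · intro j
    refine ⟨(integrable_comp_affine hfi hb (t j)).const_mul A, ?_⟩
    simp_rw [abs_mul, abs_of_pos hA]
    rw [integral_const_mul, integral_comp_affine (fun x => |f x|) hb, mul_assoc]
    gcongr
  · intro j
    simp_rw [mul_pow]
    refine ⟨(integrable_comp_affine hfi2 hb (t j)).const_mul _, ?_⟩
    rw [integral_const_mul, integral_comp_affine (fun x => f x ^ 2) hb, mul_assoc]
    gcongr
  · intro j
    refine ⟨t j, htJ j, ?_⟩
    simp only [sub_self, smul_zero]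
    exact le_mul_of_one_le_right hA.le hf0

/-! ### Asymptotics of the rate and of the error terms -/

section Asymptotics

variable {T : ℕ → ℝ} {l : ℝ}

theorem tendsto_log_mul_rpow_neg {p : ℝ} (hp : 0 < p) :
    Tendsto (fun n : ℕ => Real.log n * (n : ℝ) ^ (-p)) atTop (𝓝 0) := by
  have h := (isLittleO_log_rpow_atTop hp).tendsto_div_nhds_zero.comp tendsto_natCast_atTop_atTop
  refine h.congr fun n => ?_
  simp only [Function.comp]
  rw [Real.rpow_neg (Nat.cast_nonneg n), div_eq_mul_inv]

theorem tendsto_log_div_mul_rpow (hl : 0 < l) (hT : ∀ᶠ n : ℕ in atTop, l * n ≤ T n) {ω : ℝ}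
    (hω : ω < 1) : Tendsto (fun n : ℕ => Real.log n / T n * (n : ℝ) ^ ω) atTop (𝓝 0) := by
  have h := (tendsto_log_mul_rpow_neg (sub_pos.2 hω)).const_mul l⁻¹
  rw [mul_zero] at h
  refine squeeze_zero' ?_ ?_ h
  · filter_upwards [hT, eventually_ge_atTop 1] with n h1 h2
    have : (0 : ℝ) ≤ T n := le_trans (by positivity) h1
    have : 0 ≤ Real.log n := Real.log_natCast_nonneg n
    positivity
  · filter_upwards [hT, eventually_ge_atTop 1] with n h1 h2
    have hn : (0 : ℝ) < n := by exact_mod_cast h2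
    have h3 : Real.log n / T n ≤ Real.log n / (l * n) :=
      div_le_div_of_nonneg_left (Real.log_natCast_nonneg n) (by positivity) h1
    calc _ ≤ Real.log n / (l * n) * (n : ℝ) ^ ω := by gcongr
      _ = _ := by
        rw [neg_sub, Real.rpow_sub hn, Real.rpow_one]
        field_simp

theorem tendsto_log_div_rpow_mul_log (hl : 0 < l) (hT : ∀ᶠ n : ℕ in atTop, l * n ≤ T n) {p : ℝ}
    (hp : 0 < p) : Tendsto (fun n : ℕ => (Real.log n / T n) ^ p * Real.log n) atTop (𝓝 0) := by
  have h1 := (tendsto_log_div_mul_rpow hl hT (by norm_num : (1 / 2 : ℝ) < 1)).eventually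
    (eventually_le_nhds one_pos)
  refine squeeze_zero' ?_ ?_ (tendsto_log_mul_rpow_neg (half_pos hp))
  · filter_upwards [hT] with n h1
    have : (0 : ℝ) ≤ T n := le_trans (by positivity) h1
    have : 0 ≤ Real.log n := Real.log_natCast_nonneg n
    positivity
  · filter_upwards [h1, hT, eventually_ge_atTop 1] with n h1 h2 h3
    have hn : (0 : ℝ) < n := by exact_mod_cast h3
    have hT0 : (0 : ℝ) ≤ T n := le_trans (by positivity) h2
    have hlog : 0 ≤ Real.log n := Real.log_natCast_nonneg n
    have h4 : Real.log n / T n ≤ (n : ℝ) ^ (-(1 / 2 : ℝ)) := by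
      rw [Real.rpow_neg hn.le, ← one_div, le_div_iff₀ (Real.rpow_pos_of_pos hn _)]
      exact h1
    rw [mul_comm]
    refine mul_le_mul_of_nonneg_left ?_ hlog
    refine (Real.rpow_le_rpow (by positivity) h4 hp.le).trans (le_of_eq ?_)
    rw [← Real.rpow_mul hn.le]
    congr 1
    ring

theorem tendsto_log_div_rpow (hl : 0 < l) (hT : ∀ᶠ n : ℕ in atTop, l * n ≤ T n) {p : ℝ}
    (hp : 0 < p) : Tendsto (fun n : ℕ => (Real.log n / T n) ^ p) atTop (𝓝 0) := by
  have h := (tendsto_log_div_mul_rpow hl hT (zero_lt_one)).rpow_const (p := p) (Or.inr hp.le)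
  simpa [Real.zero_rpow hp.ne'] using h

end Asymptotics


/-- The asymptotic lower bound for rescaled translates of a compactly supported profile `f`. -/
theorem limsup_minimalPower_le_of_profile (hd0 : 0 < d) {β L α : ℝ} (hβ : 0 < β)
    {m : ℕ → ℕ} (hm : ∀ n, m n ≤ n) {l : ℝ} (hl : 0 < l)
    (hml : ∀ᶠ n : ℕ in atTop, l * n ≤ (m n : ℝ) * ((n : ℝ) - m n) / n)
    {h : ℕ → Euc d → ℝ} (hd : ∀ n, IsDensity (h n)) (he : EquicontinuousOn h (unitCube d))
    {κ : ℝ} (hκ : 0 < κ) (hκh : ∀ n, ∀ x ∈ unitCube d, κ ≤ h n x)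
    {J : Set (Euc d)} (hJ : IsNondegenerateRectangle J)
    {f : Euc d → ℝ} {Lf : ℝ} (hf : f ∈ holderClass β Lf Set.univ) (hf0 : 1 ≤ f 0)
    (hfc : HasCompactSupport f) {G : ℝ} (hG : ∫ x, f x ^ 2 ≤ G)
    {CA Cb τ : ℝ} (hCA : 0 < CA) (hCb : 0 < Cb) (hτ : τ < 1) (hL : CA * Lf * Cb⁻¹ ^ β ≤ L)
    (hΘ : CA ^ 2 * Cb ^ d * G / 2 < d / (2 * β + d))
    {ψ : (n : ℕ) → (Fin n → Euc d) → ℝ} (hψ : ∀ n, IsTest (ψ n))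
    (hα : ∀ n, ∫ x, ψ n x ∂(sampleLaw (m n) n (h n) (h n)) ≤ α) :
    limsup (fun n => minimalPower (m n) n (h n) β L J (τ * CA * rate d β (m n) n) (ψ n)) atTop
      ≤ (α : EReal) := by
  obtain ⟨H₀, hH₀⟩ := exists_uniform_bound hd he
  set H := max H₀ κ
  have hH : ∀ n, ∀ x ∈ unitCube d, h n x ≤ H := fun n x hx => (hH₀ n x hx).trans (le_max_left _ _)
  have hκH : κ ≤ H := le_max_right _ _
  obtain ⟨a, ℓ, hℓ, haℓ⟩ := hJ.exists_cube
  have hfcont : Continuous f := (mem_holderClass_univ_iff.1 hf).1.continuous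
  obtain ⟨S, hS⟩ := hfc.exists_bound_of_continuous hfcont
  obtain ⟨R, hR⟩ : ∃ R : ℝ, ∀ x, R ≤ ‖x‖ → f x = 0 := by
    obtain ⟨R, hR⟩ := hfc.isCompact.isBounded.subset_ball (0 : Euc d)
    refine ⟨R, fun x hx => ?_⟩
    by_contra hne
    have := hR (subset_tsupport f hne)
    rw [mem_ball_zero_iff] at this
    linarith
  set I := ∫ x, |f x|
  set E : ℝ := 2 * β + d with hE
  have hd0' : (0 : ℝ) < d := by exact_mod_cast hd0
  have hE0 : 0 < E := by positivity
  set T : ℕ → ℝ := fun n => (m n : ℝ) * ((n : ℝ) - m n) / n with hT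
  set x : ℕ → ℝ := fun n => Real.log n / T n with hx
  set Θ := CA ^ 2 * Cb ^ d with hΘdef
  have hΘ0 : 0 < Θ := by positivity
  -- Amplitude and bandwidth are balanced so that A b^(-β) stays fixed, as the Hölder bound
  -- requires, while T A² b^d equals Θ log n.
  set A : ℕ → ℝ := fun n => CA * x n ^ (β / E) with hA
  set b : ℕ → ℝ := fun n => Cb * x n ^ (1 / E) with hb
  have hrate : ∀ n, 0 < n → rate d β (m n) n = x n ^ (β / E) := by
    intro n hn
    have hn' : (n : ℝ) ≠ 0 := by exact_mod_cast hn.ne'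
    simp only [rate, x, T, hE]
    congr 1
    rw [div_div_eq_mul_div, mul_comm]
  -- the exponents
  obtain ⟨κ₁, hκ₁, hκ₁'⟩ := exists_between hΘ
  obtain ⟨κ₂, hκ₂, hκ₂'⟩ := exists_between hκ₁'
  -- With ε = s in the moment bound, the truncation error has exponent s((1+s)²ΘG/2 - κ₁), up to a
  -- bounded factor, and this is negative.
  obtain ⟨s, hs0, hs1, hs⟩ : ∃ s : ℝ, 0 < s ∧ s ≤ 1 ∧ (1 + s) * (1 + s) * (Θ * G / 2) < κ₁ := by
    have hlim : Tendsto (fun s : ℝ => (1 + s) * (1 + s) * (Θ * G / 2)) (𝓝[>] 0)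
        (𝓝 (Θ * G / 2)) := by
      have hc : Continuous fun s : ℝ => (1 + s) * (1 + s) * (Θ * G / 2) := by fun_prop
      have := (hc.tendsto 0).mono_left (nhdsWithin_le_nhds (s := Set.Ioi 0))
      simpa using this
    have h2 : ∀ᶠ r : ℝ in 𝓝[>] 0, r ≤ 1 := nhdsWithin_le_nhds (eventually_le_nhds one_pos)
    obtain ⟨s, h1, h2, h3⟩ := ((hlim.eventually (eventually_lt_nhds hκ₁)).and
      (h2.and self_mem_nhdsWithin)).exists
    exact ⟨s, h3, h2, h1⟩
  -- About n^κ₂ bumps and truncation at n^κ₁. Here κ₁ < κ₂ makes K/N^d vanish, and κ₂ < d/(2β+d)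
  -- lets the bumps of width b fit into J side by side.
  set N : ℕ → ℕ := fun n => ⌊(n : ℝ) ^ (κ₂ / d)⌋₊ with hN
  set K : ℕ → ℝ := fun n => (n : ℝ) ^ κ₁ with hK
  set u : ℕ → ℝ := fun n => (A n * S + H * (A n * b n ^ d * I)) / √κ with hu
  set q : ℕ → ℝ := fun n => 2 * (H * (A n * b n ^ d * I)) * (A n * b n ^ d * I) +
    (H * (A n * b n ^ d * I)) ^ 2 / κ with hq
  set q' : ℕ → ℝ := fun n => A n ^ 2 * b n ^ d * G + q n with hq'
  have hI0 : 0 ≤ I := integral_nonneg fun _ => abs_nonneg _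
  have hG0 : 0 ≤ G := (integral_nonneg fun _ => sq_nonneg _).trans hG
  have hκ₁0 : 0 < κ₁ := lt_of_le_of_lt (by positivity) hκ₁
  have hκ₂0 : 0 < κ₂ := hκ₁0.trans hκ₂
  -- eventual positivity
  have hpos : ∀ᶠ n : ℕ in atTop, 0 < n ∧ 0 < T n ∧ 0 < Real.log n := by
    filter_upwards [hml, eventually_ge_atTop 2] with n h1 h2
    have hn : (2 : ℝ) ≤ n := by exact_mod_cast h2
    exact ⟨by omega, lt_of_lt_of_le (by positivity) h1, Real.log_pos (by linarith)⟩
  have hbd : ∀ᶠ n : ℕ in atTop, b n ^ d = Cb ^ d * x n ^ (d / E) := by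
    filter_upwards [hpos] with n ⟨h1, h2, h3⟩
    simp only [b]
    rw [mul_pow, ← Real.rpow_natCast (x n ^ (1 / E)), ← Real.rpow_mul (by positivity),
      one_div_mul_eq_div]
  -- the limits
  have hAlim : Tendsto A atTop (𝓝 0) := by
    simpa using (tendsto_log_div_rpow hl hml (div_pos hβ hE0)).const_mul CA
  have hblim : Tendsto (fun n => b n ^ d) atTop (𝓝 0) := by
    refine Tendsto.congr' (EventuallyEq.symm hbd) ?_
    simpa using (tendsto_log_div_rpow hl hml (div_pos hd0' hE0)).const_mul (Cb ^ d)
  have hbloglim : Tendsto (fun n : ℕ => b n ^ d * Real.log n) atTop (𝓝 0) := by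
    have := (tendsto_log_div_rpow_mul_log hl hml (div_pos hd0' hE0)).const_mul (Cb ^ d)
    rw [mul_zero] at this
    refine Tendsto.congr' ?_ this
    filter_upwards [hbd] with n hn
    rw [hn, mul_assoc]
  have hbN : Tendsto (fun n : ℕ => b n * (n : ℝ) ^ (κ₂ / d)) atTop (𝓝 0) := by
    have hω : κ₂ * E / d < 1 := by
      rw [div_lt_one hd0']
      exact (lt_div_iff₀ hE0).1 hκ₂'
    have := ((tendsto_log_div_mul_rpow hl hml hω).rpow_const (p := 1 / E)
      (Or.inr (by positivity))).const_mul Cb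
    rw [Real.zero_rpow (by positivity), mul_zero] at this
    refine Tendsto.congr' ?_ this
    filter_upwards [hpos] with n ⟨h1, h2, h3⟩
    rw [Real.mul_rpow (by positivity) (by positivity), ← Real.rpow_mul (by positivity), ← mul_assoc]
    congr 2
    field_simp
  have hulim : Tendsto u atTop (𝓝 0) := by
    have h1 : Tendsto (fun n => (A n * S + H * (A n * b n ^ d * I)) / √κ) atTop
        (𝓝 ((0 * S + H * (0 * 0 * I)) / √κ)) :=
      ((hAlim.mul_const S).add (((hAlim.mul hblim).mul_const I).const_mul H)).div_const _
    simpa using h1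
  have hTA : ∀ᶠ n : ℕ in atTop, T n * (A n ^ 2 * b n ^ d) = Θ * Real.log n := by
    filter_upwards [hpos, hbd] with n ⟨h1, h2, h3⟩ h4
    rw [h4]
    simp only [A]
    have hx0 : 0 < x n := by positivity
    have h5 : (x n ^ (β / E)) ^ 2 * x n ^ (d / E) = x n := by
      rw [← Real.rpow_natCast, ← Real.rpow_mul hx0.le, ← Real.rpow_add hx0]
      have : β / E * (2 : ℕ) + d / E = 1 := by
        push_cast
        rw [hE]
        field_simp
      rw [this, Real.rpow_one]
    have h6 : T n * x n = Real.log n := by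
      simp only [x]; field_simp
    calc _ = Θ * (T n * ((x n ^ (β / E)) ^ 2 * x n ^ (d / E))) := by rw [hΘdef]; ring
      _ = _ := by rw [h5, h6]
  -- The centring error carries an additional factor b^d compared with the main term Θ log n, and
  -- b^d log n tends to zero.
  have hTq : Tendsto (fun n => T n * q n) atTop (𝓝 0) := by
    have h1 := hbloglim.const_mul (Θ * ((2 * H + H ^ 2 / κ) * I ^ 2))
    rw [mul_zero] at h1
    refine Tendsto.congr' ?_ h1
    filter_upwards [hTA] with n hn
    calc _ = (Θ * Real.log n) * b n ^ d * ((2 * H + H ^ 2 / κ) * I ^ 2) := by ring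
      _ = _ := by rw [← hn]; simp only [q]; ring
  have hNlim : Tendsto (fun n : ℕ => (n : ℝ) ^ (κ₂ / d)) atTop atTop :=
    (tendsto_rpow_atTop (div_pos hκ₂0 hd0')).comp tendsto_natCast_atTop_atTop
  have hE1 : Tendsto (fun n => Real.exp (T n * ((1 + s) * s / 2 * (1 + s) * q' n)) * K n ^ (-s))
      atTop (𝓝 0) := by
    set ν := s * (κ₁ - (1 + s) * (1 + s) * (Θ * G / 2)) with hν
    have hν0 : 0 < ν := mul_pos hs0 (sub_pos.2 hs)
    have h1 : Tendsto (fun n : ℕ => (n : ℝ) ^ (-ν) *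
        Real.exp ((1 + s) * s / 2 * (1 + s) * (T n * q n))) atTop (𝓝 (0 * Real.exp 0)) := by
      refine ((tendsto_rpow_neg_atTop hν0).comp tendsto_natCast_atTop_atTop).mul ?_
      refine (Real.continuous_exp.tendsto _).comp ?_
      simpa using hTq.const_mul ((1 + s) * s / 2 * (1 + s))
    rw [zero_mul] at h1
    refine Tendsto.congr' ?_ h1
    filter_upwards [hpos, hTA] with n ⟨hn, h2, h3⟩ h4
    have hn' : (0 : ℝ) < n := by exact_mod_cast hn
    simp only [K, q']
    rw [← Real.rpow_mul hn'.le, Real.rpow_def_of_pos hn', Real.rpow_def_of_pos hn', ← Real.exp_add,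
      ← Real.exp_add]
    congr 1
    calc _ = Real.log n * -ν + (1 + s) * s / 2 * (1 + s) * (T n * q n) := rfl
      _ = (1 + s) * s / 2 * (1 + s) * ((Θ * Real.log n) * G + T n * q n) +
          Real.log n * (κ₁ * -s) := by rw [hν]; ring
      _ = _ := by rw [← h4]; ring
  have hE2 : Tendsto (fun n => K n / (N n : ℝ) ^ d) atTop (𝓝 0) := by
    have h1 : Tendsto (fun n : ℕ => 2 ^ d * (n : ℝ) ^ (-(κ₂ - κ₁))) atTop (𝓝 (2 ^ d * 0)) :=
      ((tendsto_rpow_neg_atTop (sub_pos.2 hκ₂)).comp tendsto_natCast_atTop_atTop).const_mul _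
    rw [mul_zero] at h1
    refine squeeze_zero' (Eventually.of_forall fun n => by positivity) ?_ h1
    filter_upwards [hpos, hNlim.eventually (eventually_ge_atTop 2)] with n ⟨hn, _, _⟩ h2
    have hn' : (0 : ℝ) < n := by exact_mod_cast hn
    have hNge : (n : ℝ) ^ (κ₂ / d) / 2 ≤ N n := by
      have := (Nat.sub_one_lt_floor ((n : ℝ) ^ (κ₂ / d))).le
      change _ ≤ (N n : ℝ) at this
      linarith
    calc K n / (N n : ℝ) ^ d ≤ K n / ((n : ℝ) ^ (κ₂ / d) / 2) ^ d := by gcongr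
      _ = 2 ^ d * (n : ℝ) ^ (-(κ₂ - κ₁)) := by
        rw [div_pow, ← Real.rpow_natCast ((n : ℝ) ^ (κ₂ / d)), ← Real.rpow_mul hn'.le,
          div_mul_cancel₀ _ hd0'.ne', neg_sub, Real.rpow_sub hn']
        simp only [K]
        field_simp
  have hE3 : Tendsto (fun n => Real.exp (T n * q n) - 1) atTop (𝓝 0) := by
    have := ((Real.continuous_exp.tendsto 0).comp hTq).sub_const 1
    simpa using this
  have herr : Tendsto (fun n => α + Real.exp (T n * ((1 + s) * s / 2 * (1 + s) * q' n)) * K n ^ (-s) +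
      √(K n / (N n : ℝ) ^ d + (Real.exp (T n * q n) - 1) +
        2 * (Real.exp (T n * ((1 + s) * s / 2 * (1 + s) * q' n)) * K n ^ (-s)))) atTop (𝓝 α) := by
    have h1 := (Real.continuous_sqrt.tendsto _).comp ((hE2.add hE3).add (hE1.const_mul 2))
    have h2 := (hE1.const_add α).add h1
    simpa using h2
  have hle : ∀ᶠ n in atTop, minimalPower (m n) n (h n) β L J (τ * CA * rate d β (m n) n) (ψ n) ≤
      ((α + Real.exp (T n * ((1 + s) * s / 2 * (1 + s) * q' n)) * K n ^ (-s) +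
      √(K n / (N n : ℝ) ^ d + (Real.exp (T n * q n) - 1) +
        2 * (Real.exp (T n * ((1 + s) * s / 2 * (1 + s) * q' n)) * K n ^ (-s))) : ℝ) : EReal) := by
    have c1 := hulim.eventually (eventually_le_nhds (by norm_num : (0 : ℝ) < 1 / 8))
    have c2 := hulim.eventually (eventually_le_nhds
      (by positivity : (0 : ℝ) < (1 + s) * s / 2 * s / 25))
    -- Centring lowers the peak by at most the fraction H b^d I of the amplitude, eventually less
    -- than the slack 1 - τ.
    have c3 : ∀ᶠ n in atTop, H * (b n ^ d * I) ≤ 1 - τ := by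
      have : Tendsto (fun n => H * (b n ^ d * I)) atTop (𝓝 (H * (0 * I))) :=
        (hblim.mul_const I).const_mul H
      rw [zero_mul, mul_zero] at this
      exact this.eventually (eventually_le_nhds (sub_pos.2 hτ))
    have c4 : ∀ᶠ n in atTop, 2 * R * (b n * (n : ℝ) ^ (κ₂ / d)) ≤ ℓ := by
      have := hbN.const_mul (2 * R)
      rw [mul_zero] at this
      exact this.eventually (eventually_le_nhds hℓ)
    have c5 := hNlim.eventually (eventually_ge_atTop 1)
    filter_upwards [hpos, c1, c2, c3, c4, c5] with n ⟨hn, hTn, hlog⟩ h1 h2 h3 h4 h5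
    have hn' : (0 : ℝ) < n := by exact_mod_cast hn
    have hx0 : 0 < x n := by positivity
    have hA0 : 0 < A n := by positivity
    have hb0 : 0 < b n := by positivity
    have hN0 : 0 < N n := Nat.floor_pos.2 h5
    have hNn : (0 : ℝ) < N n := by exact_mod_cast hN0
    have hNle : (N n : ℝ) ≤ (n : ℝ) ^ (κ₂ / d) := Nat.floor_le (by positivity)
    refine (minimalPower_le_of_profile (ε := s) (hm n) hn (hd n) (he.continuousOn n) hκ (hκh n) (hH n) hκH
      hℓ haℓ hf hf0 hS hR hfc hA0 hb0 ?_ hN0 ?_ (le_refl I) ?_ (le_refl (u n)) h1 hs0 hs1 ?_ hG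
      (le_refl (q n)) (le_refl (q' n)) (by positivity : 0 < K n) (rfl : _ = T n) (hψ n)).trans ?_
    · refine le_trans (le_of_eq ?_) hL
      simp only [A, b]
      rw [mul_inv, Real.mul_rpow (by positivity) (by positivity), Real.inv_rpow (by positivity) β,
        Real.inv_rpow (by positivity) β, ← Real.rpow_mul hx0.le, one_div_mul_eq_div]
      field_simp
    · rw [le_div_iff₀ hNn]
      rcases le_total R 0 with hR0 | hR0
      · exact le_trans (mul_nonpos_of_nonpos_of_nonneg (mul_nonpos_of_nonpos_of_nonneg
          (by linarith) hb0.le) hNn.le) hℓ.le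
      · calc 2 * R * b n * N n = 2 * R * (b n * N n) := by ring
          _ ≤ 2 * R * (b n * (n : ℝ) ^ (κ₂ / d)) := by gcongr
          _ ≤ ℓ := h4
    · rw [hrate n hn]
      have := mul_le_mul_of_nonneg_left h3 hA0.le
      calc τ * CA * x n ^ (β / E) = A n - A n * (1 - τ) := by simp only [A]; ring
        _ ≤ A n - A n * (H * (b n ^ d * I)) := by linarith
        _ = _ := by ring
    · linarith
    · rw [EReal.coe_le_coe_iff]
      gcongr
      exact hα n
  refine (limsup_le_limsup hle).trans (le_of_eq ?_)
  exact (continuous_coe_real_ereal.continuousAt.tendsto.comp herr).limsup_eq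

/-! ### The sharp constant and the final assembly -/

theorem minimalPower_mono_radius {m n : ℕ} {h : Euc d → ℝ} {β L : ℝ} {J : Set (Euc d)} {r r' : ℝ}
    (hr : r ≤ r') {ψ : (Fin n → Euc d) → ℝ} :
    minimalPower m n h β L J r ψ ≤ minimalPower m n h β L J r' ψ :=
  biInf_mono fun _ hpq => ⟨hpq.1, hr.trans hpq.2⟩

theorem rate_nonneg (d : ℕ) (β : ℝ) {m n : ℕ} (hm : m ≤ n) : 0 ≤ rate d β m n := by
  have h1 : (0 : ℝ) ≤ n - m := sub_nonneg.2 (by exact_mod_cast hm)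
  have h2 := Real.log_natCast_nonneg n
  unfold rate
  positivity

/-- The right-hand side is n λ(1 - λ) with λ = m/n, and λ is eventually bounded away from 0 and 1.
Hence the effective sample size is at least of order n. -/
theorem eventually_mul_le_harmonic {m : ℕ → ℕ} (hm : ∀ n, m n ≤ n)
    (hm_inf : 0 < liminf (fun n => (m n : ℝ) / n) atTop)
    (hm_sup : limsup (fun n => (m n : ℝ) / n) atTop < 1) :
    ∃ l : ℝ, 0 < l ∧ ∀ᶠ n : ℕ in atTop, l * n ≤ (m n : ℝ) * ((n : ℝ) - m n) / n := by
  have hb0 : ∀ n, (0 : ℝ) ≤ (m n : ℝ) / n := fun n => by positivity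
  have hb1 : ∀ n, (m n : ℝ) / n ≤ 1 := fun n =>
    div_le_one_of_le₀ (by exact_mod_cast hm n) (Nat.cast_nonneg n)
  obtain ⟨l₁, hl₁, hl₁'⟩ := exists_between hm_inf
  obtain ⟨l₂, hl₂, hl₂'⟩ := exists_between hm_sup
  have h1 := eventually_lt_of_lt_liminf hl₁' (isBoundedUnder_of ⟨0, hb0⟩)
  have h2 := eventually_lt_of_limsup_lt hl₂ (isBoundedUnder_of ⟨1, hb1⟩)
  refine ⟨l₁ * (1 - l₂), mul_pos hl₁ (sub_pos.2 hl₂'), ?_⟩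
  filter_upwards [h1, h2, eventually_gt_atTop 0] with n h1 h2 hn
  have hn' : (0 : ℝ) < n := by exact_mod_cast hn
  have e : (m n : ℝ) * ((n : ℝ) - m n) / n = (m n : ℝ) / n * (1 - (m n : ℝ) / n) * n := by
    field_simp
  rw [e]
  gcongr

/-- A compactly supported profile, and scaling constants, that nearly attain the sharp constant. -/
theorem exists_profile (hd : 0 < d) {β L : ℝ} (hβ : 0 < β) (hL : 0 < L) {γ : Euc d → ℝ}
    (hγ : IsOptimalRecovery β γ) {δ : ℝ} (hδ : 0 < δ) :
    ∃ (f : Euc d → ℝ) (Lf CA Cb τ : ℝ), f ∈ holderClass β Lf Set.univ ∧ 1 ≤ f 0 ∧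
      HasCompactSupport f ∧ ∫ x, f x ^ 2 ≤ (eLpNorm γ 2 volume).toReal ^ 2 ∧ 0 < CA ∧ 0 < Cb ∧
      τ < 1 ∧ CA * Lf * Cb⁻¹ ^ β ≤ L ∧
      CA ^ 2 * Cb ^ d * (eLpNorm γ 2 volume).toReal ^ 2 / 2 < d / (2 * β + d) ∧
      (1 - δ) * sharpConst β L γ ≤ τ * CA := by
  have hg0 := hγ.norm_pos
  obtain ⟨hγH, hγ0, hγ2, -⟩ := hγ
  set g := (eLpNorm γ 2 volume).toReal with hg
  have hg2 : ∫ x, γ x ^ 2 = g ^ 2 := by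
    have h1 := hγ2.eLpNorm_eq_integral_rpow_norm two_ne_zero ENNReal.ofNat_ne_top
    rw [hg, h1, ENNReal.toReal_ofReal (by positivity)]
    simp only [ENNReal.toReal_ofNat, Real.rpow_two, Real.norm_eq_abs, sq_abs]
    rw [← Real.rpow_natCast, ← Real.rpow_mul (integral_nonneg fun _ => sq_nonneg _)]
    norm_num
  have hd' : (0 : ℝ) < d := by exact_mod_cast hd
  set E : ℝ := 2 * β + d with hE
  have hE0 : 0 < E := by positivity
  set c := sharpConst β L γ with hc
  have hbase : 0 < 2 * d * L ^ ((d : ℝ) / β) / (E * g ^ 2) := by positivity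
  have hc0 : 0 < c := Real.rpow_pos_of_pos hbase _
  have hcE : c ^ (E / β) = 2 * d * L ^ ((d : ℝ) / β) / (E * g ^ 2) := by
    rw [hc, sharpConst, ← Real.rpow_mul hbase.le]
    have : β / (2 * β + d) * (E / β) = 1 := by
      rw [← hE]; field_simp
    rw [this, Real.rpow_one]
  -- the slack
  set δ' := min δ (1 / 2)
  have hδ'0 : 0 < δ' := lt_min hδ (by norm_num)
  have hδ'1 : δ' ≤ 1 / 2 := min_le_right _ _
  -- The slack is split: the factor η lowers the amplitude below the critical one, and τ = (1 -
  -- δ')/η < 1 leaves room for the loss of height by centring.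
  set η := 1 - δ' / 2
  have hη0 : 0 < η := by simp only [η]; linarith
  have hη1 : η < 1 := by simp only [η]; linarith
  have hηE : η ^ (E / β) < 1 := Real.rpow_lt_one hη0.le hη1 (by positivity)
  obtain ⟨ε, hε0, hε⟩ : ∃ ε : ℝ, 0 < ε ∧ η ^ (E / β) * (1 + ε) ^ ((d : ℝ) / β) < 1 := by
    have hlim : Tendsto (fun ε : ℝ => η ^ (E / β) * (1 + ε) ^ ((d : ℝ) / β)) (𝓝[>] 0)
        (𝓝 (η ^ (E / β))) := by
      have hcont : ContinuousAt (fun ε : ℝ => η ^ (E / β) * (1 + ε) ^ ((d : ℝ) / β)) 0 :=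
        continuousAt_const.mul ((continuousAt_const.add continuousAt_id).rpow_const
          (Or.inr (by positivity)))
      have := hcont.tendsto.mono_left (nhdsWithin_le_nhds (s := Set.Ioi 0))
      simpa using this
    obtain ⟨ε, h1, h2⟩ := ((hlim.eventually (eventually_lt_nhds hηE)).and
      self_mem_nhdsWithin).exists
    exact ⟨ε, h2, h1⟩
  obtain ⟨f, hf, hf0, hfc, hfγ⟩ := exists_compactSupport_approx hβ hγH hγ0 hγ2 hε0
  have hCA : 0 < η * c := by positivity
  -- The bandwidth constant Cb = w^(1/β) gives Cb^(-β) = 1/w, so the scaled profile uses up the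
  -- Hölder constant L exactly.
  set w := η * c * (1 + ε) / L with hw
  have hw0 : 0 < w := by positivity
  refine ⟨f, 1 + ε, η * c, w ^ (1 / β), (1 - δ') / η, hf, hf0, hfc, hfγ.trans hg2.le, hCA,
    Real.rpow_pos_of_pos hw0 _, ?_, ?_, ?_, ?_⟩
  · rw [div_lt_one hη0]
    simp only [η]
    linarith
  · rw [Real.inv_rpow (by positivity), ← Real.rpow_mul hw0.le, one_div_mul_cancel hβ.ne',
      Real.rpow_one, hw]
    apply le_of_eq
    field_simp
  · have h1 : (w ^ (1 / β)) ^ d = w ^ ((d : ℝ) / β) := by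
      rw [← Real.rpow_natCast, ← Real.rpow_mul hw0.le, one_div_mul_eq_div]
    have h2 : w ^ ((d : ℝ) / β) =
        (η * c) ^ ((d : ℝ) / β) * (1 + ε) ^ ((d : ℝ) / β) / L ^ ((d : ℝ) / β) := by
      rw [hw, Real.div_rpow (by positivity) hL.le, Real.mul_rpow hCA.le (by positivity)]
    -- The identity 2 + d/β = (2β+d)/β collects the powers of the height, so that c^((2β+d)/β) can
    -- be replaced by its explicit value.
    have h3 : (η * c) ^ 2 * (η * c) ^ ((d : ℝ) / β) = η ^ (E / β) * c ^ (E / β) := by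
      rw [← Real.rpow_natCast, ← Real.rpow_add hCA, ← Real.mul_rpow hη0.le hc0.le]
      congr 1
      rw [hE]
      push_cast
      field_simp
    have hL' : 0 < L ^ ((d : ℝ) / β) := Real.rpow_pos_of_pos hL _
    rw [h1, h2]
    calc _ = ((η * c) ^ 2 * (η * c) ^ ((d : ℝ) / β)) * (1 + ε) ^ ((d : ℝ) / β) /
          L ^ ((d : ℝ) / β) * g ^ 2 / 2 := by ring
      _ = (η ^ (E / β) * (1 + ε) ^ ((d : ℝ) / β)) * (d / E) := by
        rw [h3, hcE]
        field_simp
      _ < d / E := mul_lt_of_lt_one_left (by positivity) hε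
  · have h1 : (1 - δ') / η * (η * c) = (1 - δ') * c := by field_simp
    rw [h1]
    have : δ' ≤ δ := min_le_left _ _
    gcongr

end TwoSample

end

theorem mainTheorem3
    (d : ℕ) (hd : 0 < d) (β L : ℝ) (hβ : 0 < β) (hL : 0 < L)
    (α : ℝ) (hα : α ∈ Set.Ioo (0 : ℝ) 1)
    -- the size of the first sample
    (m : ℕ → ℕ) (hm : ∀ n, m n ≤ n)
    (hm_inf : 0 < liminf (fun n => (m n : ℝ) / n) atTop)
    (hm_sup : limsup (fun n => (m n : ℝ) / n) atTop < 1)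
    -- the mixed densities
    (h : ℕ → TwoSample.Euc d → ℝ) (h_dens : ∀ n, TwoSample.IsDensity (h n))
    (h_equi : EquicontinuousOn h (TwoSample.unitCube d))
    (h_pos : ∃ κ : ℝ, 0 < κ ∧ ∀ n, ∀ x ∈ TwoSample.unitCube d, κ ≤ h n x) :
    (∃ γ : TwoSample.Euc d → ℝ, TwoSample.IsOptimalRecovery β γ) ∧
    ∀ γ : TwoSample.Euc d → ℝ, TwoSample.IsOptimalRecovery β γ →
      ∀ δ : ℝ, 0 < δ →
      ∀ J : Set (TwoSample.Euc d), J ⊆ TwoSample.unitCube d →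
        TwoSample.IsNondegenerateRectangle J →
      ∀ ψ : (n : ℕ) → (Fin n → TwoSample.Euc d) → ℝ, (∀ n, TwoSample.IsTest (ψ n)) →
        (∀ n, ∫ x, ψ n x ∂(TwoSample.sampleLaw (m n) n (h n) (h n)) ≤ α) →
        limsup (fun n => TwoSample.minimalPower (m n) n (h n) β L J
            ((1 - δ) * TwoSample.sharpConst β L γ * TwoSample.rate d β (m n) n) (ψ n)) atTop
          ≤ (α : EReal) := by
  refine ⟨TwoSample.exists_isOptimalRecovery d hβ, fun γ hγ δ hδ J _ hJ ψ hψ hψα => ?_⟩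
  obtain ⟨κ, hκ, hκh⟩ := h_pos
  obtain ⟨l, hl, hml⟩ := TwoSample.eventually_mul_le_harmonic hm hm_inf hm_sup
  obtain ⟨f, Lf, CA, Cb, τ, hf, hf0, hfc, hfG, hCA, hCb, hτ, hL, hΘ, hδτ⟩ :=
    TwoSample.exists_profile hd hβ hL hγ hδ
  -- The profile gives the bound at the larger radius τ CA ρ; at a smaller radius the infimum runs
  -- over more pairs and can only decrease.
  refine le_trans (limsup_le_limsup (Eventually.of_forall fun n =>
    TwoSample.minimalPower_mono_radius ?_)) (TwoSample.limsup_minimalPower_le_of_profile hd hβ hm hl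
    hml h_dens h_equi hκ hκh hJ hf hf0 hfc hfG hCA hCb hτ hL hΘ hψ hψα)
  exact mul_le_mul_of_nonneg_right hδτ (TwoSample.rate_nonneg d β (hm n))
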